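/- Let $\mathcal H$ be a Hilbert space. **The function $\mu$.** Let $\widetilde X_\infty$ be the set of functions $f:(0,2\pi)\to\mathbb Z$ that are left continuous and non-increasing, with the metric $\widetilde\rho(f,g)=\sup_{n\in\mathbb Z}|\nu(n;f)-\nu(n;g)|$, where $\nu(n;f)=\sup(\{0\}\cup\{\theta\in(0,2\pi): f(\theta)>n\})$. Let $X_\infty$ be the quotient of $\widetilde X_\infty$ by the addition of integer constants, with the quotient metric. For a unitary $W$ with $W-I$ compact let $\eta(W)\in X_\infty$ be the class of $\theta\mapsto N(e^{i\theta},-1;W)$, where for angles $a,b\in(0,2\pi)$ the integer $N(e^{ia},e^{ib};W)$ is the number of eigenvalues of $W$ (with multiplicity) on the arc $\{e^{it}:a\le t<b\}$ if $a<b$, is $0$ if $a=b$, and is $-N(e^{ib},e^{ia};W)$ if $a>b$. For self-adjoint $H_0,H$ and $\operatorname{Im}z>0$ put $$M(z;H,H_0)=\bigl(I+(z-\bar z)(H-z)^{-1}\bigr)\bigl(I+(\bar z-z)(H_0-\bar z)^{-1}\bigr).$$ Let $\lambda\in\mathbb R$. One says that $\mu(\cdot;\lambda,H,H_0)$ is *well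 defined* if (i) $(H-z)^{-1}-(H_0-z)^{-1}$ is compact for all $z\in\rho(H)\cap\rho(H_0)$, (ii) $y\,\|(H-(l+iy))^{-1}-(H_0-(l+iy))^{-1}\|\to0$ as $y\to+\infty$ for all $l\in\mathbb R$, and (iii) $\lim_{y\to0+}\eta(M(\lambda+iy;H,H_0))$ exists in $X_\infty$. Then the operators $M(\lambda+iy;H,H_0)$, $y>0$, are unitary with $M-I$ compact, the path $t\mapsto\eta(M(\lambda+i(1-t)t^{-1};H,H_0))$, $0<t<1$, extends to a continuous path $[0,1]\to X_\infty$, this path has a continuous lift $\widetilde\gamma:[0,1]\to\widetilde X_\infty$, and one defines $\mu(\theta;\lambda,H,H_0)=\widetilde\gamma(1)(\theta)-\widetilde\gamma(0)(\theta)$ for $\theta\in(0,2\pi)$. **The family.** Let $H(\alpha)$, $\alpha\in[0,1]$, be self-adjoint operators in $\mathcal H$ such that 1. $(H(\alpha)-z)^{-1}-(H(0)-z)^{-1}$ is compact for all $\alpha\in[0,1]$ and $\operatorname{Im}z>0$; 2. $\alpha\mapsto(H(\alpha)-z)^{-1}$ is continuous in the operator norm for every $z$ with $\operatorname{Im}z>0$;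 3. $\lim_{y\to+\infty}\sup_{\alpha\in[0,1]}y\,\|(H(\alpha)-(\lambda+iy))^{-1}-(H(0)-(\lambda+iy))^{-1}\|=0$ for every $\lambda\in\mathbb R$. By 1, all the $H(\alpha)$ have the same essential spectrum. Let $\Delta\subset\mathbb R$ be a bounded interval with more than one point whose closure does not meet this essential spectrum. **The spectral flow of the family.** Let $\widetilde X$ be the set of bounded, left continuous, non-decreasing functions $\Delta\to\mathbb Z$ with the topology of $L_1(\Delta)$, and let $X$ be its quotient by the addition of integer constants. For a self-adjoint operator $A$ let $N(a,b;A)$ be the rank of the spectral projection $E_A([a,b))$ if $a<b$, $0$ if $a=b$, and $-N(b,a;A)$ if $a>b$. Let $\gamma(\alpha)\in X$ be the class of $N(\lambda_0,\cdot\,;H(\alpha))$, where $\lambda_0\in\Delta\cap\rho(H(\alpha))$. If $\gamma$ is continuous and $\widetilde\gamma:[0,1]\to\widetilde X$ is a continuous lift of $\gamma$, the spectral flow of the family through $\lambda\in\Delta$ is $\operatorname{sf}(\lambda;H)=\widetilde\gamma(1)(\lambda)-\widetilde\gamma(0)(\lambda)$. **Theorem.** For all $\alpha\in[0,1]$ and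 $\lambda\in\Delta$ the function $\mu(\cdot;\lambda,H(\alpha),H(0))$ is well defined, and for every $\theta\in(0,2\pi)$ the mapping $$[0,1]\ni\alpha\mapsto\mu(\theta;\cdot,H(\alpha),H(0))\in L_1(\Delta)$$ takes its values in $L_1(\Delta)$ and is continuous. Consequently: the elements $\gamma(\alpha)$ exist (they do not depend on $\lambda_0$), $\gamma$ is continuous and has a continuous lift, the set $\Delta\cap(\sigma(H(0))\cup\sigma(H(1)))$ is finite, and $$\mu(\theta;\lambda,H(1),H(0))=\operatorname{sf}(\lambda;H)\qquad\text{for all }\theta\in(0,2\pi)\text{ and all }\lambda\in\Delta\cap\rho(H(0))\cap\rho(H(1)).$$ -/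

import Mathlib

open Set Filter Topology MeasureTheory
open scoped ComplexConjugate ENNReal

noncomputable section

namespace PushFlow

/-- Integer valued functions on the unit circle without the point `1`, written in the angle
`θ ∈ (0, 2π)`, that are left continuous and non-increasing in `θ`. -/
structure CircleFun where
  toFun : Ioo (0 : ℝ) (2 * Real.pi) → ℤ
  antitone' : Antitone toFun
  leftCont' : ∀ θ, ContinuousWithinAt toFun (Iic θ) θ

namespace CircleFun

instance : CoeFun CircleFun (fun _ => Ioo (0 : ℝ) (2 * Real.pi) → ℤ) := ⟨toFun⟩

theorem ext' {f g : CircleFun} (h : ∀ θ, f θ = g θ) : f = g := by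
  cases f; cases g; congr; exact funext h

/-- `ν(n; f) = sup ({0} ∪ {θ ∈ (0, 2π) | f(θ) > n})`. -/
def nu (f : CircleFun) (n : ℤ) : ℝ :=
  sSup ({0} ∪ {t : ℝ | ∃ h : t ∈ Ioo (0 : ℝ) (2 * Real.pi), n < f ⟨t, h⟩})

theorem bddAbove_nu (f : CircleFun) (n : ℤ) :
    BddAbove ({0} ∪ {t : ℝ | ∃ h : t ∈ Ioo (0 : ℝ) (2 * Real.pi), n < f ⟨t, h⟩}) := by
  refine ⟨2 * Real.pi, ?_⟩
  rintro t (rfl | ⟨h, -⟩)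
  · positivity
  · exact h.2.le

theorem nu_mem (f : CircleFun) (n : ℤ) : f.nu n ∈ Icc (0 : ℝ) (2 * Real.pi) := by
  refine ⟨le_csSup (f.bddAbove_nu n) (Or.inl rfl), csSup_le ⟨0, Or.inl rfl⟩ ?_⟩
  rintro t (rfl | ⟨h, -⟩)
  · positivity
  · exact h.2.le

theorem lt_iff_le_nu (f : CircleFun) (n : ℤ) (θ : Ioo (0 : ℝ) (2 * Real.pi)) :
    n < f θ ↔ (θ : ℝ) ≤ f.nu n := by
  refine ⟨fun h => le_csSup (f.bddAbove_nu n) (Or.inr ⟨θ.2, h⟩), fun h => ?_⟩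
  have h1 : ∀ t : Ioo (0 : ℝ) (2 * Real.pi), t < θ → n < f t := by
    intro t ht
    have ht' : (t : ℝ) < f.nu n := lt_of_lt_of_le ht h
    obtain ⟨s, hs, hts⟩ := exists_lt_of_lt_csSup
      (s := {0} ∪ {t : ℝ | ∃ h : t ∈ Ioo (0 : ℝ) (2 * Real.pi), n < f ⟨t, h⟩})
      ⟨0, Or.inl rfl⟩ ht'
    rcases hs with hs | ⟨hs, hs'⟩
    · have : s = 0 := hs
      subst this
      exact absurd t.2.1 (not_lt.mpr hts.le)
    · exact lt_of_lt_of_le hs' (f.antitone' (show t ≤ ⟨s, hs⟩ from hts.le))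
  have h2 : ∀ᶠ t in 𝓝[≤] θ, f t = f θ :=
    (f.leftCont' θ).eventually (p := fun m => m = f θ) (by simp [nhds_discrete])
  have hne : (𝓝[<] θ).NeBot := by
    have : (Iio θ).Nonempty :=
      ⟨⟨θ / 2, by have := θ.2.1; constructor <;> have := θ.2.2 <;> linarith⟩, by
        have := θ.2.1
        show (θ : ℝ) / 2 < θ
        linarith⟩
    exact nhdsLT_neBot_of_exists_lt this
  have h3 : ∀ᶠ t in 𝓝[<] θ, f t = f θ := h2.filter_mono (nhdsWithin_mono _ Iio_subset_Iic_self)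
  obtain ⟨t, ht, ht'⟩ := (h3.and self_mem_nhdsWithin).exists
  exact ht ▸ h1 t ht'

theorem nu_injective {f g : CircleFun} (h : f.nu = g.nu) : f = g := by
  apply ext'
  intro θ
  have : ∀ n, n < f θ ↔ n < g θ := fun n => by rw [lt_iff_le_nu, lt_iff_le_nu, h]
  exact le_antisymm (by by_contra! hc; exact lt_irrefl _ ((this _).1 hc))
    (by by_contra! hc; exact lt_irrefl _ ((this _).2 hc))

/-- The sequence `ν(·; f)` as an element of `ℓ^∞(ℤ)`. -/
def nuLp (f : CircleFun) : lp (fun _ : ℤ => ℝ) ∞ :=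
  ⟨f.nu, memℓp_infty ⟨2 * Real.pi, by
    rintro _ ⟨n, rfl⟩
    change ‖f.nu n‖ ≤ _
    rw [Real.norm_eq_abs, abs_of_nonneg (f.nu_mem n).1]
    exact (f.nu_mem n).2⟩⟩

/-- The metric `‖ν(·; f) - ν(·; g)‖` in `ℓ^∞(ℤ)`. -/
instance : MetricSpace CircleFun :=
  MetricSpace.induced nuLp
    (fun _ _ h => nu_injective (congrArg (fun a : lp (fun _ : ℤ => ℝ) ∞ => (a : ℤ → ℝ)) h))
    inferInstance

theorem dist_eq (f g : CircleFun) : dist f g = ⨆ n : ℤ, |f.nu n - g.nu n| := by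
  change dist f.nuLp g.nuLp = _
  rw [dist_eq_norm, lp.norm_eq_ciSup]
  rfl

/-- Adding an integer constant. -/
def shift (m : ℤ) (f : CircleFun) : CircleFun where
  toFun θ := f θ + m
  antitone' _ _ h := by simpa using f.antitone' h
  leftCont' θ := (f.leftCont' θ).add continuousWithinAt_const

theorem nu_shift (m : ℤ) (f : CircleFun) (n : ℤ) : (f.shift m).nu n = f.nu (n - m) := by
  simp only [nu, shift]
  congr 2
  ext t
  simp only [mem_ofPred_eq]
  exact exists_congr fun _ => by constructor <;> intro h <;> linarith

theorem dist_shift (m : ℤ) (f g : CircleFun) : dist (f.shift m) (g.shift m) = dist f g := by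
  simp only [dist_eq, nu_shift]
  exact (Equiv.subRight m).iSup_comp (g := fun n => |f.nu n - g.nu n|)

/-- Equality up to an integer constant. -/
def rel : Setoid CircleFun where
  r f g := ∃ n : ℤ, ∀ θ, f θ = g θ + n
  iseqv :=
    { refl := fun _ => ⟨0, by simp⟩
      symm := by
        rintro f g ⟨n, h⟩
        exact ⟨-n, fun θ => by rw [h θ]; ring⟩
      trans := by
        rintro f g k ⟨n, h⟩ ⟨m, h'⟩
        exact ⟨m + n, fun θ => by rw [h θ, h' θ]; ring⟩ }

end CircleFun

/-- Functions on the punctured circle modulo integer constants. -/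
def CircleClass : Type := Quotient CircleFun.rel

namespace CircleClass

/-- The projection onto the quotient. -/
def proj (f : CircleFun) : CircleClass := Quotient.mk CircleFun.rel f

theorem proj_surjective : Function.Surjective proj := Quotient.mk_surjective

theorem proj_eq_iff {f g : CircleFun} : proj f = proj g ↔ ∃ n : ℤ, f = g.shift n := by
  refine Quotient.eq.trans ⟨?_, ?_⟩
  · rintro ⟨n, h⟩
    exact ⟨n, CircleFun.ext' h⟩
  · rintro ⟨n, rfl⟩
    exact ⟨n, fun _ => rfl⟩

instance : TopologicalSpace CircleClass :=
  inferInstanceAs (TopologicalSpace (Quotient CircleFun.rel))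

/-- The quotient distance: the infimum of the distances of representatives. -/
def rho (x y : CircleClass) : ℝ :=
  sInf {r : ℝ | ∃ f g : CircleFun, proj f = x ∧ proj g = y ∧ r = dist f g}

theorem rho_bddBelow (x y : CircleClass) :
    BddBelow {r : ℝ | ∃ f g : CircleFun, proj f = x ∧ proj g = y ∧ r = dist f g} :=
  ⟨0, by rintro _ ⟨f, g, -, -, rfl⟩; exact dist_nonneg⟩

theorem rho_lt {x y : CircleClass} {r : ℝ} (f : CircleFun) (hf : proj f = x) (h : rho x y < r) :
    ∃ g, proj g = y ∧ dist f g < r := by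
  obtain ⟨f₀, rfl⟩ := proj_surjective x
  obtain ⟨g₀, rfl⟩ := proj_surjective y
  obtain ⟨_, ⟨f', g', hf', hg', rfl⟩, hr⟩ := exists_lt_of_csInf_lt
    (s := {r : ℝ | ∃ f g : CircleFun, proj f = proj f₀ ∧ proj g = proj g₀ ∧ r = dist f g})
    ⟨_, f₀, g₀, rfl, rfl, rfl⟩ h
  obtain ⟨n, rfl⟩ := proj_eq_iff.1 (hf.trans hf'.symm)
  exact ⟨g'.shift n, (proj_eq_iff.2 ⟨n, rfl⟩).trans hg', by rwa [CircleFun.dist_shift]⟩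

theorem rho_le (f g : CircleFun) : rho (proj f) (proj g) ≤ dist f g :=
  csInf_le (rho_bddBelow _ _) ⟨f, g, rfl, rfl, rfl⟩

/-- The metric structure `rho` on the quotient; its topology is (provably, by the last field) the
quotient topology. -/
instance : PseudoMetricSpace CircleClass :=
  PseudoMetricSpace.ofDistTopology rho
    (fun x => by
      obtain ⟨f, rfl⟩ := proj_surjective x
      refine le_antisymm (by simpa using rho_le f f) (Real.sInf_nonneg ?_)
      rintro _ ⟨f, g, -, -, rfl⟩
      exact dist_nonneg)
    (fun x y => by
      unfold rho
      congr 1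
      ext r
      constructor <;> rintro ⟨f, g, hf, hg, rfl⟩ <;> exact ⟨g, f, hg, hf, dist_comm _ _⟩)
    (fun x y z => by
      refine le_of_forall_pos_le_add fun ε hε => ?_
      obtain ⟨f, rfl⟩ := proj_surjective x
      obtain ⟨g, rfl, hg⟩ := rho_lt (y := y) f rfl (lt_add_of_pos_right _ (half_pos hε))
      obtain ⟨k, rfl, hk⟩ := rho_lt (y := z) g rfl (lt_add_of_pos_right _ (half_pos hε))
      have := rho_le f k
      have := dist_triangle f g k
      linarith)
    (fun s => by
      change IsOpen (proj ⁻¹' s) ↔ _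
      rw [Metric.isOpen_iff]
      constructor
      · intro h x hx
        obtain ⟨f, rfl⟩ := proj_surjective x
        obtain ⟨ε, hε, hs⟩ := h f hx
        refine ⟨ε, hε, fun y hy => ?_⟩
        obtain ⟨g, rfl, hg⟩ := rho_lt f rfl hy
        exact hs (by rwa [Metric.mem_ball, dist_comm])
      · intro h f hf
        obtain ⟨ε, hε, hs⟩ := h _ hf
        refine ⟨ε, hε, fun g hg => hs _ (lt_of_le_of_lt (rho_le f g) ?_)⟩
        rwa [Metric.mem_ball, dist_comm] at hg)

end CircleClass
/-! ### Unitary operators -/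

set_option linter.unusedSectionVars false

variable {E : Type*} [NormedAddCommGroup E] [InnerProductSpace ℂ E] [CompleteSpace E]

/-- The unitary operators `W` such that `W - I` is compact. -/
def unitaryCompact (E : Type*) [NormedAddCommGroup E] [InnerProductSpace ℂ E] [CompleteSpace E] :
    Set (E →L[ℂ] E) :=
  {W | W ∈ unitary (E →L[ℂ] E) ∧ IsCompactOperator ⇑(W - 1)}

/-- `Ker (W - exp(iθ) I)`. -/
def angleSpace (W : E →L[ℂ] E) (θ : ℝ) : Submodule ℂ E :=
  Module.End.eigenspace (W : E →ₗ[ℂ] E) (Complex.exp (θ * Complex.I))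

/-- The span of the eigenvectors of `W` with eigenvalues on the arc `[exp(ia), exp(ib))`. If `W` is
unitary, `W - I` is compact and `0 < a`, `b < 2π`, then `W` has pure point spectrum on this arc, and
this (finite dimensional) space is the range of the spectral projection of the arc. -/
def arcSpace (W : E →L[ℂ] E) (a b : ℝ) : Submodule ℂ E := ⨆ θ ∈ Ico a b, angleSpace W θ

/-- `N(exp(ia), exp(ib); W)`: the rank of the spectral projection of `W` on `[exp(ia), exp(ib))` if
`a < b`, zero if `a = b`, and minus the rank of the projection on `[exp(ib), exp(ia))` if `b < a`
(one of the two spaces is always zero). -/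
def arcCount (W : E →L[ℂ] E) (a b : ℝ) : ℤ :=
  (Module.finrank ℂ (arcSpace W a b) : ℤ) - Module.finrank ℂ (arcSpace W b a)

theorem exp_ne_of_ne {a b : ℝ} (ha : a ∈ Ioo (0 : ℝ) (2 * Real.pi))
    (hb : b ∈ Ioo (0 : ℝ) (2 * Real.pi)) (h : a ≠ b) :
    Complex.exp (a * Complex.I) ≠ Complex.exp (b * Complex.I) := by
  intro he
  obtain ⟨n, hn⟩ := Complex.exp_eq_exp_iff_exists_int.1 he
  have h1 : (a : ℂ) = b + n * (2 * Real.pi) := by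
    apply mul_right_cancel₀ Complex.I_ne_zero
    rw [hn]; ring
  have h2 : a = b + n * (2 * Real.pi) := by exact_mod_cast h1
  have hpi := Real.pi_pos
  have h3 : n < 1 := by
    by_contra! hc
    have : (1 : ℝ) ≤ n := by exact_mod_cast hc
    nlinarith [ha.2, hb.1]
  have h4 : -1 < n := by
    by_contra! hc
    have : (n : ℝ) ≤ -1 := by exact_mod_cast hc
    nlinarith [ha.1, hb.2]
  have : n = 0 := by omega
  subst this
  simp at h2
  exact h h2

theorem mem_angleSpace {W : E →L[ℂ] E} {θ : ℝ} {x : E} :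
    x ∈ angleSpace W θ ↔ W x = Complex.exp (θ * Complex.I) • x :=
  Module.End.mem_eigenspace_iff

theorem inner_eq_zero_of_ne {W : E →L[ℂ] E} (hW : W ∈ unitary (E →L[ℂ] E)) {a b : ℝ}
    (ha : a ∈ Ioo (0 : ℝ) (2 * Real.pi)) (hb : b ∈ Ioo (0 : ℝ) (2 * Real.pi)) (h : a ≠ b)
    {x y : E} (hx : x ∈ angleSpace W a) (hy : y ∈ angleSpace W b) : inner ℂ x y = 0 := by
  have h1 : inner ℂ (W x) (W y) = inner ℂ x y := by
    rw [← ContinuousLinearMap.adjoint_inner_right]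
    have : (ContinuousLinearMap.adjoint W * W) y = y := by
      rw [← ContinuousLinearMap.star_eq_adjoint, (Unitary.mem_iff.1 hW).1]; rfl
    rw [← mul_apply_eq_comp, this]
  rw [mem_angleSpace.1 hx, mem_angleSpace.1 hy, inner_smul_left, inner_smul_right, ← mul_assoc] at h1
  by_contra hne
  have h2 : conj (Complex.exp (a * Complex.I)) * Complex.exp (b * Complex.I) = 1 :=
    mul_right_cancel₀ hne (by rw [h1, one_mul])
  have h3 : Complex.exp (a * Complex.I) * conj (Complex.exp (a * Complex.I)) = 1 := by
    rw [Complex.mul_conj, Complex.normSq_eq_norm_sq, Complex.norm_exp_ofReal_mul_I]; simp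
  apply exp_ne_of_ne ha hb h
  calc Complex.exp (a * Complex.I)
      = Complex.exp (a * Complex.I) *
        (conj (Complex.exp (a * Complex.I)) * Complex.exp (b * Complex.I)) := by rw [h2, mul_one]
    _ = _ := by rw [← mul_assoc, h3, one_mul]

theorem finiteDimensional_arcSpace {W : E →L[ℂ] E} (hW : W ∈ unitaryCompact E) {a b : ℝ}
    (ha : 0 < a) (hb : b < 2 * Real.pi) : FiniteDimensional ℂ (arcSpace W a b) := by
  have hsub : Icc a b ⊆ Ioo 0 (2 * Real.pi) := fun t ht => ⟨ha.trans_le ht.1, ht.2.trans_lt hb⟩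
  have hsub' : ∀ i : Ico a b, (i : ℝ) ∈ Ioo (0 : ℝ) (2 * Real.pi) :=
    fun i => hsub (Ico_subset_Icc_self i.2)
  -- a lower bound for the distance of the arc to the point one
  obtain ⟨δ, hδ, hδ'⟩ : ∃ δ > 0, ∀ t ∈ Icc a b, δ ≤ ‖Complex.exp (t * Complex.I) - 1‖ := by
    rcases (Icc a b).eq_empty_or_nonempty with he | hne
    · exact ⟨1, one_pos, by simp [he]⟩
    obtain ⟨t, ht, hmin⟩ := isCompact_Icc.exists_isMinOn hne
      (f := fun t : ℝ => ‖Complex.exp (t * Complex.I) - 1‖) (by fun_prop)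
    refine ⟨_, norm_pos_iff.2 (sub_ne_zero.2 fun h1 => ?_), fun s hs => hmin hs⟩
    obtain ⟨n, hn⟩ := Complex.exp_eq_one_iff.1 h1
    have h2 : t = n * (2 * Real.pi) := by
      have : (t : ℂ) = n * (2 * Real.pi) := by
        apply mul_right_cancel₀ Complex.I_ne_zero
        rw [hn]; ring
      exact_mod_cast this
    have hpi := Real.pi_pos
    have ht' := hsub ht
    have h3 : n < 1 := by
      by_contra! hc
      have : (1 : ℝ) ≤ n := by exact_mod_cast hc
      nlinarith [ht'.2]
    have h4 : 0 < n := by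
      by_contra! hc
      have : (n : ℝ) ≤ 0 := by exact_mod_cast hc
      nlinarith [ht'.1]
    omega
  have horth : OrthogonalFamily ℂ (fun i : Ico a b => angleSpace W i)
      fun i => (angleSpace W i).subtypeₗᵢ := by
    intro i j hij v w
    exact inner_eq_zero_of_ne hW.1 (hsub' i) (hsub' j) (fun h => hij (Subtype.ext h)) v.2 w.2
  have hbound : ∀ x ∈ arcSpace W a b, δ * ‖x‖ ≤ ‖(W - 1) x‖ := by
    intro x hx
    rw [arcSpace, iSup_subtype', Submodule.mem_iSup_iff_exists_finsupp] at hx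
    obtain ⟨f, hf, rfl⟩ := hx
    let l : ∀ i : Ico a b, angleSpace W i := fun i => ⟨f i, hf i⟩
    let l' : ∀ i : Ico a b, angleSpace W i := fun i => (Complex.exp (i * Complex.I) - 1) • l i
    have e1 : ‖f.sum fun _ xi => xi‖ ^ 2 = ∑ i ∈ f.support, ‖l i‖ ^ 2 :=
      horth.norm_sum l f.support
    have e2 : ‖(W - 1) (f.sum fun _ xi => xi)‖ ^ 2 = ∑ i ∈ f.support, ‖l' i‖ ^ 2 := by
      rw [← horth.norm_sum l' f.support, Finsupp.sum, map_sum]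
      congr 2
      refine Finset.sum_congr rfl fun i _ => ?_
      change W (f i) - f i = (Complex.exp (i * Complex.I) - 1) • f i
      rw [mem_angleSpace.1 (hf i), sub_smul, one_smul]
    refine le_of_sq_le_sq ?_ (norm_nonneg _)
    rw [mul_pow, e1, e2, Finset.mul_sum]
    refine Finset.sum_le_sum fun i _ => ?_
    rw [← mul_pow, norm_smul]
    gcongr
    exact hδ' i (Ico_subset_Icc_self i.2)
  obtain ⟨K, hK, hKs⟩ := hW.2
  obtain ⟨r, hr, hrs⟩ := Metric.mem_nhds_iff.1 hKs
  let T : arcSpace W a b →L[ℂ] E := (W - 1).comp (arcSpace W a b).subtypeL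
  have hanti : AntilipschitzWith (Real.toNNReal δ⁻¹) T := by
    refine T.antilipschitz_of_bound fun x => ?_
    rw [Real.coe_toNNReal _ (inv_nonneg.2 hδ.le), inv_mul_eq_div, le_div_iff₀ hδ, mul_comm]
    exact hbound x x.2
  refine FiniteDimensional.of_totallyBounded_nhds_zero ℂ
    (U := Metric.ball (0 : arcSpace W a b) r) (Metric.ball_mem_nhds _ hr) ?_
  refine (totallyBounded_preimage (hanti.isUniformInducing T.uniformContinuous)
    hK.totallyBounded).subset fun x hx => ?_
  exact hrs (by simpa using hx)

theorem finite_angles {W : E →L[ℂ] E} (hW : W ∈ unitaryCompact E) {a b : ℝ}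
    (ha : 0 < a) (hb : b < 2 * Real.pi) : {θ | θ ∈ Ico a b ∧ angleSpace W θ ≠ ⊥}.Finite := by
  have := finiteDimensional_arcSpace hW ha hb
  have hsub' : ∀ i : Ico a b, (i : ℝ) ∈ Ioo (0 : ℝ) (2 * Real.pi) :=
    fun i => ⟨ha.trans_le i.2.1, i.2.2.trans hb⟩
  have hex : ∀ θ : {θ | θ ∈ Ico a b ∧ angleSpace W θ ≠ ⊥}, ∃ x ∈ angleSpace W θ, x ≠ 0 :=
    fun θ => Submodule.exists_mem_ne_zero_of_ne_bot θ.2.2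
  choose v hv hv0 using hex
  have hinj : Function.Injective
      (fun θ : {θ | θ ∈ Ico a b ∧ angleSpace W θ ≠ ⊥} => Complex.exp ((θ : ℝ) * Complex.I)) := by
    intro i j hij
    by_contra hne
    exact exp_ne_of_ne ⟨ha.trans_le i.2.1.1, i.2.1.2.trans hb⟩
      ⟨ha.trans_le j.2.1.1, j.2.1.2.trans hb⟩ (fun h => hne (Subtype.ext h)) hij
  have hlin : LinearIndependent ℂ v :=
    Module.End.eigenvectors_linearIndependent' (W : E →ₗ[ℂ] E) _ hinj v fun θ => ⟨hv θ, hv0 θ⟩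
  have hmem : ∀ θ, v θ ∈ arcSpace W a b := fun θ =>
    (le_iSup₂_of_le (f := fun θ (_ : θ ∈ Ico a b) => angleSpace W θ) θ.1 θ.2.1 le_rfl) (hv θ)
  have hlin' : LinearIndependent ℂ fun θ => (⟨v θ, hmem θ⟩ : arcSpace W a b) :=
    LinearIndependent.of_comp (arcSpace W a b).subtype hlin
  exact Set.finite_coe_iff.1 hlin'.finite_of_isNoetherian

theorem arcSpace_mono {W : E →L[ℂ] E} {a b c d : ℝ} (hac : c ≤ a) (hbd : b ≤ d) :
    arcSpace W a b ≤ arcSpace W c d :=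
  biSup_mono fun _ ht => Ico_subset_Ico hac hbd ht

theorem arcCount_antitone {W : E →L[ℂ] E} (hW : W ∈ unitaryCompact E) {c : ℝ}
    (hc : c ∈ Ioo (0 : ℝ) (2 * Real.pi)) :
    Antitone fun θ : Ioo (0 : ℝ) (2 * Real.pi) => arcCount W θ c := by
  intro s t hst
  have := finiteDimensional_arcSpace hW s.2.1 hc.2
  have := finiteDimensional_arcSpace hW hc.1 t.2.2
  have h1 := Submodule.finrank_mono (arcSpace_mono (W := W) (show (s : ℝ) ≤ t from hst) le_rfl
    : arcSpace W t c ≤ arcSpace W s c)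
  have h2 := Submodule.finrank_mono (arcSpace_mono (W := W) le_rfl (show (s : ℝ) ≤ t from hst)
    : arcSpace W c s ≤ arcSpace W c t)
  simp only [arcCount]
  omega

theorem arcCount_eq {W : E →L[ℂ] E} {s t c : ℝ} (hst : s ≤ t)
    (h : ∀ θ ∈ Ico s t, angleSpace W θ = ⊥) : arcCount W s c = arcCount W t c := by
  have h1 : arcSpace W s c = arcSpace W t c := by
    refine le_antisymm (iSup₂_le fun θ hθ => ?_) (arcSpace_mono hst le_rfl)
    by_cases hlt : θ < t
    · rw [h θ ⟨hθ.1, hlt⟩]; exact bot_le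
    · exact le_iSup₂_of_le θ ⟨not_lt.1 hlt, hθ.2⟩ le_rfl
  have h2 : arcSpace W c s = arcSpace W c t := by
    refine le_antisymm (arcSpace_mono le_rfl hst) (iSup₂_le fun θ hθ => ?_)
    by_cases hlt : θ < s
    · exact le_iSup₂_of_le θ ⟨hθ.1, hlt⟩ le_rfl
    · rw [h θ ⟨not_lt.1 hlt, hθ.2⟩]; exact bot_le
  rw [arcCount, arcCount, h1, h2]

theorem arcCount_leftCont {W : E →L[ℂ] E} (hW : W ∈ unitaryCompact E) {c : ℝ}
    (θ : Ioo (0 : ℝ) (2 * Real.pi)) :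
    ContinuousWithinAt (fun θ : Ioo (0 : ℝ) (2 * Real.pi) => arcCount W θ c) (Iic θ) θ := by
  have hfin := finite_angles hW (a := θ / 2) (b := θ) (by linarith [θ.2.1]) θ.2.2
  have hopen : ({t | t ∈ Ico (θ / 2 : ℝ) θ ∧ angleSpace W t ≠ ⊥}ᶜ ∩ Ioi (θ / 2 : ℝ)) ∈ 𝓝 (θ : ℝ) :=
    (hfin.isClosed.isOpen_compl.inter isOpen_Ioi).mem_nhds
      ⟨fun h => lt_irrefl _ h.1.2, by have := θ.2.1; show (θ / 2 : ℝ) < θ; linarith⟩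
  obtain ⟨ε, hε, hsub⟩ := Metric.mem_nhds_iff.1 hopen
  refine (continuousWithinAt_const (b := arcCount W θ c)).congr_of_eventuallyEq ?_ rfl
  have : ∀ᶠ t : Ioo (0 : ℝ) (2 * Real.pi) in 𝓝 θ, dist t θ < ε := Metric.ball_mem_nhds θ hε
  filter_upwards [this.filter_mono nhdsWithin_le_nhds, self_mem_nhdsWithin] with t ht hle
  refine arcCount_eq hle fun u hu => ?_
  have hu' : u ∈ Metric.ball (θ : ℝ) ε := by
    rw [Subtype.dist_eq, Real.dist_eq, abs_lt] at ht
    rw [Metric.mem_ball, Real.dist_eq, abs_lt]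
    constructor <;> linarith [hu.1, hu.2]
  by_contra hne
  exact (hsub hu').1 ⟨⟨(hsub hu').2.le, hu.2⟩, hne⟩

/-- The function `θ ↦ N(exp(iθ), -1; W)`. -/
def countFun (W : E →L[ℂ] E) (hW : W ∈ unitaryCompact E) : CircleFun where
  toFun θ := arcCount W θ Real.pi
  antitone' := arcCount_antitone hW ⟨Real.pi_pos, by linarith [Real.pi_pos]⟩
  leftCont' := arcCount_leftCont hW

open Classical in
/-- The class `η(W)` of `z ↦ N(z, z₀; W)` modulo integer constants, for `W` unitary with `W - I`
compact. It does not depend on `z₀`, since changing `z₀` adds a constant; we take `z₀ = -1`.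
For all other operators the value is irrelevant (we take the class of zero). -/
def eta (W : E →L[ℂ] E) : CircleClass :=
  if hW : W ∈ unitaryCompact E then CircleClass.proj (countFun W hW)
  else CircleClass.proj ⟨fun _ => 0, fun _ _ _ => le_rfl, fun _ => continuousWithinAt_const⟩

/-- `g` is a lift of the continuous extension `γ` to `[0, 1]` of the path `t ↦ η(U(t))`,
`0 < t < 1`. -/
def IsFlowLift (U : ℝ → E →L[ℂ] E) (g : C(unitInterval, CircleFun)) : Prop :=
  ∃ γ : C(unitInterval, CircleClass),
    (∀ t : unitInterval, (t : ℝ) ∈ Ioo (0 : ℝ) 1 → γ t = eta (U t)) ∧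
      ∀ t, CircleClass.proj (g t) = γ t

open Classical in
/-- The spectral flow of a family `U(t)`, `0 < t < 1`, of unitary operators through the point
`exp(iθ)`: the increment of a lift (zero by convention if there is no lift). -/
def spflow (U : ℝ → E →L[ℂ] E) (θ : Ioo (0 : ℝ) (2 * Real.pi)) : ℤ :=
  if h : ∃ g, IsFlowLift U g then h.choose 1 θ - h.choose 0 θ else 0

/-! ### Unbounded operators -/

/-- `R` is the bounded everywhere defined two-sided inverse of `A - z`. -/
def IsResolventAt (A : E →ₗ.[ℂ] E) (z : ℂ) (R : E →L[ℂ] E) : Prop :=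
  (∀ x, ∃ h : R x ∈ A.domain, A ⟨R x, h⟩ - z • R x = x) ∧
    ∀ u : A.domain, R (A u - z • (u : E)) = u

/-- The resolvent set `ρ(A)`. -/
def resolventSet (A : E →ₗ.[ℂ] E) : Set ℂ := {z | ∃ R, IsResolventAt A z R}

open Classical in
/-- The resolvent `(A - z)⁻¹` for `z ∈ ρ(A)` (zero by convention for other `z`). -/
def res (A : E →ₗ.[ℂ] E) (z : ℂ) : E →L[ℂ] E :=
  if h : ∃ R, IsResolventAt A z R then h.choose else 0

theorem IsResolventAt.res_eq {A : E →ₗ.[ℂ] E} {z : ℂ} {R : E →L[ℂ] E} (h : IsResolventAt A z R) :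
    res A z = R := by
  have hex : ∃ R, IsResolventAt A z R := ⟨R, h⟩
  rw [res, dif_pos hex]
  ext x
  obtain ⟨hx, hx'⟩ := h.1 x
  have := hex.choose_spec.2 ⟨R x, hx⟩
  simpa only [hx'] using this

/-- `Ker (A - t)` for real `t`. -/
def realEigenspace (A : E →ₗ.[ℂ] E) (t : ℝ) : Submodule ℂ E :=
  (LinearMap.ker (A.toFun - (t : ℂ) • A.domain.subtype)).map A.domain.subtype

theorem mem_realEigenspace {A : E →ₗ.[ℂ] E} {t : ℝ} {x : E} :
    x ∈ realEigenspace A t ↔ ∃ h : x ∈ A.domain, A ⟨x, h⟩ = (t : ℂ) • x := by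
  constructor
  · rintro ⟨⟨y, hy⟩, hker, rfl⟩
    exact ⟨hy, sub_eq_zero.1 hker⟩
  · rintro ⟨h, hx⟩
    exact ⟨⟨x, h⟩, sub_eq_zero.2 hx, rfl⟩

/-- The real part of the spectrum (the whole spectrum if `A` is self-adjoint). -/
def realSpectrum (A : E →ₗ.[ℂ] E) : Set ℝ := {t | (t : ℂ) ∉ resolventSet A}

/-- The essential spectrum of a self-adjoint operator: the spectrum without the isolated points
that are eigenvalues of finite multiplicity. (For self-adjoint `A`, an isolated point of the
spectrum is an eigenvalue.) -/
def essSpectrum (A : E →ₗ.[ℂ] E) : Set ℝ :=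
  {t | t ∈ realSpectrum A ∧
    ¬ (¬ AccPt t (𝓟 (realSpectrum A)) ∧ FiniteDimensional ℂ (realEigenspace A t))}

/-- The span of the eigenvectors of `A` with eigenvalues in `[a, b)`. If `A` is self-adjoint and
`[a, b]` does not meet the essential spectrum, this is the range of the spectral projection
`E_A([a, b))`, and it is finite dimensional. -/
def intervalSpace (A : E →ₗ.[ℂ] E) (a b : ℝ) : Submodule ℂ E := ⨆ t ∈ Ico a b, realEigenspace A t

/-- `N(a, b; A)`: the rank of `E_A([a, b))` if `a < b`, zero if `a = b`, and minus the rank of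
`E_A([b, a))` if `b < a` (one of the two spaces is always zero). -/
def intervalCount (A : E →ₗ.[ℂ] E) (a b : ℝ) : ℤ :=
  (Module.finrank ℂ (intervalSpace A a b) : ℤ) - Module.finrank ℂ (intervalSpace A b a)

/-! ### The function `μ` -/

/-- `M(z; H, H₀) = (I + (z - z̄) (H - z)⁻¹) (I + (z̄ - z) (H₀ - z̄)⁻¹)`. -/
def mOp (H H₀ : E →ₗ.[ℂ] E) (z : ℂ) : E →L[ℂ] E :=
  (1 + (z - conj z) • res H z) * (1 + (conj z - z) • res H₀ (conj z))

/-- The resolvent difference is compact, and it decays faster than `1 / y` along vertical lines. -/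
structure ResolventComparable (H H₀ : E →ₗ.[ℂ] E) : Prop where
  compact : ∀ z ∈ resolventSet H₀ ∩ resolventSet H, IsCompactOperator ⇑(res H z - res H₀ z)
  decay : ∀ l : ℝ, Tendsto
    (fun y : ℝ => y * ‖res H (l + y * Complex.I) - res H₀ (l + y * Complex.I)‖) atTop (𝓝 0)

/-- The limit of `η(M(l + iy; H, H₀))` as `y → 0+` exists. -/
def HasBoundaryValue (H H₀ : E →ₗ.[ℂ] E) (l : ℝ) : Prop :=
  ∃ c : CircleClass, Tendsto (fun y : ℝ => eta (mOp H H₀ (l + y * Complex.I))) (𝓝[>] 0) (𝓝 c)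

/-- The family `t ↦ M(l + i (1 - t) / t; H, H₀)`, `0 < t < 1`. -/
def mPath (H H₀ : E →ₗ.[ℂ] E) (l : ℝ) (t : ℝ) : E →L[ℂ] E :=
  mOp H H₀ (l + ((1 - t) * t⁻¹ : ℝ) * Complex.I)

/-- `μ(θ; l, H, H₀)`. -/
def mu (θ : Ioo (0 : ℝ) (2 * Real.pi)) (l : ℝ) (H H₀ : E →ₗ.[ℂ] E) : ℤ := spflow (mPath H H₀ l) θ

/-- Everything that the definition of `μ(·; l, H, H₀)` presupposes: the two standing conditions on
`H`, `H₀`, `l`, the fact that the operators `M(l + iy; H, H₀)` are unitary with `M - I` compact,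
and the existence of a lift. -/
structure MuDefined (H H₀ : E →ₗ.[ℂ] E) (l : ℝ) : Prop where
  comparable : ResolventComparable H H₀
  boundaryValue : HasBoundaryValue H H₀ l
  mem_unitaryCompact : ∀ y : ℝ, 0 < y → mOp H H₀ (l + y * Complex.I) ∈ unitaryCompact E
  exists_lift : ∃ g, IsFlowLift (mPath H H₀ l) g

/-! ### The spectral flow of a self-adjoint family in a gap -/

/-- Lebesgue measure on the interval `Δ`. -/
abbrev gapMeasure (Δ : Set ℝ) : Measure Δ := Measure.comap (Subtype.val : Δ → ℝ) volume

/-- Left continuous bounded non-decreasing functions `Δ → ℤ`, as a subset of `L_1(Δ)` (for bounded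
`Δ` the last field follows from the others). -/
structure GapFun (Δ : Set ℝ) where
  toFun : Δ → ℤ
  monotone' : Monotone toFun
  leftCont' : ∀ x, ContinuousWithinAt toFun (Iic x) x
  bounded' : ∃ C : ℤ, ∀ x, |toFun x| ≤ C
  memLp' : MemLp (fun x => (toFun x : ℝ)) 1 (gapMeasure Δ)

namespace GapFun

variable {Δ : Set ℝ}

instance : CoeFun (GapFun Δ) (fun _ => Δ → ℤ) := ⟨toFun⟩

/-- The topology of `L_1(Δ)`. -/
instance : PseudoMetricSpace (GapFun Δ) :=
  PseudoMetricSpace.induced (fun f => f.memLp'.toLp _) inferInstance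

/-- Equality up to an integer constant. -/
def rel (Δ : Set ℝ) : Setoid (GapFun Δ) where
  r f g := ∃ n : ℤ, ∀ x, f x = g x + n
  iseqv :=
    { refl := fun _ => ⟨0, by simp⟩
      symm := by
        rintro f g ⟨n, h⟩
        exact ⟨-n, fun x => by rw [h x]; ring⟩
      trans := by
        rintro f g k ⟨n, h⟩ ⟨m, h'⟩
        exact ⟨m + n, fun x => by rw [h x, h' x]; ring⟩ }

end GapFun

/-- The quotient of `GapFun Δ` modulo integer constants, with the quotient topology. -/
def GapClass (Δ : Set ℝ) : Type := Quotient (GapFun.rel Δ)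

instance (Δ : Set ℝ) : TopologicalSpace (GapClass Δ) :=
  inferInstanceAs (TopologicalSpace (Quotient (GapFun.rel Δ)))

/-- The projection onto the quotient. -/
def GapClass.proj {Δ : Set ℝ} (f : GapFun Δ) : GapClass Δ := Quotient.mk (GapFun.rel Δ) f

/-- `c` is the class of `N(l₀, ·; A)` for `l₀ ∈ Δ ∩ ρ(A)`: such `l₀` exist, and for each of them the
function is of the required kind and represents `c`. -/
def IsCountClass (Δ : Set ℝ) (A : E →ₗ.[ℂ] E) (c : GapClass Δ) : Prop :=
  (∃ l₀ ∈ Δ, (l₀ : ℂ) ∈ resolventSet A) ∧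
    ∀ l₀ ∈ Δ, (l₀ : ℂ) ∈ resolventSet A →
      ∃ f : GapFun Δ, (∀ x, f x = intervalCount A l₀ x) ∧ GapClass.proj f = c

/-- `g` is a lift of the path `γ(α)`, the class of `N(l₀, ·; H(α))`, `l₀ ∈ Δ ∩ ρ(H(α))`, this path
being continuous. -/
def IsGapLift (Δ : Set ℝ) (H : unitInterval → E →ₗ.[ℂ] E) (g : C(unitInterval, GapFun Δ)) : Prop :=
  ∃ γ : C(unitInterval, GapClass Δ),
    (∀ α, IsCountClass Δ (H α) (γ α)) ∧ ∀ α, GapClass.proj (g α) = γ α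

open Classical in
/-- The spectral flow of the family `H` through `x ∈ Δ`: the increment of a lift (zero by convention
if there is no lift). -/
def gapFlow (Δ : Set ℝ) (H : unitInterval → E →ₗ.[ℂ] E) (x : Δ) : ℤ :=
  if h : ∃ g, IsGapLift Δ H g then h.choose 1 x - h.choose 0 x else 0

end PushFlow

end

/-! Write `S(z; A) = (A - z̄)(A - z)⁻¹` (`sOp`). This is unitary, it equals `I` for real `z`, and
`M(z; H, H₀) = S(z; H) S(z; H₀)*`. Two topological facts make the flow of such operators homotopy
invariant: `η` is continuous in the operator norm (`continuousOn_eta`), and the projection modulo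
integer constants is a covering map (`isCoveringMap_proj`). Hence the flows along the two ways
around a square agree (`flow_square`).

Hypothesis 3 makes `M` tend to `I` at the top of the half-plane, uniformly in `α`, and `M` tends to
`I` at every real point of both resolvent sets. So `μ(θ; x, H(α), H(0))` is the flow of a loop, and
it does not change while `x` and `α` move within the common resolvent sets (`mu_eq_of_path`). To
pass an isolated eigenvalue `t`, go around it on a small half-circle. There `S(z; A)` is, up to a
small error, a rotation of `Ker (A - t)` through one full turn, so `M` is nearly a full turn of `Ker
(H(α) - t)` times the inverse turn of `Ker (H(0) - t)`. Such a loop has flow equal to the difference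
of the two dimensions (`exists_jump`).

Therefore `μ` and the difference of the eigenvalue counting functions of `H(α)` and `H(0)` have the
same increments in the gap (`mu_sub_mu`), which means that `μ(θ; x, H(α), H(0)) + N(l₀, x; H(0))`
represents `γ(α)` up to finitely many `x`. This function is locally constant in `α` at almost every
`x` and locally uniformly bounded, so dominated convergence makes it continuous into `L_1(Δ)`
(`continuous_gapFun`). It is thus a continuous lift of `γ`. Since `μ` vanishes at `α = 0`, its
increment over `[0, 1]` is `μ(θ; x, H(1), H(0))`.

That the gap contains only isolated eigenvalues of finite multiplicity of every `H(α)` is the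
stability of the essential spectrum under compact perturbations of the resolvent
(`isGapAt_of_compact`), proved with the Cayley transform `S(t + i; A)`. -/

noncomputable section

namespace PushFlow

set_option linter.unusedSectionVars false

variable {E : Type*} [NormedAddCommGroup E] [InnerProductSpace ℂ E] [CompleteSpace E]

/-! ### The metric on counting functions and the action of the integers. -/

namespace CircleFun

theorem nu_antitone (f : CircleFun) : Antitone f.nu := by
  intro m n hmn
  refine csSup_le_csSup (f.bddAbove_nu m) ⟨0, Or.inl rfl⟩ ?_
  rintro t (rfl | ⟨h, h'⟩)
  · exact Or.inl rfl
  · exact Or.inr ⟨h, lt_of_le_of_lt hmn h'⟩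

theorem abs_nu_sub_le_dist (f g : CircleFun) (n : ℤ) : |f.nu n - g.nu n| ≤ dist f g := by
  rw [dist_eq]
  refine le_ciSup (f := fun n : ℤ => |f.nu n - g.nu n|) ⟨2 * Real.pi, ?_⟩ n
  rintro _ ⟨m, rfl⟩
  have h1 := f.nu_mem m
  have h2 := g.nu_mem m
  rw [abs_le]
  constructor <;> linarith [h1.1, h1.2, h2.1, h2.2]

theorem dist_le_of_forall {f g : CircleFun} {r : ℝ} (h : ∀ n, |f.nu n - g.nu n| ≤ r) :
    dist f g ≤ r := by
  rw [dist_eq]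
  exact ciSup_le h

/-- Distances are estimated by comparing the functions themselves at arguments displaced by `ε`.
Where the displaced argument would leave the interval (`t ≤ ε`), the bound `0 ≤ ν` is enough. -/
theorem nu_le_add_of_forall {f g : CircleFun} {ε : ℝ} (hε : 0 ≤ ε)
    (h : ∀ s t : Ioo (0 : ℝ) (2 * Real.pi), (t : ℝ) = s + ε → f t ≤ g s) (n : ℤ) :
    f.nu n ≤ g.nu n + ε := by
  refine csSup_le ⟨0, Or.inl rfl⟩ ?_
  rintro t (ht | ⟨ht, hn⟩)
  · have : t = 0 := ht
    linarith [(g.nu_mem n).1]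
  · by_cases hle : t ≤ ε
    · linarith [(g.nu_mem n).1]
    · have hs : t - ε ∈ Ioo (0 : ℝ) (2 * Real.pi) :=
        ⟨sub_pos.2 (not_le.1 hle), by linarith [ht.2]⟩
      have := (g.lt_iff_le_nu n ⟨t - ε, hs⟩).1
        (lt_of_lt_of_le hn (h ⟨t - ε, hs⟩ ⟨t, ht⟩ (by simp)))
      simp only at this
      linarith

theorem shift_zero (f : CircleFun) : f.shift 0 = f := ext' fun θ => by simp [shift]

theorem shift_add (m n : ℤ) (f : CircleFun) : f.shift (m + n) = (f.shift n).shift m :=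
  ext' fun θ => by simp only [shift]; ring

instance : AddAction ℤ CircleFun where
  vadd n f := f.shift n
  zero_vadd := shift_zero
  add_vadd := shift_add

theorem vadd_def (n : ℤ) (f : CircleFun) : n +ᵥ f = f.shift n := rfl

instance : ContinuousConstVAdd ℤ CircleFun :=
  ⟨fun n => (Isometry.of_dist_eq fun f g => dist_shift n f g).continuous⟩

/-- With `k = f(π)` the numbers `ν(k)` and `ν(k - 1)` lie on different sides of `π`. A shift by `n >
0` puts `ν(k - n) ≥ ν(k - 1)` in the place of `ν(k)`, so it moves a function near `f` by at least
about this gap. Half of the gap serves as the radius, and negative `n` reduce to positive ones. -/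
theorem exists_ball_shift (f : CircleFun) :
    ∃ ε > 0, ∀ g ∈ Metric.ball f ε, ∀ n : ℤ, g.shift n ∈ Metric.ball f ε → n = 0 := by
  have hpi : Real.pi ∈ Ioo (0 : ℝ) (2 * Real.pi) := ⟨Real.pi_pos, by linarith [Real.pi_pos]⟩
  set k : ℤ := f ⟨Real.pi, hpi⟩ with hk
  have h1 : f.nu k < Real.pi := by
    by_contra! hc
    exact lt_irrefl _ ((f.lt_iff_le_nu k ⟨Real.pi, hpi⟩).2 hc)
  have h2 : Real.pi ≤ f.nu (k - 1) :=
    (f.lt_iff_le_nu (k - 1) ⟨Real.pi, hpi⟩).1 (by rw [← hk]; omega)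
  have key : ∀ g ∈ Metric.ball f ((f.nu (k - 1) - f.nu k) / 2), ∀ n : ℤ,
      g.shift n ∈ Metric.ball f ((f.nu (k - 1) - f.nu k) / 2) → n ≤ 0 := by
    intro g hg n hn
    by_contra! hpos
    rw [Metric.mem_ball, dist_comm] at hg hn
    have h3 := (abs_le.1 (abs_nu_sub_le_dist f g (k - 1))).2
    have h4 := (abs_le.1 (abs_nu_sub_le_dist f (g.shift n) k)).1
    rw [nu_shift] at h4
    have h5 := g.nu_antitone (show k - n ≤ k - 1 by omega)
    linarith
  refine ⟨(f.nu (k - 1) - f.nu k) / 2, by linarith, fun g hg n hn => le_antisymm (key g hg n hn) ?_⟩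
  have := key (g.shift n) hn (-n) (by rw [← shift_add, neg_add_cancel, shift_zero]; exact hg)
  omega

/-- A function constant near `θ` has the same value at `θ` as all functions close to it. -/
theorem eq_of_dist_lt {f g : CircleFun} {θ : Ioo (0 : ℝ) (2 * Real.pi)} {δ : ℝ} (h0 : δ ≤ θ)
    (h1 : θ + δ ≤ 2 * Real.pi)
    (h : ∀ t : Ioo (0 : ℝ) (2 * Real.pi), |(t : ℝ) - θ| < δ → f t = f θ) (hd : dist f g < δ) :
    g θ = f θ := by
  have hd0 : 0 ≤ dist f g := dist_nonneg
  have hθ := θ.2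
  have key : ∀ n, n < g θ ↔ n < f θ := by
    intro n
    have hn := abs_le.1 (abs_nu_sub_le_dist f g n)
    constructor
    · intro hlt
      have h2 := (g.lt_iff_le_nu n θ).1 hlt
      rw [← h ⟨θ - dist f g, by linarith, by linarith [hθ.2]⟩ (by
        simp only
        rw [abs_lt]
        constructor <;> linarith)]
      refine (f.lt_iff_le_nu n _).2 ?_
      simp only
      linarith
    · intro hlt
      rw [← h ⟨θ + dist f g, by linarith [hθ.1], by linarith⟩ (by
        simp only
        rw [abs_lt]
        constructor <;> linarith)] at hlt
      have h2 := (f.lt_iff_le_nu n _).1 hlt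
      simp only at h2
      refine (g.lt_iff_le_nu n _).2 ?_
      linarith
  exact le_antisymm (by by_contra! hc; exact lt_irrefl _ ((key _).1 hc))
    (by by_contra! hc; exact lt_irrefl _ ((key _).2 hc))

end CircleFun

/-! ### The covering map onto classes modulo constants, and increments of lifts. -/

namespace CircleClass

/-- The integers act by isometries, and `exists_ball_shift` makes the action properly discontinuous.
All liftings of paths and homotopies rest on this. -/
theorem isAddQuotientCoveringMap_proj : IsAddQuotientCoveringMap proj ℤ where
  toIsQuotientMap := isQuotientMap_quotient_mk'
  continuous_const_vadd := continuous_const_vadd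
  apply_eq_iff_mem_orbit {f g} := by
    rw [proj_eq_iff]
    constructor
    · rintro ⟨n, rfl⟩
      exact ⟨n, rfl⟩
    · rintro ⟨n, rfl⟩
      exact ⟨n, rfl⟩
  disjoint f := by
    obtain ⟨ε, hε, h⟩ := f.exists_ball_shift
    refine ⟨_, Metric.ball_mem_nhds f hε, fun n hn => ?_⟩
    obtain ⟨_, ⟨g, hg, rfl⟩, hg'⟩ := hn
    exact h g hg n hg'

theorem isCoveringMap_proj : IsCoveringMap proj := isAddQuotientCoveringMap_proj.isCoveringMap

theorem proj_shift (f : CircleFun) (n : ℤ) : proj (f.shift n) = proj f :=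
  proj_eq_iff.2 ⟨n, rfl⟩

/-- Two lifts of the same map on a connected space differ by a constant. -/
theorem lift_unique {X : Type*} [TopologicalSpace X] [PreconnectedSpace X] [Nonempty X]
    {g g' : X → CircleFun} (hg : Continuous g) (hg' : Continuous g')
    (h : ∀ x, proj (g' x) = proj (g x)) : ∃ n : ℤ, ∀ x, g' x = (g x).shift n := by
  obtain ⟨x₀⟩ := ‹Nonempty X›
  obtain ⟨n, hn⟩ := proj_eq_iff.1 (h x₀)
  refine ⟨n, fun x => ?_⟩
  have := isCoveringMap_proj.eq_of_comp_eq hg' (hg.const_vadd n)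
    (funext fun x => by
      change proj (g' x) = proj ((g x).shift n)
      rw [proj_shift, h]) x₀ hn
  exact congrFun this x

theorem exists_lift (γ : C(unitInterval, CircleClass)) :
    ∃ g : C(unitInterval, CircleFun), ∀ t, proj (g t) = γ t := by
  obtain ⟨f, hf⟩ := proj_surjective (γ 0)
  obtain ⟨g, hg, -⟩ := isCoveringMap_proj.exists_path_lifts γ f hf.symm
  exact ⟨g, fun t => congrFun hg t⟩

/-- The increment along a path in the quotient, computed with a lift. -/
def increment (γ : C(unitInterval, CircleClass)) (θ : Ioo (0 : ℝ) (2 * Real.pi)) : ℤ :=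
  (exists_lift γ).choose 1 θ - (exists_lift γ).choose 0 θ

theorem increment_eq {γ : C(unitInterval, CircleClass)} {g : unitInterval → CircleFun}
    (hc : Continuous g) (hg : ∀ t, proj (g t) = γ t) (θ : Ioo (0 : ℝ) (2 * Real.pi)) :
    increment γ θ = g 1 θ - g 0 θ := by
  obtain ⟨n, hn⟩ := lift_unique hc (exists_lift γ).choose.continuous
    (fun t => ((exists_lift γ).choose_spec t).trans (hg t).symm)
  rw [increment, hn, hn]
  simp only [CircleFun.shift]
  ring

theorem increment_of_const {γ : C(unitInterval, CircleClass)} (h : ∀ t, γ t = γ 0)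
    (θ : Ioo (0 : ℝ) (2 * Real.pi)) : increment γ θ = 0 := by
  obtain ⟨f, hf⟩ := proj_surjective (γ 0)
  rw [increment_eq (g := fun _ => f) continuous_const (fun t => by rw [hf, h t]), sub_self]

/-- The increments along the two ways around a square agree. -/
theorem increment_square (F : C(unitInterval × unitInterval, CircleClass))
    {a b c d : C(unitInterval, CircleClass)}
    (ha : ∀ t, a t = F (0, t)) (hb : ∀ s, b s = F (s, 1)) (hc : ∀ s, c s = F (s, 0))
    (hd : ∀ t, d t = F (1, t)) (θ : Ioo (0 : ℝ) (2 * Real.pi)) :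
    increment a θ + increment b θ = increment c θ + increment d θ := by
  obtain ⟨f, hf⟩ := exists_lift a
  have h0 : ∀ t, F (0, t) = proj (f t) := fun t => by rw [hf, ha]
  let G := isCoveringMap_proj.liftHomotopy F f h0
  have hG : ∀ x, proj (G x) = F x := congrFun (isCoveringMap_proj.liftHomotopy_lifts F f h0)
  rw [increment_eq (g := fun t => G (0, t)) (by fun_prop) (fun t => by rw [hG, ha]),
    increment_eq (g := fun s => G (s, 1)) (by fun_prop) (fun t => by rw [hG, hb]),
    increment_eq (g := fun s => G (s, 0)) (by fun_prop) (fun t => by rw [hG, hc]),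
    increment_eq (g := fun t => G (1, t)) (by fun_prop) (fun t => by rw [hG, hd])]
  ring

end CircleClass

theorem exists_isFlowLift {U : ℝ → E →L[ℂ] E} {γ : C(unitInterval, CircleClass)}
    (h : ∀ t : unitInterval, (t : ℝ) ∈ Ioo (0 : ℝ) 1 → γ t = eta (U t)) :
    ∃ g, IsFlowLift U g := by
  obtain ⟨g, hg⟩ := CircleClass.exists_lift γ
  exact ⟨g, γ, h, hg⟩

theorem dense_Ioo_unitInterval : Dense {t : unitInterval | (t : ℝ) ∈ Ioo (0 : ℝ) 1} := by
  have : {t : unitInterval | (t : ℝ) ∈ Ioo (0 : ℝ) 1} = Ioo 0 1 := by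
    ext t
    rfl
  rw [this, dense_iff_closure_eq, closure_Ioo zero_ne_one]
  exact eq_univ_of_forall fun t => ⟨t.2.1, t.2.2⟩

/-- The path in the definition of the flow is prescribed only on the open interval. Two lifts of
continuous extensions differ there by a constant, because the open interval is connected. Density
and the Hausdorff property of `CircleFun` carry this to the end points, without any separation
property of the quotient. -/
theorem spflow_eq_increment {U : ℝ → E →L[ℂ] E} {γ : C(unitInterval, CircleClass)}
    (h : ∀ t : unitInterval, (t : ℝ) ∈ Ioo (0 : ℝ) 1 → γ t = eta (U t))
    (θ : Ioo (0 : ℝ) (2 * Real.pi)) : spflow U θ = CircleClass.increment γ θ := by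
  have hex : ∃ g, IsFlowLift U g := exists_isFlowLift h
  rw [spflow, dif_pos hex]
  obtain ⟨γ', hγ', hg'⟩ := hex.choose_spec
  obtain ⟨g, hg⟩ := CircleClass.exists_lift γ
  rw [CircleClass.increment_eq g.continuous hg]
  set g' := hex.choose
  have hconn : PreconnectedSpace {t : unitInterval | (t : ℝ) ∈ Ioo (0 : ℝ) 1} := by
    refine Subtype.preconnectedSpace ?_
    have : {t : unitInterval | (t : ℝ) ∈ Ioo (0 : ℝ) 1} = Ioo 0 1 := by
      ext t
      rfl
    rw [this]
    exact isPreconnected_Ioo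
  have hne : Nonempty {t : unitInterval | (t : ℝ) ∈ Ioo (0 : ℝ) 1} :=
    dense_Ioo_unitInterval.nonempty.to_subtype
  obtain ⟨n, hn⟩ := CircleClass.lift_unique
    (X := {t : unitInterval | (t : ℝ) ∈ Ioo (0 : ℝ) 1}) (g := fun t => g t) (g' := fun t => g' t)
    (by fun_prop) (by fun_prop) (fun t => by rw [hg', hg, h t t.2, hγ' t t.2])
  have hall : (g' : unitInterval → CircleFun) = fun t => n +ᵥ g t :=
    g'.continuous.ext_on dense_Ioo_unitInterval (g.continuous.const_vadd n)
      (fun t ht => hn ⟨t, ht⟩)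
  simp only [hall, CircleFun.vadd_def, CircleFun.shift]
  ring

/-! ### Perturbation of the eigenvalues of a unitary operator on an arc. -/

theorem norm_exp_sub_exp (a b : ℝ) :
    ‖Complex.exp (a * Complex.I) - Complex.exp (b * Complex.I)‖ = 2 * |Real.sin ((a - b) / 2)| := by
  have h : Complex.exp (a * Complex.I) - Complex.exp (b * Complex.I) =
      Complex.exp (b * Complex.I) * (Complex.exp (Complex.I * ((a - b : ℝ) : ℂ)) - 1) := by
    rw [mul_sub, ← Complex.exp_add, mul_one]
    congr 2
    push_cast
    ring
  rw [h, norm_mul, Complex.norm_exp_ofReal_mul_I, one_mul, Complex.norm_exp_I_mul_ofReal_sub_one,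
    norm_mul, Real.norm_eq_abs, Real.norm_eq_abs, abs_of_pos two_pos]

/-- The continuous functional calculus gives the inverse of `T - w` as `(z - w)⁻¹` evaluated at `T`,
and its norm is at most the supremum `r⁻¹` over the spectrum. -/
theorem le_norm_sub_of_spectrum {T : E →L[ℂ] E} (hT : T ∈ unitary (E →L[ℂ] E)) {w : ℂ} {r : ℝ}
    (h : ∀ z ∈ spectrum ℂ T, r ≤ ‖z - w‖) (x : E) : r * ‖x‖ ≤ ‖T x - w • x‖ := by
  rcases le_or_gt r 0 with hr | hr
  · exact (mul_nonpos_of_nonpos_of_nonneg hr (norm_nonneg _)).trans (norm_nonneg _)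
  have hn : IsStarNormal T := isStarNormal_of_mem_unitary hT
  have hne : ∀ z ∈ spectrum ℂ T, z - w ≠ 0 := fun z hz h0 => by
    have := h z hz
    rw [h0, norm_zero] at this
    linarith
  have hcont : ContinuousOn (fun z : ℂ => (z - w)⁻¹) (spectrum ℂ T) :=
    ContinuousOn.inv₀ (by fun_prop) hne
  have h1 : cfc (fun z : ℂ => (z - w)⁻¹) T * (T - algebraMap ℂ _ w) = 1 := by
    have e : T - algebraMap ℂ _ w = cfc (fun z : ℂ => z - w) T := by
      rw [cfc_sub (fun z : ℂ => z) (fun _ => w) T, cfc_id' ℂ T, cfc_const w T]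
    rw [e, ← cfc_mul _ _ T hcont, ← cfc_one ℂ T]
    exact cfc_congr fun z hz => inv_mul_cancel₀ (hne z hz)
  have h2 : ‖cfc (fun z : ℂ => (z - w)⁻¹) T‖ ≤ r⁻¹ := by
    refine norm_cfc_le (inv_nonneg.2 hr.le) fun z hz => ?_
    rw [norm_inv]
    exact inv_anti₀ hr (h z hz)
  have h3 : cfc (fun z : ℂ => (z - w)⁻¹) T (T x - w • x) = x := by
    have := congrArg (fun S : E →L[ℂ] E => S x) h1
    simpa [Algebra.algebraMap_eq_smul_one] using this
  have h4 : ‖x‖ ≤ r⁻¹ * ‖T x - w • x‖ := by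
    calc ‖x‖ = ‖cfc (fun z : ℂ => (z - w)⁻¹) T (T x - w • x)‖ := by rw [h3]
      _ ≤ _ := (ContinuousLinearMap.le_opNorm _ _).trans (by gcongr)
  rwa [inv_mul_eq_div, le_div_iff₀ hr, mul_comm] at h4

theorem arcSpace_invariant {W : E →L[ℂ] E} {a b : ℝ} {x : E} (hx : x ∈ arcSpace W a b) :
    W x ∈ arcSpace W a b := by
  have : arcSpace W a b ≤ (arcSpace W a b).comap (W : E →ₗ[ℂ] E) := by
    refine iSup₂_le fun θ hθ => ?_
    intro y hy
    have h1 : y ∈ arcSpace W a b :=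
      (le_iSup₂_of_le (f := fun θ (_ : θ ∈ Ico a b) => angleSpace W θ) θ hθ le_rfl) hy
    change W y ∈ arcSpace W a b
    rw [mem_angleSpace.1 hy]
    exact Submodule.smul_mem _ _ h1
  exact this hx

theorem star_apply_of_mem_angleSpace {W : E →L[ℂ] E} (hW : W ∈ unitary (E →L[ℂ] E)) {θ : ℝ}
    {x : E} (hx : x ∈ angleSpace W θ) : star W x = Complex.exp (-(θ * Complex.I)) • x := by
  have h1 : star W (W x) = x := by
    have := congrArg (fun S : E →L[ℂ] E => S x) (Unitary.mem_iff.1 hW).1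
    simpa using this
  rw [mem_angleSpace.1 hx, map_smul] at h1
  nth_rewrite 2 [← h1]
  rw [smul_smul, ← Complex.exp_add, neg_add_cancel, Complex.exp_zero, one_smul]

theorem arcSpace_star_invariant {W : E →L[ℂ] E} (hW : W ∈ unitary (E →L[ℂ] E)) {a b : ℝ} {x : E}
    (hx : x ∈ arcSpace W a b) : star W x ∈ arcSpace W a b := by
  have : arcSpace W a b ≤ (arcSpace W a b).comap ((star W : E →L[ℂ] E) : E →ₗ[ℂ] E) := by
    refine iSup₂_le fun θ hθ => ?_
    intro y hy
    have h1 : y ∈ arcSpace W a b :=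
      (le_iSup₂_of_le (f := fun θ (_ : θ ∈ Ico a b) => angleSpace W θ) θ hθ le_rfl) hy
    change star W y ∈ arcSpace W a b
    rw [star_apply_of_mem_angleSpace hW hy]
    exact Submodule.smul_mem _ _ h1
  exact this hx

/-- A subspace invariant under an operator and its adjoint reduces the operator. -/
theorem starProjection_comm {T : E →L[ℂ] E} {K : Submodule ℂ E} [K.HasOrthogonalProjection]
    (h1 : ∀ x ∈ K, T x ∈ K) (h2 : ∀ x ∈ K, star T x ∈ K) (x : E) :
    K.starProjection (T x) = T (K.starProjection x) := by
  refine Submodule.eq_starProjection_of_mem_of_inner_eq_zero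
    (h1 _ (Submodule.starProjection_apply_mem K x)) fun w hw => ?_
  rw [← map_sub, ← ContinuousLinearMap.adjoint_inner_right, ← ContinuousLinearMap.star_eq_adjoint]
  exact Submodule.starProjection_inner_eq_zero _ _ (h2 w hw)

/-- A unitary operator modified to be the identity on a reducing subspace. -/
theorem compress_mem_unitary {W : E →L[ℂ] E} (hW : W ∈ unitary (E →L[ℂ] E)) {K : Submodule ℂ E}
    [K.HasOrthogonalProjection] (h1 : ∀ x ∈ K, W x ∈ K) (h2 : ∀ x ∈ K, star W x ∈ K) :
    1 + (W - 1) * (1 - K.starProjection) ∈ unitary (E →L[ℂ] E) := by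
  set P : E →L[ℂ] E := K.starProjection with hP
  have hPP : P * P = P := K.isIdempotentElem_starProjection
  have hPs : star P = P := isSelfAdjoint_starProjection K
  have hc : P * W = W * P := ContinuousLinearMap.ext (starProjection_comm h1 h2)
  have hc' : P * star W = star W * P :=
    ContinuousLinearMap.ext (starProjection_comm h2 (by simpa using h1))
  obtain ⟨hW1, hW2⟩ := Unitary.mem_iff.1 hW
  have e : star (1 + (W - 1) * (1 - P)) = 1 + (star W - 1) * (1 - P) := by
    simp only [star_add, star_mul, star_sub, star_one, hPs]
    rw [sub_mul, mul_sub, mul_sub, hc']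
    noncomm_ring
  have key : ∀ A B : E →L[ℂ] E, A * B = 1 → P * A = A * P → P * B = B * P →
      (1 + (A - 1) * (1 - P)) * (1 + (B - 1) * (1 - P)) = 1 := by
    intro A B hAB hA hB
    have q1 : (1 - P) * (B - 1) = (B - 1) * (1 - P) := by
      rw [sub_mul, mul_sub, mul_sub, hB]
      noncomm_ring
    have q2 : (1 - P) * (1 - P) = 1 - P := by
      simp only [sub_mul, mul_sub, hPP, one_mul, mul_one]
      abel
    calc (1 + (A - 1) * (1 - P)) * (1 + (B - 1) * (1 - P))
        = 1 + (A - 1) * (1 - P) + (B - 1) * (1 - P) +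
          (A - 1) * ((1 - P) * (B - 1)) * (1 - P) := by noncomm_ring
      _ = 1 + (A - 1) * (1 - P) + (B - 1) * (1 - P) +
          (A - 1) * (B - 1) * ((1 - P) * (1 - P)) := by rw [q1]; noncomm_ring
      _ = 1 + (A * B - 1) * (1 - P) := by rw [q2]; noncomm_ring
      _ = 1 := by rw [hAB]; noncomm_ring
  rw [Unitary.mem_iff, e]
  exact ⟨key _ _ hW1 hc' hc, key _ _ hW2 hc hc'⟩

theorem exists_angle {z : ℂ} (hz : ‖z‖ = 1) (h1 : z ≠ 1) :
    ∃ θ ∈ Ioo (0 : ℝ) (2 * Real.pi), z = Complex.exp (θ * Complex.I) := by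
  have harg : Complex.exp (z.arg * Complex.I) = z := by
    have := Complex.norm_mul_exp_arg_mul_I z
    rwa [hz, Complex.ofReal_one, one_mul] at this
  have h0 : z.arg ≠ 0 := fun h => h1 (by rw [← harg, h]; simp)
  have hpi := Real.pi_pos
  rcases lt_or_gt_of_ne h0 with h | h
  · refine ⟨z.arg + 2 * Real.pi, ⟨by linarith [Complex.neg_pi_lt_arg z], by linarith⟩, ?_⟩
    conv_lhs => rw [← harg]
    rw [Complex.exp_eq_exp_iff_exists_int]
    exact ⟨-1, by push_cast; ring⟩
  · exact ⟨z.arg, ⟨h, by linarith [Complex.arg_le_pi z]⟩, harg.symm⟩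

/-- On the orthogonal complement of the span of the eigenvectors of an arc, `W` stays away from
the centre of the arc. -/
theorem le_norm_sub_of_mem_orthogonal {W : E →L[ℂ] E} (hW : W ∈ unitaryCompact E) {a b : ℝ}
    (ha : 0 < a) (hb : b < 2 * Real.pi) (hab : a ≤ b) {x : E} (hx : x ∈ (arcSpace W a b)ᗮ) :
    2 * Real.sin ((b - a) / 4) * ‖x‖ ≤
      ‖W x - Complex.exp (((a + b) / 2 : ℝ) * Complex.I) • x‖ := by
  have hfin := finiteDimensional_arcSpace hW ha hb
  set K := arcSpace W a b with hK
  set P : E →L[ℂ] E := K.starProjection with hP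
  -- `T` replaces `W` by the identity on the arc space. It is unitary and `T - 1` is compact, so its
  -- spectrum off `1` consists of eigenvalues. Their eigenvectors are orthogonal to the arc space,
  -- hence are eigenvectors of `W` with angle outside the arc.
  set T : E →L[ℂ] E := 1 + (W - 1) * (1 - P) with hTdef
  have hPx : P x = 0 := (Submodule.starProjection_apply_eq_zero_iff K).2 hx
  have hTx : T x = W x := by simp [T, hPx]
  have hT : T ∈ unitary (E →L[ℂ] E) := compress_mem_unitary hW.1
    (fun y hy => arcSpace_invariant hy) (fun y hy => arcSpace_star_invariant hW.1 hy)
  have hTc : IsCompactOperator ⇑(T - 1) := by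
    have : T - 1 = (W - 1) * (1 - P) := by simp [T]
    rw [this]
    exact hW.2.comp_clm (1 - P)
  have hcomm : ∀ y, P (T y) = P y := by
    intro y
    have h1 : P (W y) = W (P y) := starProjection_comm
      (fun y hy => arcSpace_invariant hy) (fun y hy => arcSpace_star_invariant hW.1 hy) y
    have h2 : P (W (P y)) = W (P y) := by
      rw [starProjection_comm (fun y hy => arcSpace_invariant hy)
        (fun y hy => arcSpace_star_invariant hW.1 hy),
        (Submodule.starProjection_eq_self_iff).2 (Submodule.starProjection_apply_mem K y)]
    have h3 : P (P y) = P y :=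
      (Submodule.starProjection_eq_self_iff).2 (Submodule.starProjection_apply_mem K y)
    simp [T, h1, h2, h3]
  rw [← hTx]
  refine le_norm_sub_of_spectrum hT (fun z hz => ?_) x
  have hz1 : ‖z‖ = 1 := by simpa using spectrum.subset_circle_of_unitary hT hz
  -- Two points of the circle at angular distance `2u` have distance `2 |sin u|`. The two hypotheses
  -- say that, either way around, the angular distance from the centre is at least half the length
  -- of the arc.
  have hsin : ∀ u : ℝ, (b - a) / 4 ≤ u → u ≤ Real.pi - (b - a) / 4 →
      2 * Real.sin ((b - a) / 4) ≤ 2 * |Real.sin u| := by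
    intro u hu1 hu2
    have hs : Real.sin ((b - a) / 4) ≤ Real.sin u := by
      rcases le_or_gt u (Real.pi / 2) with h | h
      · exact Real.sin_le_sin_of_le_of_le_pi_div_two (by linarith [Real.pi_pos]) h hu1
      · rw [← Real.sin_pi_sub u]
        exact Real.sin_le_sin_of_le_of_le_pi_div_two (by linarith [Real.pi_pos])
          (by linarith) (by linarith)
    linarith [le_abs_self (Real.sin u)]
  by_cases h1 : z = 1
  · have : z = Complex.exp ((0 : ℝ) * Complex.I) := by simp [h1]
    rw [this, norm_exp_sub_exp, show (0 - (a + b) / 2) / 2 = -((a + b) / 4) by ring, Real.sin_neg,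
      abs_neg]
    exact hsin _ (by linarith) (by linarith)
  obtain ⟨θ, hθ, rfl⟩ := exists_angle hz1 h1
  have hev : Module.End.HasEigenvalue ((T - 1 : E →L[ℂ] E) : Module.End ℂ E)
      (Complex.exp (θ * Complex.I) - 1) := by
    refine (hTc.hasEigenvalue_iff_mem_spectrum (sub_ne_zero.2 h1)).2 ?_
    have := spectrum.sub_singleton_eq (R := ℂ) T 1
    rw [map_one] at this
    rw [← this]
    exact ⟨_, hz, 1, rfl, rfl⟩
  obtain ⟨y, hy⟩ := hev.exists_hasEigenvector
  have hy1 : T y = Complex.exp (θ * Complex.I) • y := by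
    have := hy.apply_eq_smul
    simpa [sub_smul, sub_left_inj] using this
  -- Since `P T = P`, the projection of an eigenvector of `T` is multiplied by `1` as well as by an
  -- eigenvalue different from `1`.
  have hPy : P y = 0 := by
    have h2 := hcomm y
    rw [hy1, map_smul] at h2
    by_contra hne
    have h3 : (Complex.exp (θ * Complex.I) - 1) • P y = 0 := by rw [sub_smul, h2, one_smul, sub_self]
    exact (smul_ne_zero (sub_ne_zero.2 h1) hne) h3
  have hWy : W y = Complex.exp (θ * Complex.I) • y := by
    rw [← hy1]; simp [T, hPy]
  have hout : θ ∉ Ico a b := by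
    intro hmem
    have h4 : y ∈ K := (le_iSup₂_of_le (f := fun θ (_ : θ ∈ Ico a b) => angleSpace W θ) θ hmem
      le_rfl) (mem_angleSpace.2 hWy)
    exact hy.2 (by rw [← (Submodule.starProjection_eq_self_iff).2 h4]; exact hPy)
  rw [norm_exp_sub_exp]
  by_cases hlt : θ < a
  · rw [show (θ - (a + b) / 2) / 2 = -(((a + b) / 2 - θ) / 2) by ring, Real.sin_neg, abs_neg]
    exact hsin _ (by linarith [hθ.1]) (by linarith [hθ.1])
  · have hge : b ≤ θ := by
      by_contra! h
      exact hout ⟨not_lt.1 hlt, h⟩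
    exact hsin _ (by linarith [hθ.1]) (by linarith [hθ.2])

/-- The counterpart of `le_norm_sub_of_mem_orthogonal`: both estimates have the chord from the
centre of the arc to its end points as their constant. Eigenvectors with different angles are
orthogonal, so it suffices to bound each eigenvalue by this chord. -/
theorem norm_sub_le_of_mem_arcSpace {W : E →L[ℂ] E} (hW : W ∈ unitary (E →L[ℂ] E)) {a b : ℝ}
    (ha : 0 < a) (hb : b < 2 * Real.pi) {x : E} (hx : x ∈ arcSpace W a b) :
    ‖W x - Complex.exp (((a + b) / 2 : ℝ) * Complex.I) • x‖ ≤
      2 * Real.sin ((b - a) / 4) * ‖x‖ := by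
  rcases le_or_gt b a with hba | hab
  · have : x = 0 := by simpa [arcSpace, Ico_eq_empty (not_lt.2 hba)] using hx
    simp [this]
  have hpi := Real.pi_pos
  have hsin : 0 ≤ Real.sin ((b - a) / 4) :=
    Real.sin_nonneg_of_nonneg_of_le_pi (by linarith) (by linarith)
  have hsub' : ∀ i : Ico a b, (i : ℝ) ∈ Ioo (0 : ℝ) (2 * Real.pi) :=
    fun i => ⟨ha.trans_le i.2.1, i.2.2.trans hb⟩
  have horth : OrthogonalFamily ℂ (fun i : Ico a b => angleSpace W i)
      fun i => (angleSpace W i).subtypeₗᵢ := by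
    intro i j hij v w
    exact inner_eq_zero_of_ne hW (hsub' i) (hsub' j) (fun h => hij (Subtype.ext h)) v.2 w.2
  rw [arcSpace, iSup_subtype', Submodule.mem_iSup_iff_exists_finsupp] at hx
  obtain ⟨f, hf, rfl⟩ := hx
  set w : ℂ := Complex.exp (((a + b) / 2 : ℝ) * Complex.I) with hw
  let l : ∀ i : Ico a b, angleSpace W i := fun i => ⟨f i, hf i⟩
  let l' : ∀ i : Ico a b, angleSpace W i := fun i => (Complex.exp (i * Complex.I) - w) • l i
  have e1 : ‖f.sum fun _ xi => xi‖ ^ 2 = ∑ i ∈ f.support, ‖l i‖ ^ 2 :=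
    horth.norm_sum l f.support
  have e2 : ‖W (f.sum fun _ xi => xi) - w • (f.sum fun _ xi => xi)‖ ^ 2 =
      ∑ i ∈ f.support, ‖l' i‖ ^ 2 := by
    rw [← horth.norm_sum l' f.support, Finsupp.sum, map_sum, Finset.smul_sum,
      ← Finset.sum_sub_distrib]
    congr 2
    refine Finset.sum_congr rfl fun i _ => ?_
    change W (f i) - w • f i = (Complex.exp (i * Complex.I) - w) • f i
    rw [mem_angleSpace.1 (hf i), sub_smul]
  refine le_of_sq_le_sq ?_ (mul_nonneg (by linarith) (norm_nonneg _))
  rw [mul_pow, e1, e2, Finset.mul_sum]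
  refine Finset.sum_le_sum fun i _ => ?_
  rw [← mul_pow, norm_smul]
  gcongr
  rw [hw, norm_exp_sub_exp]
  gcongr
  have h1 := i.2.1
  have h2 := i.2.2
  rw [abs_le]
  constructor
  · rw [← Real.sin_neg]
    exact Real.sin_le_sin_of_le_of_le_pi_div_two (by linarith) (by linarith) (by linarith)
  · exact Real.sin_le_sin_of_le_of_le_pi_div_two (by linarith) (by linarith) (by linarith)

/-- The orthogonal projection from `K` to `L` has a kernel for reasons of dimension. -/
theorem exists_mem_orthogonal_of_finrank_lt {K L : Submodule ℂ E} [FiniteDimensional ℂ K]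
    [FiniteDimensional ℂ L] (h : Module.finrank ℂ L < Module.finrank ℂ K) :
    ∃ x ∈ K, x ∈ Lᗮ ∧ x ≠ 0 := by
  let f : K →ₗ[ℂ] L := (L.orthogonalProjectionOnto : E →ₗ[ℂ] L) ∘ₗ K.subtype
  obtain ⟨x, hx, hx0⟩ := Submodule.exists_mem_ne_zero_of_ne_bot (f.ker_ne_bot_of_finrank_lt h)
  refine ⟨x, x.2, ?_, fun h0 => hx0 (Subtype.ext h0)⟩
  rw [← Submodule.starProjection_apply_eq_zero_iff L]
  have hx' : L.orthogonalProjectionOnto (x : E) = 0 := hx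
  rw [Submodule.starProjection_apply, hx']
  rfl

theorem arcSpace_eq_bot {W : E →L[ℂ] E} {a b : ℝ} (h : b ≤ a) : arcSpace W a b = ⊥ := by
  simp [arcSpace, Ico_eq_empty (not_lt.2 h)]

theorem finrank_arcSpace_eq_zero {W : E →L[ℂ] E} {a b : ℝ} (h : b ≤ a) :
    Module.finrank ℂ (arcSpace W a b) = 0 := by
  rw [arcSpace_eq_bot h, finrank_bot]

/-- Perturbation of the number of eigenvalues on an arc: the arc grows by `ε` on both sides. -/
theorem finrank_arcSpace_le {W W' : E →L[ℂ] E} (hW : W ∈ unitaryCompact E)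
    (hW' : W' ∈ unitaryCompact E) {a b ε : ℝ} (hε : 0 < ε) (ha : 0 < a - ε)
    (hb : b + ε < 2 * Real.pi) {L : ℝ} (hL : b - a + 2 * ε ≤ L) (hL' : L < 2 * Real.pi)
    (hd : ‖W - W'‖ < 4 * Real.cos (L / 4) * Real.sin (ε / 4)) :
    Module.finrank ℂ (arcSpace W a b) ≤ Module.finrank ℂ (arcSpace W' (a - ε) (b + ε)) := by
  rcases le_or_gt b a with hba | hab
  · simp [finrank_arcSpace_eq_zero hba]
  have := finiteDimensional_arcSpace hW (a := a) (b := b) (by linarith) (by linarith)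
  have := finiteDimensional_arcSpace hW' ha hb
  by_contra! hlt
  obtain ⟨x, hx, hx', hx0⟩ := exists_mem_orthogonal_of_finrank_lt hlt
  have h1 := norm_sub_le_of_mem_arcSpace hW.1 (by linarith) (by linarith) hx
  have h2 := le_norm_sub_of_mem_orthogonal hW' ha hb (by linarith) hx'
  rw [show (a - ε + (b + ε)) / 2 = (a + b) / 2 by ring,
    show (b + ε - (a - ε)) / 4 = (b - a + 2 * ε) / 4 by ring] at h2
  set w : ℂ := Complex.exp (((a + b) / 2 : ℝ) * Complex.I)
  have h3 : ‖W' x - w • x‖ ≤ ‖W x - w • x‖ + ‖W - W'‖ * ‖x‖ := by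
    have : W' x - w • x = (W x - w • x) - (W - W') x := by
      simp
    rw [this]
    exact (norm_sub_le _ _).trans (by gcongr; exact ContinuousLinearMap.le_opNorm _ _)
  have hpos : 0 < ‖x‖ := norm_pos_iff.2 hx0
  have h4 : 2 * Real.sin ((b - a + 2 * ε) / 4) - 2 * Real.sin ((b - a) / 4) ≤ ‖W - W'‖ := by
    by_contra! hc
    nlinarith
  have hpi := Real.pi_pos
  -- This identity explains the threshold in `hd`. The bound `L` for the length of the widened arc
  -- makes the cosine factor independent of the arc.
  have h5 : Real.sin ((b - a + 2 * ε) / 4) - Real.sin ((b - a) / 4) =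
      2 * Real.sin (ε / 4) * Real.cos ((b - a + ε) / 4) := by
    rw [Real.sin_sub_sin]
    ring_nf
  have h6 : Real.cos (L / 4) ≤ Real.cos ((b - a + ε) / 4) :=
    Real.cos_le_cos_of_nonneg_of_le_pi (by linarith) (by linarith) (by linarith)
  have h7 : 0 < Real.sin (ε / 4) := Real.sin_pos_of_pos_of_lt_pi (by linarith) (by linarith)
  nlinarith

theorem arcSpace_eq_of_gap_right {W : E →L[ℂ] E} {a c ε : ℝ} (hε : 0 ≤ ε)
    (h : ∀ θ ∈ Ico (c - ε) (c + ε), angleSpace W θ = ⊥) :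
    arcSpace W a (c + ε) = arcSpace W a c := by
  refine le_antisymm (iSup₂_le fun θ hθ => ?_) (arcSpace_mono le_rfl (by linarith))
  by_cases hlt : θ < c
  · exact le_iSup₂_of_le (f := fun θ (_ : θ ∈ Ico a c) => angleSpace W θ) θ ⟨hθ.1, hlt⟩ le_rfl
  · rw [h θ ⟨by linarith, hθ.2⟩]
    exact bot_le

theorem arcSpace_eq_of_gap_left {W : E →L[ℂ] E} {b c ε : ℝ} (hε : 0 ≤ ε)
    (h : ∀ θ ∈ Ico (c - ε) (c + ε), angleSpace W θ = ⊥) :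
    arcSpace W (c - ε) b = arcSpace W c b := by
  refine le_antisymm (iSup₂_le fun θ hθ => ?_) (arcSpace_mono (by linarith) le_rfl)
  by_cases hlt : c ≤ θ
  · exact le_iSup₂_of_le (f := fun θ (_ : θ ∈ Ico c b) => angleSpace W θ) θ ⟨hlt, hθ.2⟩ le_rfl
  · rw [h θ ⟨hθ.1, by linarith⟩]
    exact bot_le

/-- Comparison of the counting functions of two nearby operators with a common gap. -/
theorem arcCount_le_of_gap {W W' : E →L[ℂ] E} (hW : W ∈ unitaryCompact E)
    (hW' : W' ∈ unitaryCompact E) {c ε L : ℝ} (hε : 0 < ε) (hc : 0 < c - ε)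
    (hc' : c + ε < 2 * Real.pi) (hL1 : c + ε ≤ L) (hL2 : 2 * Real.pi - c + ε ≤ L)
    (hL : L < 2 * Real.pi)
    (hd : ‖W - W'‖ < 4 * Real.cos (L / 4) * Real.sin (ε / 4))
    (hg : ∀ θ ∈ Ico (c - ε) (c + ε), angleSpace W θ = ⊥)
    (hg' : ∀ θ ∈ Ico (c - ε) (c + ε), angleSpace W' θ = ⊥) {s : ℝ} (hs : 0 < s)
    (ht : s + ε < 2 * Real.pi) : arcCount W (s + ε) c ≤ arcCount W' s c := by
  have hd' : ‖W' - W‖ < 4 * Real.cos (L / 4) * Real.sin (ε / 4) := by rwa [norm_sub_rev]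
  rcases le_or_gt (s + ε) c with h1 | h1
  · have h2 := finrank_arcSpace_le hW hW' (a := s + ε) (b := c) hε (by linarith) (by linarith)
      (L := L) (by linarith) hL hd
    rw [add_sub_cancel_right, arcSpace_eq_of_gap_right hε.le hg'] at h2
    simp only [arcCount, finrank_arcSpace_eq_zero h1, finrank_arcSpace_eq_zero (show s ≤ c by linarith)]
    omega
  · rcases le_or_gt s c with h2 | h2
    · simp only [arcCount, finrank_arcSpace_eq_zero h1.le, finrank_arcSpace_eq_zero h2]
      omega
    · have h3 := finrank_arcSpace_le hW' hW (a := c) (b := s) hε (by linarith) (by linarith)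
        (L := L) (by linarith) hL hd'
      rw [arcSpace_eq_of_gap_left hε.le hg] at h3
      simp only [arcCount, finrank_arcSpace_eq_zero h1.le, finrank_arcSpace_eq_zero h2.le]
      omega

/-- The function `θ ↦ N(exp(iθ), exp(ic); W)`. -/
def countFunAt (W : E →L[ℂ] E) (hW : W ∈ unitaryCompact E) (c : Ioo (0 : ℝ) (2 * Real.pi)) :
    CircleFun where
  toFun θ := arcCount W θ c
  antitone' := arcCount_antitone hW c.2
  leftCont' := arcCount_leftCont hW

theorem dist_countFunAt_le {W W' : E →L[ℂ] E} (hW : W ∈ unitaryCompact E)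
    (hW' : W' ∈ unitaryCompact E) {c : Ioo (0 : ℝ) (2 * Real.pi)} {ε L : ℝ} (hε : 0 < ε)
    (hc : 0 < c - ε) (hc' : c + ε < 2 * Real.pi) (hL1 : c + ε ≤ L)
    (hL2 : 2 * Real.pi - c + ε ≤ L) (hL : L < 2 * Real.pi)
    (hd : ‖W - W'‖ < 4 * Real.cos (L / 4) * Real.sin (ε / 4))
    (hg : ∀ θ ∈ Ico (c - ε) (c + ε), angleSpace W θ = ⊥)
    (hg' : ∀ θ ∈ Ico (c - ε) (c + ε), angleSpace W' θ = ⊥) :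
    dist (countFunAt W hW c) (countFunAt W' hW' c) ≤ ε := by
  have hd' : ‖W' - W‖ < 4 * Real.cos (L / 4) * Real.sin (ε / 4) := by rwa [norm_sub_rev]
  refine CircleFun.dist_le_of_forall fun n => ?_
  have h1 := CircleFun.nu_le_add_of_forall (f := countFunAt W hW c) (g := countFunAt W' hW' c)
    hε.le (fun s t hst => by
      change arcCount W t c ≤ arcCount W' s c
      rw [hst]
      exact arcCount_le_of_gap hW hW' hε hc hc' hL1 hL2 hL hd hg hg' s.2.1 (hst ▸ t.2.2)) n
  have h2 := CircleFun.nu_le_add_of_forall (f := countFunAt W' hW' c) (g := countFunAt W hW c)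
    hε.le (fun s t hst => by
      change arcCount W' t c ≤ arcCount W s c
      rw [hst]
      exact arcCount_le_of_gap hW' hW hε hc hc' hL1 hL2 hL hd' hg' hg s.2.1 (hst ▸ t.2.2)) n
  rw [abs_le]
  constructor <;> linarith

theorem disjoint_arcSpace {W : E →L[ℂ] E} (hW : W ∈ unitary (E →L[ℂ] E))
    {a b c d : ℝ} (ha : 0 < a) (hbc : b ≤ c) (hd : d < 2 * Real.pi) :
    Disjoint (arcSpace W a b) (arcSpace W c d) := by
  rcases le_or_gt b a with h | h
  · rw [arcSpace_eq_bot h]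
    exact disjoint_bot_left
  rcases le_or_gt d c with h' | h'
  · rw [arcSpace_eq_bot h']
    exact disjoint_bot_right
  refine Submodule.IsOrtho.disjoint ?_
  rw [arcSpace, arcSpace]
  simp only [Submodule.isOrtho_iSup_left, Submodule.isOrtho_iSup_right]
  intro s hs t ht
  rw [Submodule.isOrtho_iff_inner_eq]
  intro x hx y hy
  exact inner_eq_zero_of_ne hW ⟨by linarith [ht.1], by linarith [ht.2, hs.1]⟩
    ⟨by linarith [ht.1, hs.1], by linarith [hs.2]⟩ (by linarith [ht.2, hs.1]) hx hy

theorem finrank_arcSpace_add {W : E →L[ℂ] E} (hW : W ∈ unitaryCompact E) {a b c : ℝ} (ha : 0 < a)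
    (hab : a ≤ b) (hbc : b ≤ c) (hc : c < 2 * Real.pi) :
    Module.finrank ℂ (arcSpace W a c) =
      Module.finrank ℂ (arcSpace W a b) + Module.finrank ℂ (arcSpace W b c) := by
  have := finiteDimensional_arcSpace hW (a := a) (b := b) ha (by linarith)
  have := finiteDimensional_arcSpace hW (a := b) (b := c) (by linarith) hc
  have h1 : arcSpace W a c = arcSpace W a b ⊔ arcSpace W b c := by
    rw [arcSpace, arcSpace, arcSpace, ← iSup_union, Ico_union_Ico_eq_Ico hab hbc]
  have h2 := Submodule.finrank_sup_add_finrank_inf_eq (arcSpace W a b) (arcSpace W b c)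
  rw [(disjoint_arcSpace hW.1 ha le_rfl hc).eq_bot, finrank_bot, add_zero] at h2
  rw [h1, h2]

theorem arcCount_add {W : E →L[ℂ] E} (hW : W ∈ unitaryCompact E)
    (a b c : Ioo (0 : ℝ) (2 * Real.pi)) : arcCount W a b + arcCount W b c = arcCount W a c := by
  have key : ∀ a b c : Ioo (0 : ℝ) (2 * Real.pi), a ≤ b → b ≤ c →
      (Module.finrank ℂ (arcSpace W a c) : ℤ) =
        Module.finrank ℂ (arcSpace W a b) + Module.finrank ℂ (arcSpace W b c) := by
    intro a b c h1 h2
    exact_mod_cast finrank_arcSpace_add hW a.2.1 h1 h2 c.2.2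
  have hz : ∀ a b : Ioo (0 : ℝ) (2 * Real.pi), b ≤ a → Module.finrank ℂ (arcSpace W a b) = 0 := by
    intro a b h
    rw [arcSpace_eq_bot (show (b : ℝ) ≤ a from h), finrank_bot]
  simp only [arcCount]
  rcases le_total a b with h1 | h1 <;> rcases le_total b c with h2 | h2 <;>
    rcases le_total a c with h3 | h3
  · have := key a b c h1 h2; have := hz _ _ h1; have := hz _ _ h2; have := hz _ _ h3; omega
  · have := key a b c h1 h2; have := hz _ _ h1; have := hz _ _ h2; have := hz _ _ h3
    have := key c a b h3 h1; have := key b c a h2 h3; omega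
  · have := key a c b h3 h2; have := hz _ _ h1; have := hz _ _ h2; have := hz _ _ h3; omega
  · have := key c a b h3 h1; have := hz _ _ h1; have := hz _ _ h2; have := hz _ _ h3; omega
  · have := key b a c h1 h3; have := hz _ _ h1; have := hz _ _ h2; have := hz _ _ h3; omega
  · have := key b c a h2 h3; have := hz _ _ h1; have := hz _ _ h2; have := hz _ _ h3; omega
  · have := key c b a h2 h1; have := hz _ _ h1; have := hz _ _ h2; have := hz _ _ h3
    have := key b a c h1 h3; have := key a c b h3 h2; omega
  · have := key c b a h2 h1; have := hz _ _ h1; have := hz _ _ h2; have := hz _ _ h3; omega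

/-- Continuity is proved with a reference point in a spectral gap of `W`; the point `-1` may itself
be an eigenvalue, and counts relative to it may then jump. -/
theorem eta_eq_proj_countFunAt {W : E →L[ℂ] E} (hW : W ∈ unitaryCompact E)
    (c : Ioo (0 : ℝ) (2 * Real.pi)) : eta W = CircleClass.proj (countFunAt W hW c) := by
  rw [eta, dif_pos hW, CircleClass.proj_eq_iff]
  refine ⟨arcCount W c Real.pi, CircleFun.ext' fun θ => ?_⟩
  exact (arcCount_add hW θ c ⟨Real.pi, Real.pi_pos, by linarith [Real.pi_pos]⟩).symm

/-- The class `η(W)` depends continuously on `W` in the operator norm. -/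
theorem continuousOn_eta : ContinuousOn (eta : (E →L[ℂ] E) → CircleClass) (unitaryCompact E) := by
  intro W hW
  have hpi := Real.pi_pos
  -- a gap in the spectrum of `W`
  obtain ⟨c, δ, hδ, hc1, hc2, hgap⟩ : ∃ c δ : ℝ, 0 < δ ∧ Real.pi / 2 < c - δ ∧
      c + δ < 3 * Real.pi / 2 ∧ ∀ θ ∈ Ico (c - δ) (c + δ), angleSpace W θ = ⊥ := by
    have hfin := finite_angles hW (a := Real.pi / 2) (b := 3 * Real.pi / 2) (by linarith)
      (by linarith)
    obtain ⟨c, hc, hcn⟩ := (Ioo_infinite (show Real.pi / 2 < 3 * Real.pi / 2 by linarith)).exists_notMem_finset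
      hfin.toFinset
    have hopen : IsOpen ({θ | θ ∈ Ico (Real.pi / 2) (3 * Real.pi / 2) ∧ angleSpace W θ ≠ ⊥}ᶜ ∩
        Ioo (Real.pi / 2) (3 * Real.pi / 2)) := hfin.isClosed.isOpen_compl.inter isOpen_Ioo
    obtain ⟨δ, hδ, hsub⟩ := Metric.isOpen_iff.1 hopen c ⟨by simpa using hcn, hc⟩
    have hin : ∀ θ, |θ - c| < δ → Real.pi / 2 < θ ∧ θ < 3 * Real.pi / 2 ∧ angleSpace W θ = ⊥ := by
      intro θ hθ
      have h1 := hsub (show θ ∈ Metric.ball c δ by rwa [Metric.mem_ball, Real.dist_eq])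
      refine ⟨h1.2.1, h1.2.2, ?_⟩
      by_contra hne
      exact h1.1 ⟨⟨h1.2.1.le, h1.2.2⟩, hne⟩
    refine ⟨c, δ / 2, by linarith, ?_, ?_, fun θ hθ => (hin θ ?_).2.2⟩
    · exact (hin (c - δ / 2) (by rw [abs_lt]; constructor <;> linarith)).1
    · exact (hin (c + δ / 2) (by rw [abs_lt]; constructor <;> linarith)).2.1
    · rw [abs_lt]
      constructor <;> linarith [hθ.1, hθ.2]
  set c' : Ioo (0 : ℝ) (2 * Real.pi) := ⟨c, by linarith, by linarith⟩ with hc'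
  rw [Metric.continuousWithinAt_iff]
  intro e he
  set ε : ℝ := min (e / 2) (δ / 2) with hεdef
  have hε : 0 < ε := lt_min (by linarith) (by linarith)
  have hεe : ε ≤ e / 2 := min_le_left _ _
  have hεδ : ε ≤ δ / 2 := min_le_right _ _
  -- The gap lies in `(π/2, 3π/2)`, so the arcs to be compared have length below `3π/2` even after
  -- widening. Any `L` from there up to but not including `2π` would serve, as `cos (L/4)` has to be
  -- positive.
  set L : ℝ := 7 * Real.pi / 4 with hL
  have hcos : 0 < Real.cos (L / 4) := Real.cos_pos_of_mem_Ioo ⟨by linarith, by linarith⟩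
  have hsin : 0 < Real.sin (ε / 4) := Real.sin_pos_of_pos_of_lt_pi (by linarith) (by linarith)
  have hκ : 0 < 4 * Real.cos (L / 4) * Real.sin (ε / 4) := by positivity
  refine ⟨_, hκ, fun W' hW' hdist => ?_⟩
  rw [dist_eq_norm] at hdist
  -- The interval `(c - ε, c + ε)`, widened by `ε`, still lies in the gap of `W` because `2ε ≤ δ`.
  -- So the number of eigenvalues of `W'` is bounded by zero there.
  have hgap' : ∀ θ ∈ Ico (c - ε) (c + ε), angleSpace W' θ = ⊥ := by
    have h1 := finrank_arcSpace_le hW' hW (a := c - ε) (b := c + ε) hε (by linarith) (by linarith)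
      (L := L) (by linarith) (by linarith) hdist
    have h2 : arcSpace W (c - ε - ε) (c + ε + ε) = ⊥ := by
      rw [eq_bot_iff]
      exact iSup₂_le fun θ hθ => (hgap θ ⟨by linarith [hθ.1], by linarith [hθ.2]⟩).le
    rw [h2, finrank_bot, Nat.le_zero] at h1
    have := finiteDimensional_arcSpace hW' (a := c - ε) (b := c + ε) (by linarith) (by linarith)
    rw [Submodule.finrank_eq_zero] at h1
    intro θ hθ
    rw [eq_bot_iff, ← h1]
    exact le_iSup₂_of_le (f := fun θ (_ : θ ∈ Ico (c - ε) (c + ε)) => angleSpace W' θ) θ hθ le_rfl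
  rw [eta_eq_proj_countFunAt hW c', eta_eq_proj_countFunAt hW' c']
  refine (CircleClass.rho_le _ _).trans_lt ?_
  refine (dist_countFunAt_le hW' hW (L := L) hε (show 0 < c - ε by linarith)
    (show c + ε < 2 * Real.pi by linarith) (show c + ε ≤ L by linarith)
    (show 2 * Real.pi - c + ε ≤ L by linarith) (by linarith) hdist hgap'
    fun θ hθ => hgap θ ⟨?_, ?_⟩).trans_lt (by linarith)
  · have : c - ε ≤ θ := hθ.1
    linarith
  · have : θ < c + ε := hθ.2
    linarith

/-! ### Spectral flow of paths of unitary operators. -/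

theorem one_mem_unitaryCompact : (1 : E →L[ℂ] E) ∈ unitaryCompact E :=
  ⟨one_mem _, by rw [sub_self]; exact isCompactOperator_zero⟩

theorem mul_mem_unitaryCompact {A B : E →L[ℂ] E} (hA : A ∈ unitaryCompact E)
    (hB : B ∈ unitaryCompact E) : A * B ∈ unitaryCompact E := by
  refine ⟨mul_mem hA.1 hB.1, ?_⟩
  have : A * B - 1 = (A - 1) * B + (B - 1) := by noncomm_ring
  rw [this]
  exact (hA.2.comp_clm B).add hB.2

theorem star_mem_unitaryCompact {A : E →L[ℂ] E} (hA : A ∈ unitaryCompact E) :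
    star A ∈ unitaryCompact E := by
  refine ⟨Unitary.star_mem hA.1, ?_⟩
  have : star A - 1 = -(star A * (A - 1)) := by
    rw [mul_sub, (Unitary.mem_iff.1 hA.1).1]
    noncomm_ring
  rw [this]
  exact (hA.2.clm_comp (star A)).neg

theorem continuous_eta_comp {X : Type*} [TopologicalSpace X] {F : X → E →L[ℂ] E}
    (hF : Continuous F) (h : ∀ x, F x ∈ unitaryCompact E) : Continuous fun x => eta (F x) :=
  continuousOn_eta.comp_continuous hF h

open Classical in
/-- The spectral flow of a path of unitary operators on `[0, 1]`. -/
def flow (W : unitInterval → E →L[ℂ] E) (θ : Ioo (0 : ℝ) (2 * Real.pi)) : ℤ :=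
  if h : Continuous fun t => eta (W t) then CircleClass.increment ⟨_, h⟩ θ else 0

theorem flow_eq_increment {W : unitInterval → E →L[ℂ] E} {γ : C(unitInterval, CircleClass)}
    (h : ∀ t, γ t = eta (W t)) (θ : Ioo (0 : ℝ) (2 * Real.pi)) :
    flow W θ = CircleClass.increment γ θ := by
  have h' : (γ : unitInterval → CircleClass) = fun t => eta (W t) := funext h
  have hc : Continuous fun t => eta (W t) := h' ▸ γ.continuous
  rw [flow, dif_pos hc]
  congr 1
  ext t
  exact (h t).symm

theorem flow_eq_of_lift {W : unitInterval → E →L[ℂ] E} (hc : Continuous W)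
    (hW : ∀ t, W t ∈ unitaryCompact E) {g : unitInterval → CircleFun} (hg : Continuous g)
    (h : ∀ t, CircleClass.proj (g t) = eta (W t)) (θ : Ioo (0 : ℝ) (2 * Real.pi)) :
    flow W θ = g 1 θ - g 0 θ := by
  rw [flow_eq_increment (γ := ⟨_, continuous_eta_comp hc hW⟩) fun _ => rfl]
  exact CircleClass.increment_eq hg h θ

theorem flow_of_const {W : unitInterval → E →L[ℂ] E} (h : ∀ t, W t = W 0)
    (θ : Ioo (0 : ℝ) (2 * Real.pi)) : flow W θ = 0 := by
  rw [flow_eq_increment (γ := ContinuousMap.const _ (eta (W 0))) fun t => by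
    rw [h t]; rfl]
  exact CircleClass.increment_of_const (fun _ => rfl) θ

/-- The spectral flows along the two ways around a square agree. -/
theorem flow_square {F : unitInterval × unitInterval → E →L[ℂ] E} (hF : Continuous F)
    (h : ∀ x, F x ∈ unitaryCompact E) (θ : Ioo (0 : ℝ) (2 * Real.pi)) :
    flow (fun t => F (0, t)) θ + flow (fun s => F (s, 1)) θ =
      flow (fun s => F (s, 0)) θ + flow (fun t => F (1, t)) θ := by
  have hc := continuous_eta_comp hF h
  have hl : ∀ x : unitInterval, Continuous fun t => eta (F (x, t)) :=
    fun x => continuous_eta_comp (by fun_prop) fun _ => h _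
  have hr : ∀ x : unitInterval, Continuous fun s => eta (F (s, x)) :=
    fun x => continuous_eta_comp (by fun_prop) fun _ => h _
  rw [flow_eq_increment (γ := ⟨_, hl 0⟩) fun _ => rfl,
    flow_eq_increment (γ := ⟨_, hr 1⟩) fun _ => rfl,
    flow_eq_increment (γ := ⟨_, hr 0⟩) fun _ => rfl,
    flow_eq_increment (γ := ⟨_, hl 1⟩) fun _ => rfl]
  exact CircleClass.increment_square ⟨_, hc⟩ (fun _ => rfl) (fun _ => rfl) (fun _ => rfl)
    (fun _ => rfl) θ

/-- In the square `(s, t) ↦ A(t) B(st)` one way around runs through `A` and then through `B`. The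
other way is a constant edge followed by the product path. -/
theorem flow_mul {A B : unitInterval → E →L[ℂ] E} (hAc : Continuous A) (hBc : Continuous B)
    (hA : ∀ t, A t ∈ unitaryCompact E) (hB : ∀ t, B t ∈ unitaryCompact E) (hA1 : A 1 = 1)
    (hB0 : B 0 = 1) (θ : Ioo (0 : ℝ) (2 * Real.pi)) :
    flow (fun t => A t * B t) θ = flow A θ + flow B θ := by
  have := flow_square (F := fun x : unitInterval × unitInterval => A x.2 * B (x.1 * x.2))
    (by fun_prop) (fun x => mul_mem_unitaryCompact (hA _) (hB _)) θ
  simp only [zero_mul, mul_zero, one_mul, mul_one, hA1, hB0] at this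
  rw [flow_of_const (W := fun _ => A 0) (fun _ => rfl), zero_add] at this
  exact this.symm

theorem angleSpace_one {θ : ℝ} (hθ : θ ∈ Ioo (0 : ℝ) (2 * Real.pi)) :
    angleSpace (1 : E →L[ℂ] E) θ = ⊥ := by
  rw [eq_bot_iff]
  intro x hx
  have h1 : x = Complex.exp (θ * Complex.I) • x := mem_angleSpace.1 hx
  have h2 : Complex.exp (θ * Complex.I) ≠ 1 := by
    rw [Ne, ← sub_eq_zero, ← norm_eq_zero]
    have := norm_exp_sub_exp θ 0
    rw [Complex.ofReal_zero, zero_mul, Complex.exp_zero, sub_zero] at this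
    rw [this]
    have := Real.sin_pos_of_pos_of_lt_pi (x := θ / 2) (by linarith [hθ.1]) (by linarith [hθ.2])
    positivity
  have h3 : (Complex.exp (θ * Complex.I) - 1) • x = 0 := by
    rw [sub_smul, one_smul, ← h1, sub_self]
  exact (smul_eq_zero.1 h3).resolve_left (sub_ne_zero.2 h2)

theorem arcSpace_of_forall_eq_bot {W : E →L[ℂ] E} {a b : ℝ}
    (h : ∀ θ ∈ Ico a b, angleSpace W θ = ⊥) : arcSpace W a b = ⊥ :=
  eq_bot_iff.2 (iSup₂_le fun θ hθ => (h θ hθ).le)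

/-- The identity has no eigenvalue on the punctured circle, so every representative of its class is
constant. This makes the flow of a loop at the identity independent of `θ`. -/
theorem eta_one_lift {g : CircleFun} (hg : CircleClass.proj g = eta (1 : E →L[ℂ] E))
    (θ θ' : Ioo (0 : ℝ) (2 * Real.pi)) : g θ = g θ' := by
  have hone := one_mem_unitaryCompact (E := E)
  rw [eta, dif_pos hone] at hg
  obtain ⟨n, rfl⟩ := CircleClass.proj_eq_iff.1 hg
  have hpi := Real.pi_pos
  have : ∀ θ : Ioo (0 : ℝ) (2 * Real.pi), arcCount (1 : E →L[ℂ] E) θ Real.pi = 0 := by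
    intro θ
    rw [arcCount, arcSpace_of_forall_eq_bot fun t ht =>
        angleSpace_one ⟨θ.2.1.trans_le ht.1, by linarith [ht.2]⟩,
      arcSpace_of_forall_eq_bot fun t ht =>
        angleSpace_one ⟨by linarith [ht.1], by linarith [ht.2, θ.2.2]⟩, finrank_bot]
    rfl
  change arcCount (1 : E →L[ℂ] E) θ Real.pi + n = arcCount (1 : E →L[ℂ] E) θ' Real.pi + n
  rw [this, this]

/-- The flow of a loop based at the identity is the same through all points. -/
theorem flow_loop {W : unitInterval → E →L[ℂ] E} (hc : Continuous W)
    (hW : ∀ t, W t ∈ unitaryCompact E) (h0 : W 0 = 1) (h1 : W 1 = 1)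
    (θ θ' : Ioo (0 : ℝ) (2 * Real.pi)) : flow W θ = flow W θ' := by
  obtain ⟨g, hg⟩ := CircleClass.exists_lift ⟨_, continuous_eta_comp hc hW⟩
  rw [flow_eq_of_lift hc hW g.continuous hg, flow_eq_of_lift hc hW g.continuous hg,
    eta_one_lift (E := E) (g := g 0) (by rw [hg, ← h0]; rfl) θ θ',
    eta_one_lift (E := E) (g := g 1) (by rw [hg, ← h1]; rfl) θ θ']

/-- A loop close to the identity has no spectral flow. -/
theorem flow_eq_zero_of_norm_lt {W : unitInterval → E →L[ℂ] E} (hc : Continuous W)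
    (hW : ∀ t, W t ∈ unitaryCompact E) (h0 : W 0 = 1) (h1 : W 1 = 1)
    (hn : ∀ t, ‖W t - 1‖ < 1) (θ : Ioo (0 : ℝ) (2 * Real.pi)) : flow W θ = 0 := by
  have hpi := Real.pi_pos
  set p : Ioo (0 : ℝ) (2 * Real.pi) := ⟨Real.pi, by linarith, by linarith⟩ with hp
  rw [flow_loop hc hW h0 h1 θ p]
  obtain ⟨g, hg⟩ := CircleClass.exists_lift ⟨_, continuous_eta_comp hc hW⟩
  rw [flow_eq_of_lift hc hW g.continuous hg]
  -- `|exp(iu) - 1| = 2 sin (u/2)` is at least `1` for `u` in `[π/3, 5π/3]`. An operator closer than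
  -- `1` to the identity has no eigenvalue there, whence the half-width `2π/3` around `π`. The value
  -- of the lift at `π` is therefore locally constant along the loop.
  have hbot : ∀ t, ∀ u : ℝ, |u - Real.pi| < 2 * Real.pi / 3 → angleSpace (W t) u = ⊥ := by
    intro t u hu
    rw [abs_lt] at hu
    rw [eq_bot_iff]
    intro x hx
    by_contra hx0
    have hx0 : x ≠ 0 := hx0
    have e1 : (W t - 1) x = (Complex.exp (u * Complex.I) - 1) • x := by
      rw [sub_smul, one_smul, ← mem_angleSpace.1 hx]
      rfl
    have e2 := (W t - 1).le_opNorm x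
    have e3 := norm_exp_sub_exp u 0
    rw [Complex.ofReal_zero, zero_mul, Complex.exp_zero, sub_zero] at e3
    rw [e1, norm_smul, e3] at e2
    have e4 : 1 / 2 ≤ Real.sin (u / 2) := by
      rw [← Real.sin_pi_div_six]
      rcases le_or_gt (u / 2) (Real.pi / 2) with h | h
      · exact Real.sin_le_sin_of_le_of_le_pi_div_two (by linarith) h (by linarith)
      · rw [← Real.sin_pi_sub (u / 2)]
        exact Real.sin_le_sin_of_le_of_le_pi_div_two (by linarith) (by linarith) (by linarith)
    have e5 := le_abs_self (Real.sin (u / 2))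
    have e6 := norm_pos_iff.2 hx0
    have e7 := hn t
    nlinarith
  have hconst : ∀ t, ∀ u : Ioo (0 : ℝ) (2 * Real.pi), |(u : ℝ) - p| < 2 * Real.pi / 3 →
      g t u = g t p := by
    intro t u hu
    have h2 : CircleClass.proj (g t) = eta (W t) := hg t
    rw [eta, dif_pos (hW t)] at h2
    obtain ⟨n, hn⟩ := CircleClass.proj_eq_iff.1 h2
    rw [hn]
    change arcCount (W t) u Real.pi + n = arcCount (W t) Real.pi Real.pi + n
    congr 1
    rw [abs_lt] at hu
    change _ < (u : ℝ) - Real.pi ∧ (u : ℝ) - Real.pi < _ at hu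
    rcases le_total (u : ℝ) Real.pi with h | h
    · exact arcCount_eq h fun v hv => hbot t v (by
        rw [abs_lt]; constructor <;> linarith [hv.1, hv.2])
    · exact (arcCount_eq h fun v hv => hbot t v (by
        rw [abs_lt]; constructor <;> linarith [hv.1, hv.2])).symm
  have hloc : IsLocallyConstant fun t => g t p := by
    rw [IsLocallyConstant.iff_eventually_eq]
    intro t
    have : ∀ᶠ t' in 𝓝 t, dist (g t') (g t) < 2 * Real.pi / 3 :=
      (g.continuous.tendsto t) (Metric.ball_mem_nhds _ (by linarith))
    filter_upwards [this] with t' ht'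
    refine CircleFun.eq_of_dist_lt (δ := 2 * Real.pi / 3) ?_ ?_ (hconst t) (by rwa [dist_comm])
    · change 2 * Real.pi / 3 ≤ Real.pi
      linarith
    · change Real.pi + 2 * Real.pi / 3 ≤ 2 * Real.pi
      linarith
  rw [hloc.apply_eq_of_preconnectedSpace 1 0, sub_self]

/-- The operator that is `exp(iφ)` on `K` and the identity on the orthogonal complement. -/
def phaseOp (K : Submodule ℂ E) [K.HasOrthogonalProjection] (φ : ℝ) : E →L[ℂ] E :=
  1 + (Complex.exp (φ * Complex.I) - 1) • K.starProjection

theorem isCompactOperator_starProjection (K : Submodule ℂ E) [FiniteDimensional ℂ K] :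
    IsCompactOperator ⇑(K.starProjection) := by
  have : IsCompactOperator (K.orthogonalProjectionOnto : E → K) := by
    refine ⟨Metric.closedBall 0 1, isCompact_closedBall 0 1, ?_⟩
    exact K.orthogonalProjectionOnto.continuous.continuousAt.preimage_mem_nhds
      (by rw [map_zero]; exact Metric.closedBall_mem_nhds _ one_pos)
  exact this.clm_comp K.subtypeL

theorem phaseOp_mul (K : Submodule ℂ E) [K.HasOrthogonalProjection] (φ ψ : ℝ) :
    phaseOp K φ * phaseOp K ψ = phaseOp K (φ + ψ) := by
  have hPP : K.starProjection * K.starProjection = K.starProjection :=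
    K.isIdempotentElem_starProjection
  have e : Complex.exp ((φ + ψ : ℝ) * Complex.I) =
      Complex.exp (φ * Complex.I) * Complex.exp (ψ * Complex.I) := by
    rw [← Complex.exp_add]
    push_cast
    ring_nf
  simp only [phaseOp, mul_add, add_mul, one_mul, mul_one, smul_mul_smul_comm, hPP, e]
  module

theorem phaseOp_zero (K : Submodule ℂ E) [K.HasOrthogonalProjection] : phaseOp K 0 = 1 := by
  simp [phaseOp]

theorem phaseOp_two_pi (K : Submodule ℂ E) [K.HasOrthogonalProjection] :
    phaseOp K (2 * Real.pi) = 1 := by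
  simp [phaseOp]

theorem star_phaseOp (K : Submodule ℂ E) [K.HasOrthogonalProjection] (φ : ℝ) :
    star (phaseOp K φ) = phaseOp K (-φ) := by
  have hPs : star K.starProjection = K.starProjection := isSelfAdjoint_starProjection K
  rw [phaseOp, phaseOp, star_add, star_one, star_smul, hPs]
  congr 2
  rw [star_sub, star_one, Complex.star_def, ← Complex.exp_conj]
  congr 2
  simp

theorem phaseOp_mem_unitaryCompact (K : Submodule ℂ E) [FiniteDimensional ℂ K] (φ : ℝ) :
    phaseOp K φ ∈ unitaryCompact E := by
  refine ⟨?_, ?_⟩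
  · rw [Unitary.mem_iff, star_phaseOp, phaseOp_mul, phaseOp_mul, neg_add_cancel, add_neg_cancel,
      phaseOp_zero]
    exact ⟨rfl, rfl⟩
  · rw [phaseOp, add_sub_cancel_left]
    exact (isCompactOperator_starProjection K).smul (Complex.exp (φ * Complex.I) - 1)

theorem continuous_phaseOp (K : Submodule ℂ E) [K.HasOrthogonalProjection] :
    Continuous (phaseOp K) := by
  unfold phaseOp
  fun_prop

theorem angleSpace_phaseOp_self (K : Submodule ℂ E) [K.HasOrthogonalProjection] {φ : ℝ}
    (hφ : φ ∈ Ioo (0 : ℝ) (2 * Real.pi)) : angleSpace (phaseOp K φ) φ = K := by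
  have h1 : Complex.exp (φ * Complex.I) - 1 ≠ 0 := by
    rw [← norm_ne_zero_iff]
    have := norm_exp_sub_exp φ 0
    rw [Complex.ofReal_zero, zero_mul, Complex.exp_zero, sub_zero] at this
    rw [this]
    have := Real.sin_pos_of_pos_of_lt_pi (x := φ / 2) (by linarith [hφ.1]) (by linarith [hφ.2])
    positivity
  ext x
  rw [mem_angleSpace, ← Submodule.starProjection_eq_self_iff]
  have : phaseOp K φ x = Complex.exp (φ * Complex.I) • x ↔
      (Complex.exp (φ * Complex.I) - 1) • K.starProjection x =
        (Complex.exp (φ * Complex.I) - 1) • x := by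
    simp only [phaseOp, add_apply, one_apply_eq_self, smul_apply, sub_smul (M := E), one_smul]
    constructor <;> intro h
    · rw [← h]
      abel
    · rw [h]
      abel
  rw [this]
  exact smul_right_inj h1

theorem angleSpace_phaseOp_of_ne (K : Submodule ℂ E) [K.HasOrthogonalProjection] {φ t : ℝ}
    (hφ : φ ∈ Icc (0 : ℝ) (2 * Real.pi)) (ht : t ∈ Ioo (0 : ℝ) (2 * Real.pi)) (hne : t ≠ φ) :
    angleSpace (phaseOp K φ) t = ⊥ := by
  have hexp : ∀ s ∈ Icc (0 : ℝ) (2 * Real.pi), t ≠ s →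
      Complex.exp (t * Complex.I) - Complex.exp (s * Complex.I) ≠ 0 := by
    intro s hs hts
    rw [← norm_ne_zero_iff, norm_exp_sub_exp, mul_ne_zero_iff, abs_ne_zero]
    refine ⟨two_ne_zero, ?_⟩
    rcases lt_or_gt_of_ne hts with h | h
    · exact (Real.sin_neg_of_neg_of_neg_pi_lt (by linarith) (by linarith [hs.2, ht.1])).ne
    · exact (Real.sin_pos_of_pos_of_lt_pi (by linarith) (by linarith [hs.1, ht.2])).ne'
  rw [eq_bot_iff]
  intro x hx
  have h1 := mem_angleSpace.1 hx
  have h2 : (Complex.exp (φ * Complex.I) - 1) • K.starProjection x =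
      (Complex.exp (t * Complex.I) - 1) • x := by
    rw [sub_smul (Complex.exp (t * Complex.I)), one_smul, ← h1]
    simp [phaseOp]
  have hPP : K.starProjection (K.starProjection x) = K.starProjection x :=
    Submodule.starProjection_eq_self_iff.2 (Submodule.starProjection_apply_mem K x)
  have h3 := congrArg K.starProjection h2
  rw [map_smul, map_smul, hPP] at h3
  have h4 : (Complex.exp (t * Complex.I) - Complex.exp (φ * Complex.I)) • K.starProjection x = 0 := by
    have := sub_eq_zero.2 h3.symm
    rw [← sub_smul] at this
    simpa using this
  have h5 := (smul_eq_zero.1 h4).resolve_left (hexp φ hφ hne)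
  rw [h5, smul_zero] at h2
  have h6 := hexp 0 ⟨le_rfl, by linarith [Real.pi_pos]⟩ ht.1.ne'
  rw [Complex.ofReal_zero, zero_mul, Complex.exp_zero] at h6
  exact (smul_eq_zero.1 h2.symm).resolve_left h6

theorem finrank_arcSpace_phaseOp (K : Submodule ℂ E) [FiniteDimensional ℂ K] {φ a b : ℝ}
    (hφ : φ ∈ Icc (0 : ℝ) (2 * Real.pi)) (ha : 0 < a) (hb : b < 2 * Real.pi) :
    Module.finrank ℂ (arcSpace (phaseOp K φ) a b) =
      if φ ∈ Ico a b then Module.finrank ℂ K else 0 := by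
  split_ifs with h
  · have : arcSpace (phaseOp K φ) a b = K := by
      have hself := angleSpace_phaseOp_self K (φ := φ) ⟨ha.trans_le h.1, h.2.trans hb⟩
      refine le_antisymm (iSup₂_le fun t ht => ?_) ?_
      · by_cases hne : t = φ
        · rw [hne, hself]
        · rw [angleSpace_phaseOp_of_ne K hφ ⟨ha.trans_le ht.1, ht.2.trans hb⟩ hne]
          exact bot_le
      · exact hself.ge.trans (le_iSup₂_of_le
          (f := fun t (_ : t ∈ Ico a b) => angleSpace (phaseOp K φ) t) φ h le_rfl)
    rw [this]
  · rw [arcSpace_of_forall_eq_bot fun t ht => angleSpace_phaseOp_of_ne K hφ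
      ⟨ha.trans_le ht.1, ht.2.trans hb⟩ fun hne => h (hne ▸ ht), finrank_bot]

/-- The step function `m · 1_{θ ≤ φ}`. -/
def stepFun (m : ℕ) (φ : ℝ) : CircleFun where
  toFun θ := if (θ : ℝ) ≤ φ then m else 0
  antitone' s t hst := by
    have : (s : ℝ) ≤ t := hst
    simp only
    split_ifs with h1 h2 <;> first | omega | (exfalso; linarith)
  leftCont' θ := by
    by_cases h : (θ : ℝ) ≤ φ
    · refine (continuousWithinAt_const (b := (m : ℤ))).congr (fun t ht => if_pos ?_) (if_pos h)
      exact (show (t : ℝ) ≤ θ from ht).trans h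
    · refine (continuousWithinAt_const (b := (0 : ℤ))).congr_of_eventuallyEq ?_ (if_neg h)
      have : ∀ᶠ t : Ioo (0 : ℝ) (2 * Real.pi) in 𝓝 θ, φ < t :=
        (isOpen_Ioi.preimage continuous_subtype_val).mem_nhds (not_le.1 h)
      filter_upwards [this.filter_mono nhdsWithin_le_nhds] with t ht
      exact if_neg (not_le.2 ht)

theorem dist_stepFun_le (m : ℕ) (φ ψ : ℝ) : dist (stepFun m φ) (stepFun m ψ) ≤ |φ - ψ| := by
  have key : ∀ φ ψ : ℝ, ∀ n, (stepFun m φ).nu n ≤ (stepFun m ψ).nu n + |φ - ψ| := by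
    intro φ ψ n
    refine CircleFun.nu_le_add_of_forall (abs_nonneg _) (fun s t hst => ?_) n
    change (if (t : ℝ) ≤ φ then (m : ℤ) else 0) ≤ if (s : ℝ) ≤ ψ then (m : ℤ) else 0
    have := le_abs_self (φ - ψ)
    split_ifs with h1 h2 <;> first | omega | (exfalso; linarith)
  refine CircleFun.dist_le_of_forall fun n => ?_
  have h1 := key φ ψ n
  have h2 := key ψ φ n
  rw [abs_sub_comm ψ φ] at h2
  rw [abs_le]
  constructor <;> linarith

theorem continuous_stepFun (m : ℕ) : Continuous (stepFun m) := by
  refine (LipschitzWith.of_dist_le_mul (K := 1) fun φ ψ => ?_).continuous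
  rw [NNReal.coe_one, one_mul, Real.dist_eq]
  exact dist_stepFun_le m φ ψ

/-- The explicit lift includes both ends. At `φ = 0` and at `φ = 2π` the operator is the identity,
but the lift is the constant `0` at the first and the constant `dim K` at the second. This is where
nonzero flow comes from. -/
theorem proj_stepFun (K : Submodule ℂ E) [FiniteDimensional ℂ K] {φ : ℝ}
    (hφ : φ ∈ Icc (0 : ℝ) (2 * Real.pi)) :
    CircleClass.proj (stepFun (Module.finrank ℂ K) φ) = eta (phaseOp K φ) := by
  have hpi := Real.pi_pos
  rw [eta, dif_pos (phaseOp_mem_unitaryCompact K φ), CircleClass.proj_eq_iff]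
  refine ⟨if Real.pi ≤ φ then Module.finrank ℂ K else 0, CircleFun.ext' fun θ => ?_⟩
  change (if (θ : ℝ) ≤ φ then (Module.finrank ℂ K : ℤ) else 0) =
    arcCount (phaseOp K φ) θ Real.pi + if Real.pi ≤ φ then (Module.finrank ℂ K : ℤ) else 0
  rw [arcCount, finrank_arcSpace_phaseOp K hφ θ.2.1 (by linarith),
    finrank_arcSpace_phaseOp K hφ hpi θ.2.2]
  simp only [mem_Ico]
  split_ifs <;> first | omega | (exfalso; grind)

/-- The spectral flow of a rotation of a finite dimensional subspace. -/
theorem flow_phaseOp (K : Submodule ℂ E) [FiniteDimensional ℂ K] {φ : unitInterval → ℝ}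
    (hc : Continuous φ) (hφ : ∀ t, φ t ∈ Icc (0 : ℝ) (2 * Real.pi))
    (θ : Ioo (0 : ℝ) (2 * Real.pi)) :
    flow (fun t => phaseOp K (φ t)) θ =
      (if (θ : ℝ) ≤ φ 1 then (Module.finrank ℂ K : ℤ) else 0) -
        if (θ : ℝ) ≤ φ 0 then (Module.finrank ℂ K : ℤ) else 0 :=
  flow_eq_of_lift ((continuous_phaseOp K).comp hc) (fun _ => phaseOp_mem_unitaryCompact K _)
    ((continuous_stepFun _).comp hc) (fun t => proj_stepFun K (hφ t)) θ

/-! ### Resolvents of self-adjoint operators -/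

section Resolvent

variable {A B : E →ₗ.[ℂ] E}

theorem inner_apply_comm (hA : IsSelfAdjoint A) (u v : A.domain) :
    inner ℂ (A u) (v : E) = inner ℂ (u : E) (A v) := by
  have h := LinearPMap.adjoint_isFormalAdjoint hA.dense_domain
  rw [LinearPMap.isSelfAdjoint_def.1 hA] at h
  exact h u v

theorem inner_self_apply_im (hA : IsSelfAdjoint A) (u : A.domain) :
    (inner ℂ (u : E) (A u)).im = 0 := by
  have h := inner_apply_comm hA u u
  rw [← inner_conj_symm] at h
  exact Complex.conj_eq_iff_im.1 h

/-- The cross term vanishes because `⟨u, A u⟩` is real. -/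
theorem norm_sub_smul_sq (hA : IsSelfAdjoint A) (u : A.domain) (z : ℂ) :
    ‖A u - z • (u : E)‖ ^ 2 = ‖A u - (z.re : ℂ) • (u : E)‖ ^ 2 + z.im ^ 2 * ‖(u : E)‖ ^ 2 := by
  set v : E := A u - (z.re : ℂ) • (u : E) with hv
  have e : A u - z • (u : E) = v - ((z.im : ℂ) * Complex.I) • (u : E) := by
    rw [hv, sub_sub, ← add_smul, Complex.re_add_im]
  have him : (inner ℂ (u : E) v).im = 0 := by
    have h0 : (inner ℂ (u : E) (u : E)).im = 0 := inner_self_im (𝕜 := ℂ) (u : E)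
    rw [hv, inner_sub_right, inner_smul_right, Complex.sub_im, inner_self_apply_im hA,
      Complex.im_ofReal_mul, h0, mul_zero, sub_zero]
  have hre : (inner ℂ v (((z.im : ℂ) * Complex.I) • (u : E))).re = 0 := by
    have him' : (inner ℂ v (u : E)).im = 0 := by
      rw [← inner_conj_symm, Complex.conj_im, him, neg_zero]
    rw [inner_smul_right]
    simp [him', Complex.mul_re]
  rw [e, @norm_sub_sq ℂ]
  change ‖v‖ ^ 2 - 2 * (inner ℂ v (((z.im : ℂ) * Complex.I) • (u : E))).re + _ = _
  rw [hre, norm_smul]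
  simp [mul_pow]

theorem abs_im_mul_norm_le (hA : IsSelfAdjoint A) (u : A.domain) (z : ℂ) :
    |z.im| * ‖(u : E)‖ ≤ ‖A u - z • (u : E)‖ := by
  refine le_of_sq_le_sq ?_ (norm_nonneg _)
  rw [mul_pow, sq_abs, norm_sub_smul_sq hA]
  linarith [sq_nonneg ‖A u - (z.re : ℂ) • (u : E)‖]

theorem norm_sub_smul_conj (hA : IsSelfAdjoint A) (u : A.domain) (z : ℂ) :
    ‖A u - conj z • (u : E)‖ = ‖A u - z • (u : E)‖ := by
  rw [← sq_eq_sq₀ (norm_nonneg _) (norm_nonneg _), norm_sub_smul_sq hA u (conj z),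
    norm_sub_smul_sq hA u z, Complex.conj_re, Complex.conj_im, neg_sq]

/-- A lower bound makes a point belong to the resolvent set of a self-adjoint operator. -/
theorem exists_isResolventAt (hA : IsSelfAdjoint A) {z : ℂ} {c : ℝ} (hc : 0 < c)
    (h : ∀ u : A.domain, c * ‖(u : E)‖ ≤ ‖A u - z • (u : E)‖) :
    ∃ R : E →L[ℂ] E, IsResolventAt A z R := by
  let T : A.domain →ₗ[ℂ] E := A.toFun - z • A.domain.subtype
  have hT : ∀ u, T u = A u - z • (u : E) := fun u => rfl
  have hinj : Function.Injective T := by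
    rw [← LinearMap.ker_eq_bot, LinearMap.ker_eq_bot']
    intro u hu
    have := h u
    rw [← hT, hu, norm_zero] at this
    have h0 : ‖(u : E)‖ = 0 := le_antisymm (by nlinarith) (norm_nonneg _)
    exact Subtype.ext (norm_eq_zero.1 h0)
  -- The lower bound turns convergence of the images into convergence of the preimages, and `A` is
  -- closed because it is self-adjoint.
  have hclosed : IsClosed (LinearMap.range T : Set E) := by
    rw [← isSeqClosed_iff_isClosed]
    intro y x hy hx
    choose u hu using hy
    have hcau : CauchySeq fun n => (u n : E) := by
      rw [Metric.cauchySeq_iff]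
      intro ε hε
      obtain ⟨N, hN⟩ := Metric.cauchySeq_iff.1 hx.cauchySeq (c * ε) (by positivity)
      refine ⟨N, fun m hm n hn => ?_⟩
      have h1 := hN m hm n hn
      have h2 := h (u m - u n)
      rw [← hT, map_sub, hu, hu, ← dist_eq_norm] at h2
      rw [dist_eq_norm]
      have h3 : c * ‖(u m : E) - u n‖ < c * ε := h2.trans_lt h1
      exact lt_of_mul_lt_mul_left h3 hc.le
    obtain ⟨v, hv⟩ := cauchySeq_tendsto_of_complete hcau
    have hA' : Tendsto (fun n => ((u n : E), A (u n))) atTop (𝓝 (v, x + z • v)) := by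
      refine hv.prodMk_nhds ?_
      have : (fun n => A (u n)) = fun n => y n + z • (u n : E) := by
        funext n
        rw [← hu, hT, sub_add_cancel]
      rw [this]
      exact hx.add (hv.const_smul z)
    have hmem : (v, x + z • v) ∈ A.graph :=
      hA.isClosed.mem_of_tendsto hA' (Eventually.of_forall fun n => A.mem_graph (u n))
    rw [LinearPMap.mem_graph_iff] at hmem
    obtain ⟨w, hw1, hw2⟩ := hmem
    refine ⟨w, ?_⟩
    rw [hT, hw2, hw1, add_sub_cancel_right]
  -- A vector orthogonal to the range lies in the kernel of `A* - z̄ = A - z̄`. The lower bound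
  -- holds for `z̄` too, since the norms of `(A - z) u` and `(A - z̄) u` agree.
  have hbot : (LinearMap.range T)ᗮ = ⊥ := by
    rw [eq_bot_iff]
    intro y hy
    have hy' : ∀ u : A.domain, inner ℂ (conj z • y) (u : E) = inner ℂ y (A u) := by
      intro u
      have h1 : inner ℂ (T u) y = 0 := hy (T u) ⟨u, rfl⟩
      rw [← inner_conj_symm, hT, inner_sub_right, inner_smul_right] at h1
      rw [inner_smul_left, Complex.conj_conj]
      have h2 := congrArg conj h1
      rw [Complex.conj_conj, map_zero] at h2
      exact (sub_eq_zero.1 h2).symm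
    have hdom : y ∈ A.adjoint.domain := LinearPMap.mem_adjoint_domain_of_exists y ⟨_, hy'⟩
    have hval := LinearPMap.adjoint_apply_eq hA.dense_domain ⟨y, hdom⟩ hy'
    have hdom' : y ∈ A.domain := by
      rw [← LinearPMap.isSelfAdjoint_def.1 hA]
      exact hdom
    have hval' : A ⟨y, hdom'⟩ = conj z • y := by
      rw [← hval]
      have hext := (LinearPMap.ext_iff.1 (LinearPMap.isSelfAdjoint_def.1 hA)).2
      exact (@hext y hdom hdom').symm
    have h3 := h ⟨y, hdom'⟩
    rw [← norm_sub_smul_conj hA, hval'] at h3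
    simp only [sub_self, norm_zero] at h3
    have h0 : ‖y‖ = 0 := le_antisymm (by nlinarith) (norm_nonneg _)
    exact norm_eq_zero.1 h0
  have hsurj : Function.Surjective T := by
    rw [← LinearMap.range_eq_top]
    have : CompleteSpace (LinearMap.range T) := hclosed.completeSpace_coe
    rwa [Submodule.orthogonal_eq_bot_iff] at hbot
  let e := LinearEquiv.ofBijective T ⟨hinj, hsurj⟩
  let R : E →L[ℂ] E := (A.domain.subtype ∘ₗ e.symm.toLinearMap).mkContinuous c⁻¹ fun x => by
    have h1 := h (e.symm x)
    rw [← hT] at h1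
    have h2 : T (e.symm x) = x := e.apply_symm_apply x
    rw [h2, mul_comm, ← le_div_iff₀ hc] at h1
    rw [inv_mul_eq_div]
    exact h1
  refine ⟨R, fun x => ⟨(e.symm x).2, ?_⟩, fun u => ?_⟩
  · exact e.apply_symm_apply x
  · exact congrArg Subtype.val (e.symm_apply_apply u)

theorem isResolventAt_res {z : ℂ} (hz : z ∈ resolventSet A) : IsResolventAt A z (res A z) := by
  obtain ⟨R, hR⟩ := hz
  rwa [hR.res_eq]

theorem mem_resolventSet_of_im_ne_zero (hA : IsSelfAdjoint A) {z : ℂ} (hz : z.im ≠ 0) :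
    z ∈ resolventSet A :=
  exists_isResolventAt hA (abs_pos.2 hz) fun u => abs_im_mul_norm_le hA u z

theorem norm_res_apply_le {z : ℂ} (hz : z ∈ resolventSet A) {c : ℝ} (hc : 0 < c)
    (h : ∀ u : A.domain, c * ‖(u : E)‖ ≤ ‖A u - z • (u : E)‖) (x : E) :
    ‖res A z x‖ ≤ c⁻¹ * ‖x‖ := by
  obtain ⟨hx, hx'⟩ := (isResolventAt_res hz).1 x
  have := h ⟨res A z x, hx⟩
  rw [hx'] at this
  rw [inv_mul_eq_div, le_div_iff₀ hc, mul_comm]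
  exact this

theorem norm_res_le {z : ℂ} (hz : z ∈ resolventSet A) {c : ℝ} (hc : 0 < c)
    (h : ∀ u : A.domain, c * ‖(u : E)‖ ≤ ‖A u - z • (u : E)‖) : ‖res A z‖ ≤ c⁻¹ :=
  ContinuousLinearMap.opNorm_le_bound _ (inv_nonneg.2 hc.le) (norm_res_apply_le hz hc h)

theorem norm_res_le_inv_im (hA : IsSelfAdjoint A) {z : ℂ} (hz : z.im ≠ 0) :
    ‖res A z‖ ≤ |z.im|⁻¹ :=
  norm_res_le (mem_resolventSet_of_im_ne_zero hA hz) (abs_pos.2 hz)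
    fun u => abs_im_mul_norm_le hA u z

/-- The first resolvent identity. -/
theorem res_sub_res {z w : ℂ} (hz : z ∈ resolventSet A) (hw : w ∈ resolventSet A) :
    res A z - res A w = (z - w) • (res A z * res A w) := by
  ext x
  obtain ⟨hx, hx'⟩ := (isResolventAt_res hw).1 x
  have h1 := (isResolventAt_res hz).2 ⟨res A w x, hx⟩
  have h2 : A ⟨res A w x, hx⟩ = x + w • res A w x := by
    exact sub_eq_iff_eq_add.1 hx'
  rw [h2] at h1
  have h3 : res A z x + (w - z) • res A z (res A w x) = res A w x := by
    have e : x + w • res A w x - z • res A w x = x + (w - z) • res A w x := by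
      rw [sub_smul]
      abel
    simp only [e, map_add, map_smul] at h1
    exact h1
  change res A z x - res A w x = (z - w) • res A z (res A w x)
  rw [← neg_sub w z, neg_smul, eq_neg_iff_add_eq_zero, sub_add_eq_add_sub, h3, sub_self]

theorem res_mul_comm {z w : ℂ} (hz : z ∈ resolventSet A) (hw : w ∈ resolventSet A) :
    res A z * res A w = res A w * res A z := by
  by_cases h : z = w
  · rw [h]
  have h1 := res_sub_res hz hw
  have h2 := res_sub_res hw hz
  have h3 : (z - w) • (res A z * res A w) = (z - w) • (res A w * res A z) := by
    rw [← h1, ← neg_sub w z, neg_smul, ← h2]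
    abel
  exact (smul_right_inj (sub_ne_zero.2 h)).1 h3

theorem star_res (hA : IsSelfAdjoint A) {z : ℂ} (hz : z ∈ resolventSet A)
    (hz' : conj z ∈ resolventSet A) : star (res A z) = res A (conj z) := by
  rw [ContinuousLinearMap.star_eq_adjoint]
  symm
  rw [ContinuousLinearMap.eq_adjoint_iff]
  intro x y
  obtain ⟨hx, hx'⟩ := (isResolventAt_res hz').1 x
  obtain ⟨hy, hy'⟩ := (isResolventAt_res hz).1 y
  have h := inner_apply_comm hA ⟨_, hx⟩ ⟨_, hy⟩
  conv_lhs => rw [← hy']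
  conv_rhs => rw [← hx']
  rw [inner_sub_right, inner_sub_left, inner_smul_right, inner_smul_left, Complex.conj_conj]
  rw [h]

/-- The difference of resolvents at another point. -/
theorem res_sub_res_eq {z w : ℂ} (hAz : z ∈ resolventSet A) (hAw : w ∈ resolventSet A)
    (hBz : z ∈ resolventSet B) (hBw : w ∈ resolventSet B) :
    res A w - res B w =
      (1 + (w - z) • res A w) * (res A z - res B z) * (1 + (w - z) • res B w) := by
  have h1 : (1 + (w - z) • res A w) * res A z = res A w := by
    have := res_sub_res hAw hAz
    rw [add_mul, one_mul, smul_mul_assoc, ← this]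
    abel
  have h2 : res B z * (1 + (w - z) • res B w) = res B w := by
    have := res_sub_res hBw hBz
    rw [res_mul_comm hBw hBz] at this
    rw [mul_add, mul_one, mul_smul_comm, ← this]
    abel
  rw [mul_sub, sub_mul, h1, mul_assoc, h2, mul_add, add_mul, mul_one, one_mul, mul_smul_comm,
    smul_mul_assoc]
  abel

/-- The operator `(A - z̄) (A - z)⁻¹`. -/
def sOp (A : E →ₗ.[ℂ] E) (z : ℂ) : E →L[ℂ] E := 1 + (z - conj z) • res A z

/-- The factor `z - z̄` vanishes, so the value is `1` even where the resolvent does not exist and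
`res` has its default value. At a real eigenvalue this is in general not the limit from the upper
half-plane. -/
theorem sOp_ofReal (A : E →ₗ.[ℂ] E) {z : ℂ} (hz : z.im = 0) : sOp A z = 1 := by
  rw [sOp, Complex.conj_eq_iff_im.2 hz, sub_self, zero_smul, add_zero]

theorem star_sOp (hA : IsSelfAdjoint A) {z : ℂ} (hz : z.im ≠ 0) :
    star (sOp A z) = 1 + (conj z - z) • res A (conj z) := by
  rw [sOp, star_add, star_one, star_smul, star_res hA (mem_resolventSet_of_im_ne_zero hA hz)
    (mem_resolventSet_of_im_ne_zero hA (by simpa using hz))]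
  simp

/-- Unitarity is the first resolvent identity for the pair `z`, `z̄`. -/
theorem sOp_mem_unitary (hA : IsSelfAdjoint A) (z : ℂ) : sOp A z ∈ unitary (E →L[ℂ] E) := by
  by_cases hz : z.im = 0
  · rw [sOp_ofReal A hz]
    exact one_mem _
  have h1 := mem_resolventSet_of_im_ne_zero hA hz
  have h2 : conj z ∈ resolventSet A := mem_resolventSet_of_im_ne_zero hA (by simpa using hz)
  have h3 := res_sub_res h1 h2
  have key : sOp A z * (1 + (conj z - z) • res A (conj z)) = 1 := by
    calc sOp A z * (1 + (conj z - z) • res A (conj z))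
        = 1 + (z - conj z) • (res A z - res A (conj z) -
          (z - conj z) • (res A z * res A (conj z))) := by
          rw [sOp, mul_add, mul_one, add_mul, one_mul, smul_mul_smul_comm]
          module
      _ = 1 := by rw [h3, sub_self, smul_zero, add_zero]
  have hcomm : (1 + (conj z - z) • res A (conj z)) * sOp A z =
      sOp A z * (1 + (conj z - z) • res A (conj z)) := by
    simp only [sOp, mul_add, add_mul, mul_one, one_mul, smul_mul_smul_comm, res_mul_comm h1 h2,
      mul_comm (conj z - z)]
    abel
  rw [Unitary.mem_iff, star_sOp hA hz]
  exact ⟨hcomm.trans key, key⟩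

theorem mOp_eq (hB : IsSelfAdjoint B) (z : ℂ) : mOp A B z = sOp A z * star (sOp B z) := by
  by_cases hz : z.im = 0
  · rw [sOp_ofReal A hz, sOp_ofReal B hz, mOp, Complex.conj_eq_iff_im.2 hz]
    simp
  · rw [star_sOp hB hz]
    rfl

theorem mOp_sub_one (hB : IsSelfAdjoint B) (z : ℂ) :
    mOp A B z - 1 = (sOp A z - sOp B z) * star (sOp B z) := by
  rw [mOp_eq hB, sub_mul, (Unitary.mem_iff.1 (sOp_mem_unitary hB z)).2]

theorem sOp_sub_sOp (z : ℂ) : sOp A z - sOp B z = (z - conj z) • (res A z - res B z) := by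
  rw [sOp, sOp, smul_sub]
  abel

theorem mOp_mem_unitaryCompact (hA : IsSelfAdjoint A) (hB : IsSelfAdjoint B) {z : ℂ}
    (h : z.im ≠ 0 → IsCompactOperator ⇑(res A z - res B z)) : mOp A B z ∈ unitaryCompact E := by
  by_cases hz : z.im = 0
  · rw [mOp_eq hB, sOp_ofReal A hz, sOp_ofReal B hz, star_one, mul_one]
    exact one_mem_unitaryCompact
  refine ⟨?_, ?_⟩
  · rw [mOp_eq hB]
    exact mul_mem (sOp_mem_unitary hA z) (Unitary.star_mem (sOp_mem_unitary hB z))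
  · rw [mOp_sub_one hB, sOp_sub_sOp]
    exact IsCompactOperator.comp_clm ((h hz).smul (z - conj z)) _

end Resolvent

/-! ### Points outside the essential spectrum -/

section Gap

variable {A B : E →ₗ.[ℂ] E} {t : ℝ}

/-- `A - t` has a finite dimensional kernel and is bounded below on its orthogonal complement. -/
structure IsGapAt (A : E →ₗ.[ℂ] E) (t : ℝ) : Prop where
  finiteDimensional : FiniteDimensional ℂ (realEigenspace A t)
  exists_bound : ∃ δ > 0, ∀ u : A.domain, (u : E) ∈ (realEigenspace A t)ᗮ →
    δ * ‖(u : E)‖ ≤ ‖A u - (t : ℂ) • (u : E)‖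

theorem sub_mul_inner_eigenvector (hA : IsSelfAdjoint A) {k : E} (hk : k ∈ realEigenspace A t)
    (u : A.domain) (z : ℂ) :
    inner ℂ k (A u - z • (u : E)) = ((t : ℂ) - z) * inner ℂ k (u : E) := by
  obtain ⟨hd, hk'⟩ := mem_realEigenspace.1 hk
  have h1 := inner_apply_comm hA ⟨k, hd⟩ u
  rw [hk', inner_smul_left, Complex.conj_ofReal] at h1
  rw [inner_sub_right, ← h1, inner_smul_right]
  ring

theorem res_apply_eigenvector {k : E} (hk : k ∈ realEigenspace A t) {z : ℂ}
    (hz : z ∈ resolventSet A) : ((t : ℂ) - z) • res A z k = k := by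
  obtain ⟨hd, hk'⟩ := mem_realEigenspace.1 hk
  have h1 := (isResolventAt_res hz).2 ⟨k, hd⟩
  rw [hk'] at h1
  rw [← map_smul, sub_smul]
  exact h1

theorem realEigenspace_eq_bot (h : (t : ℂ) ∈ resolventSet A) : realEigenspace A t = ⊥ := by
  rw [eq_bot_iff]
  intro k hk
  have := res_apply_eigenvector hk h
  rw [sub_self, zero_smul] at this
  exact this.symm

theorem exists_bound_of_mem_resolventSet {z : ℂ} (h : z ∈ resolventSet A) :
    ∃ δ > 0, ∀ u : A.domain, δ * ‖(u : E)‖ ≤ ‖A u - z • (u : E)‖ := by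
  refine ⟨(‖res A z‖ + 1)⁻¹, by positivity, fun u => ?_⟩
  rw [inv_mul_le_iff₀ (by positivity)]
  conv_lhs => rw [← (isResolventAt_res h).2 u]
  refine (ContinuousLinearMap.le_opNorm _ _).trans ?_
  gcongr
  linarith

theorem apply_sub_smul_le (A : E →ₗ.[ℂ] E) (u : A.domain) (z w : ℂ) :
    ‖A u - w • (u : E)‖ ≤ ‖A u - z • (u : E)‖ + ‖z - w‖ * ‖(u : E)‖ := by
  have : A u - w • (u : E) = (A u - z • (u : E)) + (z - w) • (u : E) := by
    rw [sub_smul]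
    abel
  rw [this, ← norm_smul]
  exact norm_add_le _ _

/-- Such points are isolated in the spectrum. -/
theorem IsGapAt.exists_punctured (hA : IsSelfAdjoint A) (h : IsGapAt A t) :
    ∃ δ > 0, ∀ s : ℝ, s ≠ t → |s - t| < δ → (s : ℂ) ∈ resolventSet A := by
  obtain ⟨δ, hδ, hb⟩ := h.exists_bound
  have := h.finiteDimensional
  refine ⟨δ / 2, by linarith, fun s hs hst => ?_⟩
  have hpos : 0 < |s - t| := abs_pos.2 (sub_ne_zero.2 hs)
  refine exists_isResolventAt hA (c := |s - t|) hpos fun u => ?_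
  set K := realEigenspace A t
  set p : E := K.starProjection u with hp
  have hpK : p ∈ K := Submodule.starProjection_apply_mem K _
  obtain ⟨hpd, hpA⟩ := mem_realEigenspace.1 hpK
  -- On the eigenspace component `p` the operator `A - s` is multiplication by `t - s`. On the
  -- orthogonal component `q` it is bounded below by `δ - |s - t| ≥ |s - t|`. The two images are
  -- again orthogonal.
  let q : A.domain := u - ⟨p, hpd⟩
  have hq : (q : E) = u - p := rfl
  have hqK : (q : E) ∈ Kᗮ := Submodule.sub_starProjection_mem_orthogonal _
  have hbq := hb q hqK
  have h1 : |s - t| * ‖(q : E)‖ ≤ ‖A q - (s : ℂ) • (q : E)‖ := by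
    have h2 := apply_sub_smul_le A q s t
    rw [← Complex.ofReal_sub, Complex.norm_real, Real.norm_eq_abs] at h2
    nlinarith [norm_nonneg (q : E)]
  have hdecomp : A u - (s : ℂ) • (u : E) = ((t : ℂ) - s) • p + (A q - (s : ℂ) • (q : E)) := by
    have h3 : A q = A u - (t : ℂ) • p := by
      rw [← hpA, ← LinearPMap.map_sub]
    rw [h3, hq]
    module
  have horth : inner ℂ (((t : ℂ) - s) • p) (A q - (s : ℂ) • (q : E)) = 0 := by
    rw [inner_smul_left, sub_mul_inner_eigenvector hA hpK, hqK p hpK, mul_zero, mul_zero]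
  have horth' : inner ℂ p (q : E) = 0 := hqK p hpK
  have e1 := norm_add_sq_eq_norm_sq_add_norm_sq_of_inner_eq_zero _ _ horth
  have e2 := norm_add_sq_eq_norm_sq_add_norm_sq_of_inner_eq_zero _ _ horth'
  rw [hq, add_sub_cancel] at e2
  rw [← hdecomp, norm_smul, ← Complex.ofReal_sub, Complex.norm_real, Real.norm_eq_abs,
    abs_sub_comm t s] at e1
  refine le_of_sq_le_sq ?_ (norm_nonneg _)
  have h4 : (|s - t| * ‖(q : E)‖) ^ 2 ≤ ‖A q - (s : ℂ) • (q : E)‖ ^ 2 := by gcongr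
  rw [hq] at h4 e1
  have e3 : (|s - t| * ‖(u : E)‖) ^ 2 = |s - t| ^ 2 * (‖(u : E)‖ * ‖(u : E)‖) := by ring
  rw [e3, e2]
  linarith

theorem IsGapAt.exists_punctured_bot (hA : IsSelfAdjoint A) (h : IsGapAt A t) :
    ∃ δ > 0, ∀ s : ℝ, s ≠ t → |s - t| < δ → realEigenspace A s = ⊥ := by
  obtain ⟨δ, hδ, hs⟩ := h.exists_punctured hA
  exact ⟨δ, hδ, fun s h1 h2 => realEigenspace_eq_bot (hs s h1 h2)⟩

theorem starProjection_res_comm (hA : IsSelfAdjoint A) [FiniteDimensional ℂ (realEigenspace A t)]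
    {z : ℂ} (hz : z.im ≠ 0) {x : E} (hx : x ∈ (realEigenspace A t)ᗮ) :
    res A z x ∈ (realEigenspace A t)ᗮ := by
  have hz' := mem_resolventSet_of_im_ne_zero hA hz
  intro k hk
  obtain ⟨hd, hx'⟩ := (isResolventAt_res hz').1 x
  have h1 := sub_mul_inner_eigenvector hA hk ⟨_, hd⟩ z
  rw [hx', hx k hk] at h1
  refine (mul_eq_zero.1 h1.symm).resolve_left fun h0 => hz ?_
  rw [← sub_eq_zero.1 h0, Complex.ofReal_im]

/-- Near an isolated eigenvalue `t`, the unitary operator `(A - z̄) (A - z)⁻¹` is a rotation of the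
eigenspace, up to `O(Im z)`. -/
theorem IsGapAt.exists_norm_sOp_sub_le (hA : IsSelfAdjoint A) (h : IsGapAt A t)
    [FiniteDimensional ℂ (realEigenspace A t)] :
    ∃ δ > 0, ∃ C > 0, ∀ z : ℂ, 0 < z.im → ‖z - t‖ < δ →
      ‖sOp A z - (1 + (((t : ℂ) - conj z) / ((t : ℂ) - z) - 1) •
        (realEigenspace A t).starProjection)‖ ≤ C * z.im := by
  obtain ⟨δ, hδ, hb⟩ := h.exists_bound
  set K := realEigenspace A t with hK
  refine ⟨δ / 2, by linarith, 4 / δ, by positivity, fun z hz hzt => ?_⟩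
  have hzr := mem_resolventSet_of_im_ne_zero hA hz.ne'
  have htz : (t : ℂ) - z ≠ 0 := fun h0 => hz.ne' (by rw [← sub_eq_zero.1 h0, Complex.ofReal_im])
  refine ContinuousLinearMap.opNorm_le_bound _ (by positivity) fun x => ?_
  set p : E := K.starProjection x with hp
  have hpK : p ∈ K := Submodule.starProjection_apply_mem K _
  have hqK : x - p ∈ Kᗮ := Submodule.sub_starProjection_mem_orthogonal _
  have hrp : res A z p = ((t : ℂ) - z)⁻¹ • p := by
    rw [eq_inv_smul_iff₀ htz]
    exact res_apply_eigenvector hpK hzr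
  -- On the eigenspace `S(z)` is exactly multiplication by `(t - z̄)/(t - z)`. What remains is `(z -
  -- z̄)(A - z)⁻¹` on the orthogonal complement, where the resolvent is bounded by `2/δ`.
  have e : (sOp A z - (1 + (((t : ℂ) - conj z) / ((t : ℂ) - z) - 1) • K.starProjection)) x =
      (z - conj z) • res A z (x - p) := by
    have h1 : ((t : ℂ) - conj z) / ((t : ℂ) - z) - 1 = (z - conj z) * ((t : ℂ) - z)⁻¹ := by
      field_simp
      ring
    rw [map_sub, hrp, h1]
    simp only [sOp, sub_apply, add_apply, one_apply_eq_self, smul_apply, ← hp]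
    module
  rw [e, norm_smul]
  have h2 : ‖z - conj z‖ = 2 * z.im := by
    rw [Complex.sub_conj, norm_mul, Complex.norm_I, mul_one, Complex.norm_real, Real.norm_eq_abs,
      abs_of_pos (by linarith)]
  obtain ⟨hd, hx'⟩ := (isResolventAt_res hzr).1 (x - p)
  have h3 := hb ⟨_, hd⟩ (starProjection_res_comm hA hz.ne' hqK)
  have h4 := apply_sub_smul_le A ⟨_, hd⟩ z t
  rw [hx'] at h4
  have h5 : ‖x - p‖ ≤ ‖x‖ := by
    have : x - p = Kᗮ.starProjection x := by
      rw [Submodule.starProjection_orthogonal_val]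
    rw [this]
    exact Submodule.norm_starProjection_apply_le _ _
  simp only at h3 h4
  have h6 : δ / 2 * ‖res A z (x - p)‖ ≤ ‖x‖ := by
    nlinarith [norm_nonneg (res A z (x - p))]
  have h7 : ‖res A z (x - p)‖ ≤ 2 / δ * ‖x‖ := by
    rw [div_mul_eq_mul_div, le_div_iff₀ hδ]
    linarith
  rw [h2]
  calc 2 * z.im * ‖res A z (x - p)‖ ≤ 2 * z.im * (2 / δ * ‖x‖) := by gcongr
    _ = 4 / δ * z.im * ‖x‖ := by ring

/-- An operator that is bounded below up to a compact operator has a finite dimensional kernel and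
is bounded below on its orthogonal complement. -/
theorem finiteDimensional_ker_of_compact {F : Type*} [NormedAddCommGroup F] [NormedSpace ℂ F]
    {T : E →L[ℂ] E} {K : E →L[ℂ] F} (hK : IsCompactOperator ⇑K) {c : ℝ} (hc : 0 < c)
    (h : ∀ x, c * ‖x‖ ≤ ‖T x‖ + ‖K x‖) :
    FiniteDimensional ℂ (LinearMap.ker (T : E →ₗ[ℂ] E)) ∧
      ∃ δ > 0, ∀ x ∈ (LinearMap.ker (T : E →ₗ[ℂ] E))ᗮ, δ * ‖x‖ ≤ ‖T x‖ := by
  set N := LinearMap.ker (T : E →ₗ[ℂ] E) with hN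
  have hNc : IsClosed (N : Set E) := T.isClosed_ker
  have : CompleteSpace N := hNc.completeSpace_coe
  -- Pass to a subsequence along which `K (x n)` converges. The estimate `h`, applied to
  -- differences, makes this subsequence Cauchy. Applied in the kernel it gives a compact unit ball,
  -- hence finite dimension.
  have key : ∀ x : ℕ → E, (∀ n, ‖x n‖ ≤ 1) → Tendsto (fun n => T (x n)) atTop (𝓝 0) →
      ∃ y, ∃ φ : ℕ → ℕ, StrictMono φ ∧ Tendsto (fun n => x (φ n)) atTop (𝓝 y) := by
    intro x hx hT
    obtain ⟨S, hS, hsub⟩ := hK.image_closedBall_subset_compact 1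
    obtain ⟨w, -, φ, hφ, hw⟩ := hS.tendsto_subseq (x := fun n => K (x n))
      (fun n => hsub ⟨x n, by simpa using hx n, rfl⟩)
    have hT' : Tendsto (fun n => T (x (φ n))) atTop (𝓝 0) := hT.comp hφ.tendsto_atTop
    have hcau : CauchySeq fun n => x (φ n) := by
      rw [Metric.cauchySeq_iff]
      intro ε hε
      obtain ⟨N1, h1⟩ := Metric.cauchySeq_iff.1 hT'.cauchySeq (c * ε / 2) (by positivity)
      obtain ⟨N2, h2⟩ := Metric.cauchySeq_iff.1 hw.cauchySeq (c * ε / 2) (by positivity)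
      refine ⟨max N1 N2, fun m hm n hn => ?_⟩
      have h3 := h1 m (le_of_max_le_left hm) n (le_of_max_le_left hn)
      have h4 := h2 m (le_of_max_le_right hm) n (le_of_max_le_right hn)
      rw [dist_eq_norm] at h3 h4 ⊢
      simp only [Function.comp] at h4
      have h5 := h (x (φ m) - x (φ n))
      rw [map_sub, map_sub] at h5
      exact lt_of_mul_lt_mul_left (by linarith : c * _ < c * ε) hc.le
    obtain ⟨y, hy⟩ := cauchySeq_tendsto_of_complete hcau
    exact ⟨y, φ, hφ, hy⟩
  refine ⟨?_, ?_⟩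
  · refine FiniteDimensional.of_isCompact_closedBall ℂ (r := 1) one_pos (c := (0 : N)) ?_
    refine IsSeqCompact.isCompact ?_
    intro x hx
    have h0 : ∀ n, T (x n : E) = 0 := fun n => (x n).2
    obtain ⟨y, φ, hφ, hy⟩ := key (fun n => (x n : E))
      (fun n => by simpa using hx n) (by simp [h0])
    have hyN : y ∈ N := hNc.mem_of_tendsto hy (Eventually.of_forall fun n => (x (φ n)).2)
    refine ⟨⟨y, hyN⟩, ?_, φ, hφ, tendsto_subtype_rng.2 hy⟩
    rw [mem_closedBall_zero_iff]
    exact le_of_tendsto hy.norm (Eventually.of_forall fun n => by simpa using hx (φ n))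
  -- If no lower bound exists, unit vectors in `Nᗮ` with images tending to zero have a limit point
  -- of norm one in `N ∩ Nᗮ`.
  · by_contra! hcon
    have hcon' : ∀ n : ℕ, ∃ x ∈ Nᗮ, ‖x‖ = 1 ∧ ‖T x‖ < 1 / ((n : ℝ) + 1) := by
      intro n
      obtain ⟨x, hx, hlt⟩ := hcon (1 / ((n : ℝ) + 1)) (by positivity)
      have hx0 : x ≠ 0 := by
        rintro rfl
        simp at hlt
      have hpos := norm_pos_iff.2 hx0
      refine ⟨((‖x‖⁻¹ : ℝ) : ℂ) • x, Submodule.smul_mem _ _ hx, ?_, ?_⟩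
      · rw [norm_smul, Complex.norm_real, norm_inv, norm_norm, inv_mul_cancel₀ hpos.ne']
      · rw [map_smul, norm_smul, Complex.norm_real, norm_inv, norm_norm, inv_mul_lt_iff₀ hpos,
          mul_comm]
        exact hlt
    choose x hx hx1 hxT using hcon'
    have hT : Tendsto (fun n => T (x n)) atTop (𝓝 0) :=
      squeeze_zero_norm (fun n => (hxT n).le) tendsto_one_div_add_atTop_nhds_zero_nat
    obtain ⟨y, φ, hφ, hy⟩ := key x (fun n => (hx1 n).le) hT
    have hyN : y ∈ N := by
      have h1 : Tendsto (fun n => T (x (φ n))) atTop (𝓝 (T y)) := (T.continuous.tendsto y).comp hy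
      exact tendsto_nhds_unique h1 (hT.comp hφ.tendsto_atTop)
    have hyN' : y ∈ Nᗮ := (Submodule.isClosed_orthogonal N).mem_of_tendsto hy
      (Eventually.of_forall fun n => hx (φ n))
    have hy0 : y = 0 := by
      have := hyN' y hyN
      exact inner_self_eq_zero.1 this
    have hy1 : ‖y‖ = 1 := tendsto_nhds_unique hy.norm (by simp [hx1])
    rw [hy0, norm_zero] at hy1
    exact zero_ne_one hy1

/-- `S(t + i) + 1 = 2 (A - t)(A - t - i)⁻¹`. Questions about the unbounded operator `A - t` become
questions about the point `-1` for a bounded unitary operator. -/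
theorem sOp_add_one_apply (hA : IsSelfAdjoint A) (x : E) :
    ∃ h : res A (t + Complex.I) x ∈ A.domain, (sOp A (t + Complex.I) + 1) x =
      (2 : ℂ) • (A ⟨res A (t + Complex.I) x, h⟩ - (t : ℂ) • res A (t + Complex.I) x) := by
  have hz := mem_resolventSet_of_im_ne_zero hA (z := t + Complex.I) (by simp)
  obtain ⟨hd, hx⟩ := (isResolventAt_res hz).1 x
  refine ⟨hd, ?_⟩
  have e : A ⟨res A (t + Complex.I) x, hd⟩ - (t : ℂ) • res A (t + Complex.I) x =
      x + Complex.I • res A (t + Complex.I) x := by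
    rw [sub_eq_iff_eq_add.1 hx]
    module
  have e2 : ((t : ℂ) + Complex.I) - conj ((t : ℂ) + Complex.I) = 2 * Complex.I := by
    simp
    ring
  rw [e]
  simp only [sOp, e2, add_apply, one_apply_eq_self, smul_apply]
  module

theorem ker_sOp_add_one (hA : IsSelfAdjoint A) :
    LinearMap.ker ((sOp A (t + Complex.I) + 1 : E →L[ℂ] E) : E →ₗ[ℂ] E) = realEigenspace A t := by
  have hz := mem_resolventSet_of_im_ne_zero hA (z := t + Complex.I) (by simp)
  ext x
  obtain ⟨hd, hx⟩ := sOp_add_one_apply (t := t) hA x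
  have h1 : x ∈ LinearMap.ker ((sOp A (t + Complex.I) + 1 : E →L[ℂ] E) : E →ₗ[ℂ] E) ↔
      res A (t + Complex.I) x ∈ realEigenspace A t := by
    rw [LinearMap.mem_ker]
    change (sOp A (t + Complex.I) + 1) x = 0 ↔ _
    rw [hx, smul_eq_zero_iff_right two_ne_zero, sub_eq_zero, mem_realEigenspace]
    exact ⟨fun h => ⟨hd, h⟩, fun ⟨_, h⟩ => h⟩
  rw [h1]
  constructor
  · intro h
    obtain ⟨hd', h2⟩ := mem_realEigenspace.1 h
    obtain ⟨hd'', h3⟩ := (isResolventAt_res hz).1 x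
    rw [h2, ← sub_smul] at h3
    rw [← h3]
    exact Submodule.smul_mem _ _ h
  · intro h
    have h2 := res_apply_eigenvector h hz
    have h3 : (t : ℂ) - (t + Complex.I) ≠ 0 := by simp
    rw [← inv_smul_smul₀ h3 (res A (t + Complex.I) x), h2]
    exact Submodule.smul_mem _ _ h

/-- With `f = (A - t - i) u`, the vector `(S + 1) f` is `2 (A - t) u`, and `‖u‖ ≤ ‖f‖`. A lower
bound for `S + 1` off its kernel thus gives one for `A - t`, with half the constant. -/
theorem isGapAt_of_bound (hA : IsSelfAdjoint A) {F : Type*} [NormedAddCommGroup F]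
    [NormedSpace ℂ F] {K : E →L[ℂ] F} (hK : IsCompactOperator ⇑K) {c : ℝ} (hc : 0 < c)
    (h : ∀ x, c * ‖x‖ ≤ ‖(sOp A (t + Complex.I) + 1) x‖ + ‖K x‖) : IsGapAt A t := by
  obtain ⟨h1, δ, hδ, h2⟩ := finiteDimensional_ker_of_compact hK hc h
  rw [ker_sOp_add_one hA] at h1 h2
  have hz := mem_resolventSet_of_im_ne_zero hA (z := t + Complex.I) (by simp)
  refine ⟨h1, δ / 2, by linarith, fun u hu => ?_⟩
  set f : E := A u - ((t : ℂ) + Complex.I) • (u : E) with hf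
  have hfu : res A (t + Complex.I) f = u := (isResolventAt_res hz).2 u
  have hfK : f ∈ (realEigenspace A t)ᗮ := by
    intro k hk
    rw [hf, sub_mul_inner_eigenvector hA hk, hu k hk, mul_zero]
  obtain ⟨hd, h3⟩ := sOp_add_one_apply (t := t) hA f
  have h4 := h2 f hfK
  have h5 : (⟨res A (t + Complex.I) f, hd⟩ : A.domain) = u := Subtype.ext hfu
  rw [h3, h5, hfu, norm_smul] at h4
  have h6 := abs_im_mul_norm_le hA u (t + Complex.I)
  rw [← hf] at h6
  have e1 : |((t : ℂ) + Complex.I).im| = 1 := by simp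
  rw [Complex.norm_ofNat] at h4
  rw [e1, one_mul] at h6
  nlinarith

/-- If `t` is an isolated point of the spectrum, then `-1` is isolated in the spectrum of the
Cayley transform. -/
theorem eventually_spectrum_sOp (hA : IsSelfAdjoint A)
    (hnear : ∀ᶠ s : ℝ in 𝓝[≠] t, (s : ℂ) ∈ resolventSet A) :
    ∀ᶠ w : ℂ in 𝓝 (-1), w ∈ spectrum ℂ (sOp A (t + Complex.I)) → w = -1 := by
  set z : ℂ := t + Complex.I with hzdef
  have hz := mem_resolventSet_of_im_ne_zero hA (z := z) (by simp [hzdef])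
  set V := sOp A z with hV
  have hVu : V ∈ unitary (E →L[ℂ] E) := sOp_mem_unitary hA z
  -- spectral mapping for the Cayley transform
  have hmap : ∀ w : ℂ, w ≠ 1 → (conj z - w * z) / (1 - w) ∈ resolventSet A →
      w ∉ spectrum ℂ V := by
    intro w hw hs
    set s : ℂ := (conj z - w * z) / (1 - w) with hsdef
    have hw' : 1 - w ≠ 0 := sub_ne_zero.2 hw.symm
    have h1 := res_sub_res hs hz
    have h2 := res_sub_res hz hs
    have hVw : V - algebraMap ℂ _ w = (1 - w) • (1 + (z - s) • res A z) := by
      have : z - conj z = (1 - w) * (z - s) := by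
        rw [hsdef]
        field_simp
        ring
      rw [hV, sOp, this, Algebra.algebraMap_eq_smul_one]
      module
    have hu1 : (1 + (z - s) • res A z) * (1 + (s - z) • res A s) = 1 := by
      rw [mul_add, mul_one, add_mul, one_mul, smul_mul_smul_comm]
      have h4 : (z - s) * (s - z) = -((z - s) * (z - s)) := by ring
      rw [h4, neg_smul, mul_smul, ← h2]
      module
    have hu2 : (1 + (s - z) • res A s) * (1 + (z - s) • res A z) = 1 := by
      rw [mul_add, mul_one, add_mul, one_mul, smul_mul_smul_comm]
      have h4 : (s - z) * (z - s) = -((s - z) * (s - z)) := by ring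
      rw [h4, neg_smul, mul_smul, ← h1]
      module
    rw [spectrum.notMem_iff, ← IsUnit.neg_iff, neg_sub, hVw]
    exact IsUnit.smul (Units.mk0 _ hw') ⟨⟨_, _, hu1, hu2⟩, rfl⟩
  -- The inverse Cayley map takes the unit circle without `1` to the real line.
  have hs_real : ∀ w : ℂ, ‖w‖ = 1 → w ≠ 1 →
      (((conj z - w * z) / (1 - w)).re : ℂ) = (conj z - w * z) / (1 - w) := by
    intro w hw1 hw
    rw [← Complex.conj_eq_iff_re, map_div₀]
    have hw' : 1 - w ≠ 0 := sub_ne_zero.2 hw.symm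
    have hwc : w * conj w = 1 := by
      rw [Complex.mul_conj, Complex.normSq_eq_norm_sq, hw1]
      simp
    have hw'' : 1 - conj w ≠ 0 := by
      rw [← map_one conj, ← map_sub]
      exact (map_ne_zero _).2 hw'
    simp only [map_sub, map_mul, Complex.conj_conj, map_one]
    rw [div_eq_div_iff hw'' hw']
    linear_combination (conj z - z) * hwc
  have hval : (conj z - (-1) * z) / (1 - (-1)) = (t : ℂ) := by
    simp [hzdef]
    ring
  -- `-1` is isolated in the spectrum of the Cayley transform
  have hcts : ContinuousAt (fun w : ℂ => (conj z - w * z) / (1 - w)) (-1) := by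
    refine ContinuousAt.div (by fun_prop) (by fun_prop) ?_
    norm_num
  have h1 : Tendsto (fun w : ℂ => ((conj z - w * z) / (1 - w)).re) (𝓝 (-1)) (𝓝 t) := by
    have := (Complex.continuous_re.continuousAt (x := (t : ℂ))).tendsto.comp
      (hval ▸ hcts.tendsto)
    simpa [Function.comp_def] using this
  have h2 := h1.eventually (eventually_nhdsWithin_iff.1 hnear)
  have h3 : ∀ᶠ w : ℂ in 𝓝 (-1), w ≠ 1 :=
    (isOpen_ne).mem_nhds (by norm_num)
  filter_upwards [h2, h3] with w hw hw1 hspec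
  have hnorm : ‖w‖ = 1 := by simpa using spectrum.subset_circle_of_unitary hVu hspec
  by_contra hne
  refine hmap w hw1 ?_ hspec
  rw [← hs_real w hnorm hw1]
  refine hw fun h0 => hne ?_
  have h4 := hs_real w hnorm hw1
  rw [h0, eq_div_iff (sub_ne_zero.2 hw1.symm)] at h4
  have h5 : (w + 1) * Complex.I = 0 := by
    have hcz : conj z = t - Complex.I := by simp [hzdef, sub_eq_add_neg]
    rw [hcz, hzdef] at h4
    linear_combination h4
  have h6 := (mul_eq_zero.1 h5).resolve_right Complex.I_ne_zero
  exact eq_neg_of_add_eq_zero_left h6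

/-- If `-1` is isolated in the spectrum of a unitary operator `V`, then `V + 1` is invertible modulo
its kernel. -/
theorem exists_inverse_modulo_ker {V : E →L[ℂ] E} (hV : V ∈ unitary (E →L[ℂ] E))
    (h : ∀ᶠ w : ℂ in 𝓝 (-1), w ∈ spectrum ℂ V → w = -1) :
    ∃ G : E →L[ℂ] E, (V + 1) * (1 - G * (V + 1)) = 0 := by
  have hn : IsStarNormal V := isStarNormal_of_mem_unitary hV
  -- At `w = -1` the inverse has the value zero by convention. The function is nevertheless
  -- continuous on the spectrum, where `-1` is isolated if it occurs, and applied to `V` it gives a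
  -- partial inverse of `V + 1`.
  have hfcts : ContinuousOn (fun w : ℂ => (w + 1)⁻¹) (spectrum ℂ V) := by
    intro w hw
    by_cases h1 : w = -1
    · subst h1
      refine (continuousWithinAt_const (b := ((-1 : ℂ) + 1)⁻¹)).congr_of_eventuallyEq ?_ rfl
      filter_upwards [h.filter_mono nhdsWithin_le_nhds, self_mem_nhdsWithin] with v hv hv'
      rw [hv hv']
    · exact ContinuousAt.continuousWithinAt (ContinuousAt.inv₀ (by fun_prop)
        (fun h0 => h1 (eq_neg_of_add_eq_zero_left h0)))
  have hV1 : V + 1 = cfc (fun w : ℂ => w + 1) V := by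
    rw [cfc_add (a := V) (fun w : ℂ => w) (fun _ => 1), cfc_id' ℂ V, cfc_const_one ℂ V]
  refine ⟨cfc (fun w : ℂ => (w + 1)⁻¹) V, ?_⟩
  rw [mul_sub, mul_one, sub_eq_zero, hV1, ← cfc_mul _ _ V hfcts (by fun_prop),
    ← cfc_mul _ _ V (by fun_prop) (by fun_prop)]
  refine cfc_congr fun w _ => ?_
  by_cases h0 : w + 1 = 0
  · simp [h0]
  · simp [h0]

/-- For a point outside the essential spectrum, the Cayley transform plus one is bounded below up
to a compact operator. -/
theorem exists_bound_of_notMem_essSpectrum (hA : IsSelfAdjoint A) (ht : t ∉ essSpectrum A) :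
    ∃ K : E →L[ℂ] E, IsCompactOperator ⇑K ∧ ∃ c > 0,
      ∀ x, c * ‖x‖ ≤ ‖(sOp A (t + Complex.I) + 1) x‖ + ‖K x‖ := by
  set z : ℂ := t + Complex.I with hzdef
  have hz := mem_resolventSet_of_im_ne_zero hA (z := z) (by simp [hzdef])
  have e2 : z - conj z = 2 * Complex.I := by
    simp [hzdef]
    ring
  by_cases htr : (t : ℂ) ∈ resolventSet A
  · refine ⟨0, isCompactOperator_zero, ?_⟩
    have h1 : (2⁻¹ : ℂ) • ((1 + ((t : ℂ) - z) • res A t) * (sOp A z + 1)) = 1 := by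
      have h2 := res_sub_res htr hz
      have h3 : sOp A z + 1 = (2 : ℂ) • (1 + (z - t) • res A z) := by
        rw [sOp, e2, hzdef]
        module
      rw [h3, mul_smul_comm, smul_smul, inv_mul_cancel₀ two_ne_zero, one_smul, mul_add, mul_one,
        add_mul, one_mul, smul_mul_smul_comm]
      have h4 : ((t : ℂ) - z) * (z - t) = -(((t : ℂ) - z) * ((t : ℂ) - z)) := by ring
      rw [h4, neg_smul, mul_smul, ← h2]
      module
    set G : E →L[ℂ] E := (2⁻¹ : ℂ) • (1 + ((t : ℂ) - z) • res A t) with hG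
    have h5 : G * (sOp A z + 1) = 1 := by rw [hG, smul_mul_assoc, h1]
    refine ⟨(‖G‖ + 1)⁻¹, by positivity, fun x => ?_⟩
    rw [inv_mul_le_iff₀ (by positivity)]
    have h6 : G ((sOp A z + 1) x) = x := congrArg (fun S : E →L[ℂ] E => S x) h5
    conv_lhs => rw [← h6]
    refine (ContinuousLinearMap.le_opNorm _ _).trans ?_
    simp only [zero_apply, norm_zero, add_zero]
    gcongr
    linarith
  · have hiso : ¬ AccPt t (𝓟 (realSpectrum A)) ∧ FiniteDimensional ℂ (realEigenspace A t) := by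
      by_contra hc
      exact ht ⟨htr, hc⟩
    obtain ⟨hacc, hfin⟩ := hiso
    have hnear : ∀ᶠ s : ℝ in 𝓝[≠] t, (s : ℂ) ∈ resolventSet A := by
      rw [accPt_iff_frequently_nhdsNE] at hacc
      rw [not_frequently] at hacc
      filter_upwards [hacc] with s hs
      by_contra hc
      exact hs hc
    obtain ⟨G, hG⟩ := exists_inverse_modulo_ker (sOp_mem_unitary hA z)
      (eventually_spectrum_sOp hA hnear)
    -- `Q` measures the failure of `G` to be a left inverse. It takes values in the finite
    -- dimensional eigenspace and is therefore compact.
    obtain ⟨Q, hQ⟩ : ∃ Q, Q = 1 - G * (sOp A z + 1) := ⟨_, rfl⟩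
    rw [← hQ] at hG
    have hPmem : ∀ x, Q x ∈ realEigenspace A t := by
      intro x
      rw [← ker_sOp_add_one hA, LinearMap.mem_ker]
      exact congrArg (fun S : E →L[ℂ] E => S x) hG
    refine ⟨Q, ?_, (‖G‖ + 1)⁻¹, by positivity, fun x => ?_⟩
    · have h1 : Q = (realEigenspace A t).starProjection * Q := by
        ext x
        rw [mul_apply_eq_comp, Submodule.starProjection_eq_self_iff.2 (hPmem x)]
      rw [h1]
      exact (isCompactOperator_starProjection (realEigenspace A t)).comp_clm Q
    · rw [inv_mul_le_iff₀ (by positivity)]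
      have h1 : x = G ((sOp A z + 1) x) + Q x := by
        rw [hQ, sub_apply, one_apply_eq_self, mul_apply_eq_comp]
        abel
      have h2 : ‖x‖ ≤ ‖G ((sOp A z + 1) x)‖ + ‖Q x‖ := by
        conv_lhs => rw [h1]
        exact norm_add_le _ _
      have h3 := G.le_opNorm ((sOp A z + 1) x)
      nlinarith [norm_nonneg ((sOp A z + 1) x), norm_nonneg (Q x), norm_nonneg G]

/-- Compact perturbations of the resolvent do not change the property of being outside the
essential spectrum. -/
theorem isGapAt_of_compact (hA : IsSelfAdjoint A) (hB : IsSelfAdjoint B)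
    (ht : t ∉ essSpectrum A)
    (hc : IsCompactOperator ⇑(res B (t + Complex.I) - res A (t + Complex.I))) : IsGapAt B t := by
  obtain ⟨K, hK, c, hc0, h⟩ := exists_bound_of_notMem_essSpectrum hA ht
  set z : ℂ := t + Complex.I
  set L : E →L[ℂ] E := sOp A z - sOp B z with hL
  have hLc : IsCompactOperator ⇑L := by
    have : L = (-(z - conj z)) • (res B z - res A z) := by
      rw [hL, sOp_sub_sOp]
      module
    rw [this]
    exact hc.smul (-(z - conj z))
  -- The two compact error terms, one from the estimate for `A` and one from the perturbation, are
  -- joined into a single operator into a product. Its norm is a maximum, which costs the factor `2`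
  -- in the constant.
  have hprod : IsCompactOperator ⇑(L.prod K) := by
    obtain ⟨S1, hS1, h1⟩ := hLc
    obtain ⟨S2, hS2, h2⟩ := hK
    exact ⟨S1 ×ˢ S2, hS1.prod hS2, mem_of_superset (inter_mem h1 h2) fun x hx => hx⟩
  refine isGapAt_of_bound hB (K := L.prod K) hprod (c := c / 2) (by linarith) fun x => ?_
  have h1 := h x
  have h2 : ‖(sOp A z + 1) x‖ ≤ ‖(sOp B z + 1) x‖ + ‖L x‖ := by
    have : (sOp A z + 1) x = (sOp B z + 1) x + L x := by
      simp only [hL, add_apply, sub_apply, one_apply_eq_self]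
      abel
    rw [this]
    exact norm_add_le _ _
  have h3 : ‖L x‖ ≤ ‖(L.prod K) x‖ := le_max_left _ _
  have h4 : ‖K x‖ ≤ ‖(L.prod K) x‖ := le_max_right _ _
  nlinarith [norm_nonneg ((sOp B z + 1) x)]

end Gap

/-! ### Families of self-adjoint operators -/

/-- The standing assumptions on a family of self-adjoint operators. -/
structure IsFlowFamily (H : unitInterval → E →ₗ.[ℂ] E) : Prop where
  selfAdjoint : ∀ α, IsSelfAdjoint (H α)
  compact : ∀ z : ℂ, 0 < z.im → ∀ α, IsCompactOperator ⇑(res (H α) z - res (H 0) z)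
  continuous : ∀ z : ℂ, 0 < z.im → Continuous fun α => res (H α) z
  decay : ∀ l : ℝ, Tendsto
    (fun y : ℝ => ⨆ α : unitInterval, y * ‖res (H α) (l + y * Complex.I) -
      res (H 0) (l + y * Complex.I)‖) atTop (𝓝 0)

section Family

variable {H : unitInterval → E →ₗ.[ℂ] E}

theorem norm_sOp_le {A : E →ₗ.[ℂ] E} (hA : IsSelfAdjoint A) (z : ℂ) : ‖sOp A z‖ ≤ 1 :=
  ContinuousLinearMap.opNorm_le_bound _ zero_le_one fun x => by
    rw [ContinuousLinearMap.norm_map_of_mem_unitary (sOp_mem_unitary hA z), one_mul]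

theorem norm_sub_conj (z : ℂ) : ‖z - conj z‖ = 2 * |z.im| := by
  rw [Complex.sub_conj, norm_mul, Complex.norm_I, mul_one, Complex.norm_real, Real.norm_eq_abs,
    abs_mul, abs_two]

theorem norm_mOp_sub_one_le {A B : E →ₗ.[ℂ] E} (hB : IsSelfAdjoint B) (z : ℂ) :
    ‖mOp A B z - 1‖ ≤ 2 * |z.im| * ‖res A z - res B z‖ := by
  rw [mOp_sub_one hB, sOp_sub_sOp, ← norm_sub_conj, ← norm_smul]
  refine (norm_mul_le _ _).trans ?_
  rw [norm_star]
  exact mul_le_of_le_one_right (norm_nonneg _) (norm_sOp_le hB z)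

/-- Moving horizontally from `iy` to `x + iy` multiplies the resolvent difference on both sides by
factors `1 + x (A - z)⁻¹` of norm at most `2`. The decay along the imaginary axis therefore controls
all bounded `x` uniformly. -/
theorem norm_res_sub_res_le {A B : E →ₗ.[ℂ] E} (hA : IsSelfAdjoint A) (hB : IsSelfAdjoint B)
    {x y : ℝ} (hy : 0 < y) (hxy : |x| ≤ y) :
    ‖res A (x + y * Complex.I) - res B (x + y * Complex.I)‖ ≤
      4 * ‖res A ((0 : ℝ) + y * Complex.I) - res B ((0 : ℝ) + y * Complex.I)‖ := by
  have him : ∀ x : ℝ, ((x : ℂ) + y * Complex.I).im = y := fun x => by simp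
  have hmem : ∀ {A : E →ₗ.[ℂ] E}, IsSelfAdjoint A → ∀ x : ℝ,
      (x : ℂ) + y * Complex.I ∈ resolventSet A :=
    fun hA x => mem_resolventSet_of_im_ne_zero hA (by rw [him]; exact hy.ne')
  have hn : ∀ {A : E →ₗ.[ℂ] E}, IsSelfAdjoint A →
      ‖1 + (((x : ℂ) + y * Complex.I) - ((0 : ℝ) + y * Complex.I)) •
        res A (x + y * Complex.I)‖ ≤ 2 := by
    intro A hA
    have h1 := norm_res_le_inv_im hA (z := (x : ℂ) + y * Complex.I) (by rw [him]; exact hy.ne')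
    rw [him, abs_of_pos hy] at h1
    have h2 : ((x : ℂ) + y * Complex.I) - ((0 : ℝ) + y * Complex.I) = x := by
      push_cast
      ring
    have h3 : ‖(1 : E →L[ℂ] E)‖ ≤ 1 := ContinuousLinearMap.norm_id_le
    rw [h2]
    refine (norm_add_le _ _).trans ?_
    rw [norm_smul, Complex.norm_real, Real.norm_eq_abs]
    have h4 : |x| * ‖res A (x + y * Complex.I)‖ ≤ y * y⁻¹ := by gcongr
    rw [mul_inv_cancel₀ hy.ne'] at h4
    linarith
  rw [res_sub_res_eq (hmem hA 0) (hmem hA x) (hmem hB 0) (hmem hB x)]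
  have h1 := hn hA
  have h2 := hn hB
  refine (norm_mul_le _ _).trans ?_
  refine (mul_le_mul (norm_mul_le _ _) h2 (norm_nonneg _) (by positivity)).trans ?_
  nlinarith [norm_nonneg (res A ((0 : ℝ) + y * Complex.I) - res B ((0 : ℝ) + y * Complex.I))]

/-- This makes the supremum over `α` in the decay hypothesis a genuine one: the supremum of an
unbounded set of reals is zero by convention. -/
theorem y_mul_norm_res_sub_le {A B : E →ₗ.[ℂ] E} (hA : IsSelfAdjoint A) (hB : IsSelfAdjoint B)
    (l : ℝ) {y : ℝ} (hy : 0 < y) :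
    y * ‖res A (l + y * Complex.I) - res B (l + y * Complex.I)‖ ≤ 2 := by
  have him : ((l : ℂ) + y * Complex.I).im = y := by simp
  have h1 := norm_res_le_inv_im hA (z := (l : ℂ) + y * Complex.I) (by rw [him]; exact hy.ne')
  have h2 := norm_res_le_inv_im hB (z := (l : ℂ) + y * Complex.I) (by rw [him]; exact hy.ne')
  rw [him, abs_of_pos hy] at h1 h2
  have h3 : ‖res A (l + y * Complex.I) - res B (l + y * Complex.I)‖ ≤ y⁻¹ + y⁻¹ :=
    (norm_sub_le _ _).trans (by linarith)
  calc _ ≤ y * (y⁻¹ + y⁻¹) := by gcongr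
    _ = 2 := by field_simp; norm_num

theorem IsFlowFamily.le_iSup (hH : IsFlowFamily H) (l : ℝ) {y : ℝ} (hy : 0 < y)
    (α : unitInterval) :
    y * ‖res (H α) (l + y * Complex.I) - res (H 0) (l + y * Complex.I)‖ ≤
      ⨆ α : unitInterval, y * ‖res (H α) (l + y * Complex.I) - res (H 0) (l + y * Complex.I)‖ := by
  refine le_ciSup (f := fun α : unitInterval =>
    y * ‖res (H α) (l + y * Complex.I) - res (H 0) (l + y * Complex.I)‖) ⟨2, ?_⟩ α
  rintro _ ⟨β, rfl⟩
  exact y_mul_norm_res_sub_le (hH.selfAdjoint β) (hH.selfAdjoint 0) l hy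

/-- `M(x + iy) → I` as `y → ∞`, uniformly in the parameter and for bounded `x`. -/
theorem IsFlowFamily.exists_norm_mOp_sub_one_lt (hH : IsFlowFamily H) {ε : ℝ} (hε : 0 < ε)
    (b : ℝ) : ∃ Y : ℝ, ∀ y ≥ Y, ∀ x : ℝ, |x| ≤ b → ∀ α,
      ‖mOp (H α) (H 0) (x + y * Complex.I) - 1‖ < ε := by
  -- The `8` is the product of the factor `2` in `|z - z̄| = 2y` and the factor `4` in
  -- `norm_res_sub_res_le`.
  have h1 := (hH.decay 0).eventually (gt_mem_nhds (show 0 < ε / 8 by linarith))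
  obtain ⟨Y, hY⟩ := eventually_atTop.1 h1
  refine ⟨max Y (max b 1), fun y hy x hx α => ?_⟩
  have hy1 : Y ≤ y := (le_max_left _ _).trans hy
  have hy2 : b ≤ y := ((le_max_left _ _).trans (le_max_right _ _)).trans hy
  have hy3 : 0 < y := by
    linarith [((le_max_right b 1).trans (le_max_right Y _)).trans hy]
  have h2 := hH.le_iSup 0 hy3 α
  have h3 := hY y hy1
  have h4 := norm_res_sub_res_le (hH.selfAdjoint α) (hH.selfAdjoint 0) hy3 (hx.trans hy2)
  have h5 := norm_mOp_sub_one_le (A := H α) (hH.selfAdjoint 0) (x + y * Complex.I)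
  have him : ((x : ℂ) + y * Complex.I).im = y := by simp
  rw [him, abs_of_pos hy3] at h5
  nlinarith

/-- Joint continuity holds because the first resolvent identity controls the change in `z` uniformly
in `α`, so that only norm continuity in `α` at the fixed point `z₀` is needed. -/
theorem IsFlowFamily.continuousAt_sOp (hH : IsFlowFamily H) (α₀ : unitInterval) {z₀ : ℂ}
    (hz₀ : 0 < z₀.im) :
    ContinuousAt (fun p : unitInterval × ℂ => sOp (H p.1) p.2) (α₀, z₀) := by
  have hres : ContinuousAt (fun p : unitInterval × ℂ => res (H p.1) p.2) (α₀, z₀) := by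
    rw [ContinuousAt, tendsto_iff_norm_sub_tendsto_zero]
    have h1 : Tendsto (fun p : unitInterval × ℂ => ‖p.2 - z₀‖ * (|p.2.im|⁻¹ * |z₀.im|⁻¹) +
        ‖res (H p.1) z₀ - res (H α₀) z₀‖) (𝓝 (α₀, z₀)) (𝓝 0) := by
      have h2 : ContinuousAt (fun p : unitInterval × ℂ => ‖p.2 - z₀‖ * (|p.2.im|⁻¹ * |z₀.im|⁻¹) +
          ‖res (H p.1) z₀ - res (H α₀) z₀‖) (α₀, z₀) := by
        have h3 : ContinuousAt (fun p : unitInterval × ℂ => |p.2.im|⁻¹) (α₀, z₀) := by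
          refine ContinuousAt.inv₀
            (Complex.continuous_im.comp continuous_snd).abs.continuousAt ?_
          exact (abs_pos.2 hz₀.ne').ne'
        have h4 : ContinuousAt (fun p : unitInterval × ℂ => res (H p.1) z₀) (α₀, z₀) :=
          ((hH.continuous z₀ hz₀).comp continuous_fst).continuousAt
        exact ((by fun_prop : ContinuousAt (fun p : unitInterval × ℂ => ‖p.2 - z₀‖) _).mul
          (h3.mul continuousAt_const)).add (h4.sub continuousAt_const).norm
      have h3 := h2.tendsto
      simpa using h3
    refine squeeze_zero' (Eventually.of_forall fun _ => norm_nonneg _) ?_ h1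
    have h2 : ∀ᶠ p : unitInterval × ℂ in 𝓝 (α₀, z₀), 0 < p.2.im :=
      (isOpen_lt continuous_const (by fun_prop : Continuous fun p : unitInterval × ℂ =>
        p.2.im)).mem_nhds hz₀
    filter_upwards [h2] with p hp
    have hA := hH.selfAdjoint p.1
    have h3 := res_sub_res (mem_resolventSet_of_im_ne_zero hA hp.ne')
      (mem_resolventSet_of_im_ne_zero hA hz₀.ne')
    have h4 : ‖res (H p.1) p.2 - res (H p.1) z₀‖ ≤ ‖p.2 - z₀‖ * (|p.2.im|⁻¹ * |z₀.im|⁻¹) := by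
      rw [h3, norm_smul]
      gcongr
      refine (norm_mul_le _ _).trans ?_
      have h5 := norm_res_le_inv_im hA hp.ne'
      have h6 := norm_res_le_inv_im hA hz₀.ne'
      gcongr
    calc ‖res (H p.1) p.2 - res (H α₀) z₀‖
        = ‖(res (H p.1) p.2 - res (H p.1) z₀) + (res (H p.1) z₀ - res (H α₀) z₀)‖ := by
          congr 1
          abel
      _ ≤ _ := (norm_add_le _ _).trans (by gcongr)
  have hconj : Continuous fun p : unitInterval × ℂ => conj p.2 := by fun_prop
  unfold sOp
  fun_prop

/-- A point of the resolvent set stays at a positive distance from the spectra of the nearby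
operators of the family. -/
theorem IsFlowFamily.exists_uniform_bound (hH : IsFlowFamily H) {α₀ : unitInterval} {x₀ : ℝ}
    (h : (x₀ : ℂ) ∈ resolventSet (H α₀)) :
    ∃ c > 0, ∀ᶠ α in 𝓝 α₀, ∀ u : (H α).domain,
      c * ‖(u : E)‖ ≤ ‖H α u - (x₀ : ℂ) • (u : E)‖ := by
  obtain ⟨δ, hδ, hb⟩ := exists_bound_of_mem_resolventSet h
  set z : ℂ := x₀ + Complex.I with hz
  have him : z.im = 1 := by simp [hz]
  have hpos : 0 < z.im := by rw [him]; exact one_pos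
  have hmem : ∀ α, z ∈ resolventSet (H α) :=
    fun α => mem_resolventSet_of_im_ne_zero (hH.selfAdjoint α) hpos.ne'
  -- For `f = (A - z) u` one has `‖f‖ ≤ ‖(A - x₀) u‖ + ‖u‖ ≤ (1 + 1/δ) ‖(A - x₀) u‖`, while `(S + 1)
  -- f = 2 (A - x₀) u`. The quotient of the two constants is `c`.
  set c : ℝ := 2 * δ / (1 + δ) with hc
  have hc0 : 0 < c := by positivity
  have h1 : ∀ f, c * ‖f‖ ≤ ‖(sOp (H α₀) z + 1) f‖ := by
    intro f
    obtain ⟨hd, h2⟩ := sOp_add_one_apply (t := x₀) (hH.selfAdjoint α₀) f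
    obtain ⟨hd', h3⟩ := (isResolventAt_res (hmem α₀)).1 f
    rw [h2, norm_smul, Complex.norm_ofNat]
    have h4 := hb ⟨_, hd⟩
    have h5 := apply_sub_smul_le (H α₀) ⟨_, hd⟩ x₀ z
    rw [h3] at h5
    have h6 : ‖(x₀ : ℂ) - z‖ = 1 := by simp [hz]
    rw [h6, one_mul] at h5
    simp only at h4 h5
    rw [hc, div_mul_eq_mul_div, div_le_iff₀ (by positivity)]
    nlinarith
  have hcont : ContinuousAt (fun α => sOp (H α) z) α₀ :=
    (hH.continuousAt_sOp α₀ hpos).comp (f := fun α => (α, z))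
      (by fun_prop : Continuous fun α : unitInterval => (α, z)).continuousAt
  have h2 : ∀ᶠ α in 𝓝 α₀, dist (sOp (H α) z) (sOp (H α₀) z) < c / 2 :=
    hcont.tendsto (Metric.ball_mem_nhds _ (by linarith))
  -- Half of `c` is lost to the perturbation of `S`, and the factor `2` in `(S + 1) f = 2 (H(α) -
  -- x₀) u` halves it again.
  refine ⟨c / 4, by linarith, ?_⟩
  filter_upwards [h2] with α hα u
  rw [dist_eq_norm] at hα
  set f : E := H α u - z • (u : E) with hf
  have hfu : res (H α) z f = u := (isResolventAt_res (hmem α)).2 u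
  obtain ⟨hd, h3⟩ : ∃ h : res (H α) z f ∈ (H α).domain, (sOp (H α) z + 1) f =
      (2 : ℂ) • (H α ⟨res (H α) z f, h⟩ - (x₀ : ℂ) • res (H α) z f) :=
    sOp_add_one_apply (hH.selfAdjoint α) f
  have h5 : (⟨res (H α) z f, hd⟩ : (H α).domain) = u := Subtype.ext hfu
  rw [h5, hfu] at h3
  have h6 := h1 f
  have h7 : (sOp (H α₀) z + 1) f = (sOp (H α) z + 1) f - (sOp (H α) z - sOp (H α₀) z) f := by
    simp only [add_apply, sub_apply, one_apply_eq_self]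
    abel
  have h8 : ‖(sOp (H α₀) z + 1) f‖ ≤ 2 * ‖H α u - (x₀ : ℂ) • (u : E)‖ + c / 2 * ‖f‖ := by
    rw [h7]
    refine (norm_sub_le _ _).trans ?_
    rw [h3, norm_smul, Complex.norm_ofNat]
    gcongr
    exact (ContinuousLinearMap.le_opNorm _ _).trans (by gcongr)
  have h9 := abs_im_mul_norm_le (hH.selfAdjoint α) u z
  rw [him, abs_one, one_mul, ← hf] at h9
  nlinarith

/-- At a real point of the resolvent set the resolvents of nearby operators at nearby points are
uniformly bounded. So `(z - z̄)(H(α) - z)⁻¹` tends to zero and `S` extends continuously by `1` to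
the real axis. -/
theorem IsFlowFamily.continuousWithinAt_sOp (hH : IsFlowFamily H) (α₀ : unitInterval) {z₀ : ℂ}
    (hz₀ : 0 ≤ z₀.im) (hr : z₀.im = 0 → z₀ ∈ resolventSet (H α₀)) :
    ContinuousWithinAt (fun p : unitInterval × ℂ => sOp (H p.1) p.2) {p | 0 ≤ p.2.im}
      (α₀, z₀) := by
  rcases hz₀.lt_or_eq with hpos | hzero
  · exact (hH.continuousAt_sOp α₀ hpos).continuousWithinAt
  have hre : ((z₀.re : ℝ) : ℂ) = z₀ := by
    apply Complex.ext <;> simp [← hzero]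
  obtain ⟨c, hc, hb⟩ := hH.exists_uniform_bound (x₀ := z₀.re) (by rw [hre]; exact hr hzero.symm)
  rw [ContinuousWithinAt, sOp_ofReal _ hzero.symm, tendsto_iff_norm_sub_tendsto_zero]
  have h1 : Tendsto (fun p : unitInterval × ℂ => 2 * |p.2.im| * (c / 2)⁻¹)
      (𝓝[{p | 0 ≤ p.2.im}] (α₀, z₀)) (𝓝 0) := by
    have h2 : Continuous fun p : unitInterval × ℂ => 2 * |p.2.im| * (c / 2)⁻¹ := by fun_prop
    have h3 := (h2.tendsto (α₀, z₀)).mono_left (nhdsWithin_le_nhds (s := {p | 0 ≤ p.2.im}))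
    simpa [← hzero] using h3
  refine squeeze_zero' (Eventually.of_forall fun _ => norm_nonneg _) ?_ h1
  have h2 : ∀ᶠ p : unitInterval × ℂ in 𝓝 (α₀, z₀), ∀ u : (H p.1).domain,
      c * ‖(u : E)‖ ≤ ‖H p.1 u - (z₀.re : ℂ) • (u : E)‖ :=
    (continuous_fst.tendsto (α₀, z₀)).eventually hb
  have h3 : ∀ᶠ p : unitInterval × ℂ in 𝓝 (α₀, z₀), dist p.2 z₀ < c / 2 :=
    (continuous_snd.tendsto (α₀, z₀)) (Metric.ball_mem_nhds z₀ (by linarith))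
  filter_upwards [h2.filter_mono nhdsWithin_le_nhds, h3.filter_mono nhdsWithin_le_nhds,
    self_mem_nhdsWithin] with p hp1 hp2 hp3
  have hp3 : 0 ≤ p.2.im := hp3
  rcases hp3.lt_or_eq with hp | hp
  · have h4 : sOp (H p.1) p.2 - 1 = (p.2 - conj p.2) • res (H p.1) p.2 := by
      rw [sOp, add_sub_cancel_left]
    rw [h4, norm_smul, norm_sub_conj]
    gcongr
    refine norm_res_le (mem_resolventSet_of_im_ne_zero (hH.selfAdjoint _) hp.ne') (by linarith)
      fun u => ?_
    have h5 := apply_sub_smul_le (H p.1) u p.2 z₀.re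
    have h6 := hp1 u
    rw [hre] at h5 h6
    rw [dist_eq_norm] at hp2
    nlinarith [norm_nonneg (u : E)]
  · rw [sOp_ofReal _ hp.symm, sub_self, norm_zero]
    positivity

/-- The operators `M` along a family of vertical half-lines, with the value `I` at infinity; `α` is
the parameter of the family, and the half-line ends at `x + ih`. -/
def flowSquare (H : unitInterval → E →ₗ.[ℂ] E) (α : unitInterval → unitInterval)
    (x h : unitInterval → ℝ) (p : unitInterval × unitInterval) : E →L[ℂ] E :=
  if p.2 = 0 then 1 else
    mOp (H (α p.1)) (H 0) (x p.1 + ((1 - p.2) * (p.2 : ℝ)⁻¹ + h p.1 : ℝ) * Complex.I)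

theorem IsFlowFamily.mOp_mem_unitaryCompact (hH : IsFlowFamily H) (α : unitInterval) {z : ℂ}
    (hz : 0 ≤ z.im) : mOp (H α) (H 0) z ∈ unitaryCompact E :=
  PushFlow.mOp_mem_unitaryCompact (hH.selfAdjoint α) (hH.selfAdjoint 0)
    fun h => hH.compact z (lt_of_le_of_ne hz (Ne.symm h)) α

theorem flowSquare_im_nonneg {h : ℝ} (hh : 0 ≤ h) (x : ℝ) (t : unitInterval) :
    0 ≤ ((x : ℂ) + ((1 - t) * (t : ℝ)⁻¹ + h : ℝ) * Complex.I).im := by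
  have h1 := t.2.1
  have h2 := t.2.2
  have h3 : 0 ≤ (1 - (t : ℝ)) * (t : ℝ)⁻¹ := mul_nonneg (by linarith) (inv_nonneg.2 h1)
  have : ((x : ℂ) + ((1 - t) * (t : ℝ)⁻¹ + h : ℝ) * Complex.I).im =
      (1 - t) * (t : ℝ)⁻¹ + h := by
    rw [Complex.add_im, Complex.ofReal_im, Complex.im_ofReal_mul, Complex.I_im]
    ring
  rw [this]
  positivity

theorem IsFlowFamily.flowSquare_mem (hH : IsFlowFamily H) {α : unitInterval → unitInterval}
    {x h : unitInterval → ℝ} (hh : ∀ s, 0 ≤ h s) (p : unitInterval × unitInterval) :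
    flowSquare H α x h p ∈ unitaryCompact E := by
  unfold flowSquare
  split_ifs
  · exact one_mem_unitaryCompact
  · exact hH.mOp_mem_unitaryCompact _ (flowSquare_im_nonneg (hh _) _ _)

end Family

/-! ### Homotopy invariance of `μ`. -/

section Family

variable {H : unitInterval → E →ₗ.[ℂ] E}

/-- At the top of the half-lines (`t = 0`) continuity is the uniform decay of `M - I`; elsewhere it
is the continuity of the two factors of `M`. The condition `hr` concerns only the points where a
half-line reaches the real axis. -/
theorem IsFlowFamily.continuousAt_flowSquare (hH : IsFlowFamily H)
    {α : unitInterval → unitInterval} {x h : unitInterval → ℝ} (hα : Continuous α)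
    (hx : Continuous x) (hh : Continuous h) (hh0 : ∀ s, 0 ≤ h s)
    {p₀ : unitInterval × unitInterval}
    (hr : p₀.2 = 1 → h p₀.1 = 0 →
      (x p₀.1 : ℂ) ∈ resolventSet (H (α p₀.1)) ∩ resolventSet (H 0)) :
    ContinuousAt (flowSquare H α x h) p₀ := by
  by_cases ht : p₀.2 = 0
  · obtain ⟨b, hb⟩ : ∃ b, ∀ s, |x s| ≤ b := by
      obtain ⟨b, hb⟩ := (isCompact_range (hx.abs)).bddAbove
      exact ⟨b, fun s => hb ⟨s, rfl⟩⟩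
    have h0 : flowSquare H α x h p₀ = 1 := by rw [flowSquare, if_pos ht]
    rw [ContinuousAt, h0, Metric.tendsto_nhds]
    intro ε hε
    obtain ⟨Y, hY⟩ := hH.exists_norm_mOp_sub_one_lt hε b
    -- The height of the point is `1/t - 1 + h`, so `t (|Y| + 1) < 1` puts it above `Y`.
    have h1 : ∀ᶠ p : unitInterval × unitInterval in 𝓝 p₀, (p.2 : ℝ) * (|Y| + 1) < 1 := by
      refine (isOpen_lt (by fun_prop) continuous_const).mem_nhds ?_
      simp [ht]
    filter_upwards [h1] with p hp
    rw [dist_eq_norm, flowSquare]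
    split_ifs with h2
    · simpa using hε
    · have h3 : 0 < (p.2 : ℝ) := unitInterval.pos_iff_ne_zero.2 h2
      refine hY _ ?_ _ (hb _) _
      have h4 : |Y| + 1 < (p.2 : ℝ)⁻¹ := by
        rw [← one_div, lt_div_iff₀ h3, mul_comm]
        exact hp
      have h5 : (1 - (p.2 : ℝ)) * (p.2 : ℝ)⁻¹ = (p.2 : ℝ)⁻¹ - 1 := by
        field_simp
      rw [ge_iff_le, h5]
      linarith [hh0 p.1, le_abs_self Y]
  · set z : unitInterval × unitInterval → ℂ := fun p =>
      x p.1 + ((1 - p.2) * (p.2 : ℝ)⁻¹ + h p.1 : ℝ) * Complex.I with hz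
    have h1 : flowSquare H α x h =ᶠ[𝓝 p₀] fun p =>
        sOp (H (α p.1)) (z p) * star (sOp (H 0) (z p)) := by
      have h2 : ∀ᶠ p : unitInterval × unitInterval in 𝓝 p₀, p.2 ≠ 0 :=
        continuous_snd.continuousAt.eventually_ne ht
      filter_upwards [h2] with p hp
      rw [flowSquare, if_neg hp, mOp_eq (hH.selfAdjoint 0)]
    refine ContinuousAt.congr ?_ h1.symm
    have ht' : (p₀.2 : ℝ) ≠ 0 := fun h => ht (Subtype.ext h)
    have hzc : ContinuousAt z p₀ := by
      have h2 : ContinuousAt (fun p : unitInterval × unitInterval => (p.2 : ℝ)⁻¹) p₀ :=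
        ContinuousAt.inv₀ (by fun_prop) ht'
      have h3 : ContinuousAt (fun p : unitInterval × unitInterval =>
          (1 - (p.2 : ℝ)) * (p.2 : ℝ)⁻¹ + h p.1) p₀ :=
        ((by fun_prop : ContinuousAt (fun p : unitInterval × unitInterval =>
          1 - (p.2 : ℝ)) p₀).mul h2).add (by fun_prop)
      exact (by fun_prop : ContinuousAt (fun p : unitInterval × unitInterval =>
        (x p.1 : ℂ)) p₀).add ((Complex.continuous_ofReal.continuousAt.comp h3).mul
          continuousAt_const)
    have hzim : ∀ p, 0 ≤ (z p).im := fun p => flowSquare_im_nonneg (hh0 _) _ _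
    have hzr : (z p₀).im = 0 → z p₀ ∈ resolventSet (H (α p₀.1)) ∩ resolventSet (H 0) := by
      intro h2
      have h3 : (1 - (p₀.2 : ℝ)) * (p₀.2 : ℝ)⁻¹ + h p₀.1 = 0 := by
        rw [← h2, hz, Complex.add_im, Complex.ofReal_im, Complex.im_ofReal_mul, Complex.I_im]
        ring
      have h4 : 0 ≤ (1 - (p₀.2 : ℝ)) * (p₀.2 : ℝ)⁻¹ :=
        mul_nonneg (by linarith [p₀.2.2.2]) (inv_nonneg.2 p₀.2.2.1)
      have h5 : h p₀.1 = 0 := le_antisymm (by linarith) (hh0 _)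
      have h6 : (1 - (p₀.2 : ℝ)) * (p₀.2 : ℝ)⁻¹ = 0 := by linarith
      have h7 : p₀.2 = 1 := by
        rcases mul_eq_zero.1 h6 with h | h
        · exact Subtype.ext (by change (p₀.2 : ℝ) = 1; linarith)
        · exact absurd (inv_eq_zero.1 h) ht'
      have h8 : z p₀ = x p₀.1 := by
        simp only [hz, h3]
        simp
      rw [h8]
      exact hr h7 h5
    have key : ∀ β : unitInterval → unitInterval, Continuous β →
        ((z p₀).im = 0 → z p₀ ∈ resolventSet (H (β p₀.1))) →
        ContinuousAt (fun p => sOp (H (β p.1)) (z p)) p₀ := by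
      intro β hβ hmem
      rw [← continuousWithinAt_univ]
      exact (hH.continuousWithinAt_sOp (β p₀.1) (hzim p₀) hmem).comp (t := {p | 0 ≤ p.2.im})
        (f := fun p : unitInterval × unitInterval => (β p.1, z p))
        (((hβ.comp continuous_fst).continuousAt.prodMk hzc).continuousWithinAt)
        fun p _ => hzim p
    exact (key α hα fun h => (hzr h).1).mul
      (key (fun _ => 0) continuous_const fun h => (hzr h).2).star

theorem IsFlowFamily.continuous_flowSquare (hH : IsFlowFamily H)
    {α : unitInterval → unitInterval} {x h : unitInterval → ℝ} (hα : Continuous α)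
    (hx : Continuous x) (hh : Continuous h) (hh0 : ∀ s, 0 ≤ h s)
    (hr : ∀ s, h s = 0 → (x s : ℂ) ∈ resolventSet (H (α s)) ∩ resolventSet (H 0)) :
    Continuous (flowSquare H α x h) :=
  continuous_iff_continuousAt.2 fun p =>
    hH.continuousAt_flowSquare hα hx hh hh0 fun _ => hr p.1

theorem flowSquare_eq_mPath {α : unitInterval → unitInterval} {x h : unitInterval → ℝ}
    {s t : unitInterval} (hs : h s = 0) (ht : t ≠ 0) :
    flowSquare H α x h (s, t) = mPath (H (α s)) (H 0) (x s) t := by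
  rw [flowSquare, if_neg ht, mPath]
  simp only [hs, add_zero]

theorem mu_eq_flow {A B : E →ₗ.[ℂ] E} {l : ℝ} {W : unitInterval → E →L[ℂ] E} (hW : Continuous W)
    (hW' : ∀ t, W t ∈ unitaryCompact E)
    (h : ∀ t : unitInterval, (t : ℝ) ∈ Ioo (0 : ℝ) 1 → W t = mPath A B l t)
    (θ : Ioo (0 : ℝ) (2 * Real.pi)) : mu θ l A B = flow W θ := by
  rw [flow_eq_increment (γ := ⟨_, continuous_eta_comp hW hW'⟩) fun _ => rfl]
  exact spflow_eq_increment (fun t ht => congrArg eta (h t ht)) θ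

/-- The square lemma for `M`. -/
theorem IsFlowFamily.flow_flowSquare (hH : IsFlowFamily H)
    {α : unitInterval → unitInterval} {x h : unitInterval → ℝ} (hα : Continuous α)
    (hx : Continuous x) (hh : Continuous h) (hh0 : ∀ s, 0 ≤ h s)
    (hr : ∀ s, h s = 0 → (x s : ℂ) ∈ resolventSet (H (α s)) ∩ resolventSet (H 0))
    (h0 : h 0 = 0) (h1 : h 1 = 0) (θ : Ioo (0 : ℝ) (2 * Real.pi)) :
    mu θ (x 1) (H (α 1)) (H 0) = mu θ (x 0) (H (α 0)) (H 0) +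
      flow (fun s => mOp (H (α s)) (H 0) (x s + h s * Complex.I)) θ := by
  have hc := hH.continuous_flowSquare hα hx hh hh0 hr
  have hm := hH.flowSquare_mem (α := α) (x := x) hh0
  have hmu : ∀ s, h s = 0 → mu θ (x s) (H (α s)) (H 0) =
      flow (fun t => flowSquare H α x h (s, t)) θ := fun s hs =>
    mu_eq_flow (by fun_prop) (fun t => hm (s, t)) (fun t ht => flowSquare_eq_mPath hs
      (fun h => ht.1.ne (by rw [h]; rfl))) θ
  have hsq := flow_square hc hm θ
  -- The edge `t = 0` is constantly `I` and has no flow. The edge `t = 1` is the curve `x + ih`.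
  rw [flow_of_const (W := fun s => flowSquare H α x h (s, 0)) fun s => by
    simp [flowSquare]] at hsq
  rw [hmu 1 h1, hmu 0 h0, ← zero_add (flow _ θ), ← hsq]
  congr 2
  funext s
  simp [flowSquare]

/-- Invariance of `μ` along paths in the common resolvent sets. -/
theorem IsFlowFamily.mu_eq_of_path (hH : IsFlowFamily H)
    {α : unitInterval → unitInterval} {x : unitInterval → ℝ} (hα : Continuous α)
    (hx : Continuous x)
    (hr : ∀ s, (x s : ℂ) ∈ resolventSet (H (α s)) ∩ resolventSet (H 0))
    (θ : Ioo (0 : ℝ) (2 * Real.pi)) :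
    mu θ (x 1) (H (α 1)) (H 0) = mu θ (x 0) (H (α 0)) (H 0) := by
  have h1 := hH.flow_flowSquare hα hx (h := fun _ => 0) continuous_const (fun _ => le_rfl)
    (fun s _ => hr s) rfl rfl θ
  have h2 : ∀ s, mOp (H (α s)) (H 0) (x s + (0 : ℝ) * Complex.I) = 1 := fun s => by
    rw [mOp_eq (hH.selfAdjoint 0), sOp_ofReal _ (by simp), sOp_ofReal _ (by simp), star_one,
      one_mul]
  rwa [flow_of_const (fun s => (h2 s).trans (h2 0).symm), add_zero] at h1

theorem mu_self {A : E →ₗ.[ℂ] E} (hA : IsSelfAdjoint A) (l : ℝ)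
    (θ : Ioo (0 : ℝ) (2 * Real.pi)) : mu θ l A A = 0 := by
  have h1 : ∀ z, mOp A A z = 1 := fun z => by
    rw [mOp_eq hA, (Unitary.mem_iff.1 (sOp_mem_unitary hA z)).2]
  exact (mu_eq_flow (W := fun _ => (1 : E →L[ℂ] E)) continuous_const
    (fun _ => one_mem_unitaryCompact) (fun t _ => (h1 _).symm) θ).trans
    (flow_of_const (fun _ => rfl) θ)

/-! ### The function `μ` is well defined in gaps of the essential spectrum -/

/-- On the vertical line through `l` the quotient `(l - z̄)/(l - z)` is exactly `-1`, so the limit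
is the reflection in the eigenspace. In particular `M` has a norm limit at `l` even if `l` is an
eigenvalue. -/
theorem IsGapAt.tendsto_sOp {A : E →ₗ.[ℂ] E} (hA : IsSelfAdjoint A) {l : ℝ} (h : IsGapAt A l)
    [FiniteDimensional ℂ (realEigenspace A l)] :
    Tendsto (fun y : ℝ => sOp A (l + y * Complex.I)) (𝓝[>] 0)
      (𝓝 (phaseOp (realEigenspace A l) Real.pi)) := by
  obtain ⟨δ, hδ, C, hC, hb⟩ := h.exists_norm_sOp_sub_le hA
  rw [tendsto_iff_norm_sub_tendsto_zero]
  have h1 : Tendsto (fun y : ℝ => C * y) (𝓝[>] 0) (𝓝 0) := by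
    have h2 : Continuous fun y : ℝ => C * y := by fun_prop
    simpa using (h2.tendsto 0).mono_left nhdsWithin_le_nhds
  refine squeeze_zero' (Eventually.of_forall fun _ => norm_nonneg _) ?_ h1
  filter_upwards [Ioo_mem_nhdsGT hδ] with y hy
  have him : ((l : ℂ) + y * Complex.I).im = y := by simp
  have h2 := hb (l + y * Complex.I) (by rw [him]; exact hy.1) (by
    rw [add_sub_cancel_left, norm_mul, Complex.norm_I, mul_one, Complex.norm_real,
      Real.norm_eq_abs, abs_of_pos hy.1]
    exact hy.2)
  rw [him] at h2
  have h3 : ((l : ℂ) - conj ((l : ℂ) + y * Complex.I)) / ((l : ℂ) - (l + y * Complex.I)) = -1 := by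
    have hy0 : (y : ℂ) ≠ 0 := Complex.ofReal_ne_zero.2 hy.1.ne'
    simp only [map_add, map_mul, Complex.conj_ofReal, Complex.conj_I, sub_add_cancel_left, mul_neg,
      neg_neg]
    rw [div_neg, div_self (mul_ne_zero hy0 Complex.I_ne_zero)]
  rw [h3] at h2
  rwa [phaseOp, Complex.exp_pi_mul_I]

theorem IsFlowFamily.resolventComparable (hH : IsFlowFamily H) (α : unitInterval) :
    ResolventComparable (H α) (H 0) := by
  have hI : ∀ α, Complex.I ∈ resolventSet (H α) := fun α =>
    mem_resolventSet_of_im_ne_zero (hH.selfAdjoint α) (by simp)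
  refine ⟨fun z hz => ?_, fun l => ?_⟩
  · rw [res_sub_res_eq (hI α) hz.2 (hI 0) hz.1]
    have h1 := (hH.compact Complex.I (by simp) α).comp_clm
      (1 + (z - Complex.I) • res (H 0) z : E →L[ℂ] E)
    exact h1.clm_comp (1 + (z - Complex.I) • res (H α) z : E →L[ℂ] E)
  · refine squeeze_zero' ?_ ?_ (hH.decay l)
    · filter_upwards [eventually_ge_atTop 0] with y hy
      positivity
    · filter_upwards [eventually_gt_atTop 0] with y hy
      exact hH.le_iSup l hy α

theorem IsFlowFamily.muDefined (hH : IsFlowFamily H) (α : unitInterval) {l : ℝ}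
    (hα : IsGapAt (H α) l) (h0 : IsGapAt (H 0) l) : MuDefined (H α) (H 0) l := by
  have hfα := hα.finiteDimensional
  have hf0 := h0.finiteDimensional
  set L : E →L[ℂ] E := phaseOp (realEigenspace (H α) l) Real.pi *
    star (phaseOp (realEigenspace (H 0) l) Real.pi) with hL
  have hLmem : L ∈ unitaryCompact E :=
    mul_mem_unitaryCompact (phaseOp_mem_unitaryCompact _ _)
      (star_mem_unitaryCompact (phaseOp_mem_unitaryCompact _ _))
  have hlim : Tendsto (fun y : ℝ => mOp (H α) (H 0) (l + y * Complex.I)) (𝓝[>] 0) (𝓝 L) := by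
    simp only [mOp_eq (hH.selfAdjoint 0)]
    exact (hα.tendsto_sOp (hH.selfAdjoint α)).mul (h0.tendsto_sOp (hH.selfAdjoint 0)).star
  have hmem : ∀ y : ℝ, 0 ≤ y → mOp (H α) (H 0) (l + y * Complex.I) ∈ unitaryCompact E :=
    fun y hy => hH.mOp_mem_unitaryCompact α (by simpa using hy)
  refine ⟨hH.resolventComparable α, ⟨eta L, ?_⟩, fun y hy => hmem y hy.le, ?_⟩
  · refine (continuousOn_eta L hLmem).tendsto.comp (tendsto_nhdsWithin_iff.2 ⟨hlim, ?_⟩)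
    filter_upwards [self_mem_nhdsWithin] with y hy
    exact hmem y (le_of_lt hy)
  -- The end value has to be overwritten: at `t = 1` the formula for `M` gives `I`, which need not
  -- be the limit if `l` is an eigenvalue.
  · set V : unitInterval → E →L[ℂ] E :=
      Function.update (fun t => flowSquare H (fun _ => α) (fun _ => l) (fun _ => 0) (0, t)) 1 L
      with hV
    have hVc : Continuous V := by
      rw [continuous_iff_continuousAt]
      intro t
      by_cases ht : t = 1
      · rw [ht, hV, continuousAt_update_same]
        have h1 : Tendsto (fun t : unitInterval => (1 - (t : ℝ)) * (t : ℝ)⁻¹) (𝓝[≠] 1)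
            (𝓝[>] 0) := by
          rw [tendsto_nhdsWithin_iff]
          constructor
          · have h2 : ContinuousAt (fun t : unitInterval => (1 - (t : ℝ)) * (t : ℝ)⁻¹) 1 :=
              (by fun_prop : ContinuousAt (fun t : unitInterval => 1 - (t : ℝ)) 1).mul
                (ContinuousAt.inv₀ (by fun_prop) (by simp))
            have h3 := h2.tendsto
            simp only [Icc.coe_one, sub_self, zero_mul] at h3
            exact h3.mono_left nhdsWithin_le_nhds
          · have h2 : ∀ᶠ t : unitInterval in 𝓝 1, t ≠ 0 :=
              continuous_id.continuousAt.eventually_ne one_ne_zero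
            filter_upwards [self_mem_nhdsWithin, h2.filter_mono nhdsWithin_le_nhds] with t ht ht0
            have h4 : 0 < (t : ℝ) := unitInterval.pos_iff_ne_zero.2 ht0
            have h5 : (t : ℝ) < 1 := unitInterval.lt_one_iff_ne_one.2 ht
            exact mul_pos (by linarith) (inv_pos.2 h4)
        refine (hlim.comp h1).congr' ?_
        have h2 : ∀ᶠ t : unitInterval in 𝓝 1, t ≠ 0 :=
          continuous_id.continuousAt.eventually_ne one_ne_zero
        filter_upwards [h2.filter_mono nhdsWithin_le_nhds] with t ht0
        rw [flowSquare_eq_mPath rfl ht0]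
        rfl
      · rw [hV, continuousAt_update_of_ne ht]
        exact (hH.continuousAt_flowSquare (p₀ := (0, t)) continuous_const continuous_const
          continuous_const (fun _ => le_rfl) fun h => absurd h ht).comp
          (f := fun t : unitInterval => ((0 : unitInterval), t)) (by fun_prop)
    have hVm : ∀ t, V t ∈ unitaryCompact E := by
      intro t
      by_cases ht : t = 1
      · rw [ht, hV, Function.update_self]
        exact hLmem
      · rw [hV, Function.update_of_ne ht]
        exact hH.flowSquare_mem (fun _ => le_rfl) _
    refine exists_isFlowLift (γ := ⟨_, continuous_eta_comp hVc hVm⟩) fun t ht => ?_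
    change eta (V t) = _
    rw [hV, Function.update_of_ne (fun h => ht.2.ne (by rw [h]; rfl)),
      flowSquare_eq_mPath rfl (fun h => ht.1.ne (by rw [h]; rfl))]

end Family

/-! ### The jump of `μ` at an eigenvalue. -/

section Family

variable {H : unitInterval → E →ₗ.[ℂ] E}

theorem IsFlowFamily.eventually_mem_resolventSet (hH : IsFlowFamily H) {α₀ : unitInterval} {x : ℝ}
    (h : (x : ℂ) ∈ resolventSet (H α₀)) : ∀ᶠ α in 𝓝 α₀, (x : ℂ) ∈ resolventSet (H α) := by
  obtain ⟨c, hc, hb⟩ := hH.exists_uniform_bound h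
  exact hb.mono fun α hα => exists_isResolventAt (hH.selfAdjoint α) hc hα

/-- `μ(θ; x, H(α), H(0))` is locally constant in `α` off the spectrum. -/
theorem IsFlowFamily.eventually_mu_eq (hH : IsFlowFamily H) {α₀ : unitInterval} {x : ℝ}
    (h : (x : ℂ) ∈ resolventSet (H α₀)) (h0 : (x : ℂ) ∈ resolventSet (H 0)) :
    ∀ᶠ α in 𝓝 α₀, ∀ θ, mu θ x (H α) (H 0) = mu θ x (H α₀) (H 0) := by
  have : LocallyPathConnectedSpace unitInterval :=
    (convex_Icc (0 : ℝ) 1).locallyPathConnectedSpace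
  obtain ⟨V, ⟨hV, hVp⟩, hVs⟩ :=
    (LocallyPathConnectedSpace.path_connected_basis α₀).mem_iff.1
      (hH.eventually_mem_resolventSet h)
  filter_upwards [hV] with α hα θ
  obtain ⟨p, hp⟩ := hVp.joinedIn α₀ (mem_of_mem_nhds hV) α hα
  have := hH.mu_eq_of_path p.continuous (x := fun _ => x) continuous_const
    (fun s => ⟨hVs (hp s), h0⟩) θ
  rwa [p.source, p.target] at this

/-- `μ` is constant on intervals in the common resolvent set. -/
theorem IsFlowFamily.mu_eq_of_Icc (hH : IsFlowFamily H) (α : unitInterval) {a b : ℝ} (hab : a ≤ b)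
    (h : ∀ x ∈ Icc a b, (x : ℂ) ∈ resolventSet (H α) ∩ resolventSet (H 0))
    (θ : Ioo (0 : ℝ) (2 * Real.pi)) : mu θ b (H α) (H 0) = mu θ a (H α) (H 0) := by
  have := hH.mu_eq_of_path (α := fun _ => α) (x := fun s => a + s * (b - a)) continuous_const
    (by fun_prop) (fun s => h _ ⟨by nlinarith [s.2.1, s.2.2], by nlinarith [s.2.1, s.2.2]⟩) θ
  simpa using this

theorem sub_eq_neg_mul_exp (r u : ℝ) (t : ℝ) :
    ((t - r * Real.cos u : ℝ) : ℂ) + (r * Real.sin u : ℝ) * Complex.I - t =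
      -(r * Complex.exp (-(u * Complex.I))) := by
  rw [← neg_mul (u : ℂ), Complex.exp_mul_I]
  push_cast
  rw [Complex.cos_neg, Complex.sin_neg]
  ring

/-- On a small half-circle around a point of the gap `S(z)` is close to a path of unitary operators
that rotates the eigenspace once. -/
theorem IsGapAt.exists_norm_sOp_sub_phaseOp_le {A : E →ₗ.[ℂ] E} (hA : IsSelfAdjoint A) {t : ℝ}
    (h : IsGapAt A t) [FiniteDimensional ℂ (realEigenspace A t)] :
    ∃ δ > 0, ∃ C > 0, ∀ r : ℝ, 0 < r → r < δ → ∀ u ∈ Icc 0 Real.pi,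
      ‖sOp A ((t - r * Real.cos u : ℝ) + (r * Real.sin u : ℝ) * Complex.I) -
        phaseOp (realEigenspace A t) (2 * u)‖ ≤ C * r := by
  obtain ⟨δ, hδ, C, hC, hb⟩ := h.exists_norm_sOp_sub_le hA
  refine ⟨δ, hδ, C, hC, fun r hr hrδ u hu => ?_⟩
  set z : ℂ := (t - r * Real.cos u : ℝ) + (r * Real.sin u : ℝ) * Complex.I with hz
  have hzt : z - t = -(r * Complex.exp (-(u * Complex.I))) := sub_eq_neg_mul_exp r u t
  have him : z.im = r * Real.sin u := by
    rw [hz, Complex.add_im, Complex.ofReal_im, Complex.im_ofReal_mul, Complex.I_im]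
    ring
  have hsin : 0 ≤ Real.sin u := Real.sin_nonneg_of_mem_Icc hu
  rcases hsin.lt_or_eq with hpos | hzero
  · have h1 := hb z (by rw [him]; positivity) (by
      rw [hzt, norm_neg, norm_mul, ← neg_mul, ← Complex.ofReal_neg, Complex.norm_exp_ofReal_mul_I,
        mul_one, Complex.norm_real, Real.norm_eq_abs, abs_of_pos hr]
      exact hrδ)
    have hr0 : (r : ℂ) ≠ 0 := Complex.ofReal_ne_zero.2 hr.ne'
    have h2 : (t : ℂ) - z = r * Complex.exp (-(u * Complex.I)) := by
      rw [← neg_sub, hzt, neg_neg]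
    have h3 : (t : ℂ) - conj z = r * Complex.exp (u * Complex.I) := by
      have := congrArg conj h2
      rw [map_sub, Complex.conj_ofReal, map_mul, Complex.conj_ofReal, ← Complex.exp_conj, map_neg,
        map_mul, Complex.conj_ofReal, Complex.conj_I, mul_neg, neg_neg] at this
      exact this
    -- The quotient is `exp(2iu)`, so it makes one full turn as `u` runs over `[0, π]`.
    have h4 : ((t : ℂ) - conj z) / ((t : ℂ) - z) = Complex.exp ((2 * u : ℝ) * Complex.I) := by
      rw [h2, h3, mul_div_mul_left _ _ hr0, ← Complex.exp_sub]
      congr 1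
      push_cast
      ring
    rw [h4, him] at h1
    refine h1.trans ?_
    have := Real.sin_le_one u
    gcongr
    nlinarith
  -- At the ends of the half-circle both operators are the identity.
  · have h1 : Complex.exp ((2 * u : ℝ) * Complex.I) = 1 := by
      rw [Complex.exp_mul_I, ← Complex.ofReal_cos, ← Complex.ofReal_sin, Real.sin_two_mul,
        Real.cos_two_mul', ← hzero]
      have := Real.sin_sq_add_cos_sq u
      rw [← hzero] at this
      have h2 : Real.cos u ^ 2 = 1 := by linarith
      rw [h2]
      simp
    rw [sOp_ofReal A (by rw [him, ← hzero, mul_zero]), phaseOp, h1]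
    simp
    positivity

/-- The jump of `μ` at a point of the gap is the difference of the multiplicities. -/
theorem IsFlowFamily.exists_jump (hH : IsFlowFamily H) (α : unitInterval) {t : ℝ}
    (hα : IsGapAt (H α) t) (h0 : IsGapAt (H 0) t) :
    ∃ δ > 0, (∀ s : ℝ, s ≠ t → |s - t| < δ →
        (s : ℂ) ∈ resolventSet (H α) ∩ resolventSet (H 0)) ∧
      ∀ r : ℝ, 0 < r → r < δ → ∀ θ, mu θ (t + r) (H α) (H 0) = mu θ (t - r) (H α) (H 0) +
        ((Module.finrank ℂ (realEigenspace (H α) t) : ℤ) -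
          Module.finrank ℂ (realEigenspace (H 0) t)) := by
  have hfα := hα.finiteDimensional
  have hf0 := h0.finiteDimensional
  obtain ⟨δ₁, hδ₁, hρ₁⟩ := hα.exists_punctured (hH.selfAdjoint α)
  obtain ⟨δ₂, hδ₂, hρ₂⟩ := h0.exists_punctured (hH.selfAdjoint 0)
  obtain ⟨δ₃, hδ₃, C₁, hC₁, hb₁⟩ := hα.exists_norm_sOp_sub_phaseOp_le (hH.selfAdjoint α)
  obtain ⟨δ₄, hδ₄, C₂, hC₂, hb₂⟩ := h0.exists_norm_sOp_sub_phaseOp_le (hH.selfAdjoint 0)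
  have hpi := Real.pi_pos
  -- The last entry gives `(C₁ + C₂) r < 1`, the closeness required by `flow_eq_zero_of_norm_lt`.
  set δ : ℝ := min (min δ₁ δ₂) (min (min δ₃ δ₄) (C₁ + C₂)⁻¹) with hδdef
  have hle1 : δ ≤ δ₁ := (min_le_left _ _).trans (min_le_left _ _)
  have hle2 : δ ≤ δ₂ := (min_le_left _ _).trans (min_le_right _ _)
  have hle3 : δ ≤ δ₃ := (min_le_right _ _).trans ((min_le_left _ _).trans (min_le_left _ _))
  have hle4 : δ ≤ δ₄ := (min_le_right _ _).trans ((min_le_left _ _).trans (min_le_right _ _))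
  have hle5 : δ ≤ (C₁ + C₂)⁻¹ := (min_le_right _ _).trans (min_le_right _ _)
  have hρ : ∀ s : ℝ, s ≠ t → |s - t| < δ →
      (s : ℂ) ∈ resolventSet (H α) ∩ resolventSet (H 0) := fun s hs hst =>
    ⟨hρ₁ s hs (hst.trans_le hle1), hρ₂ s hs (hst.trans_le hle2)⟩
  refine ⟨δ, by positivity, hρ, fun r hr hrδ θ => ?_⟩
  set x : unitInterval → ℝ := fun s => t - r * Real.cos (Real.pi * s) with hx
  set h : unitInterval → ℝ := fun s => r * Real.sin (Real.pi * s) with hh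
  have hu : ∀ s : unitInterval, Real.pi * s ∈ Icc 0 Real.pi := fun s =>
    ⟨mul_nonneg hpi.le s.2.1, mul_le_of_le_one_right hpi.le s.2.2⟩
  have hxc : Continuous x := by fun_prop
  have hhc : Continuous h := by fun_prop
  have hhn : ∀ s, 0 ≤ h s := fun s => mul_nonneg hr.le (Real.sin_nonneg_of_mem_Icc (hu s))
  have hr' : ∀ s, h s = 0 → (x s : ℂ) ∈ resolventSet (H α) ∩ resolventSet (H 0) := by
    intro s hs
    have h1 : Real.sin (Real.pi * s) = 0 := (mul_eq_zero.1 hs).resolve_left hr.ne'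
    have h2 := Real.sin_sq_add_cos_sq (Real.pi * s)
    rw [h1] at h2
    have h3 : |x s - t| = r := by
      have h4 : |Real.cos (Real.pi * s)| = 1 := by
        rw [← abs_one, ← sq_eq_sq_iff_abs_eq_abs]
        linarith
      rw [hx]
      simp only
      rw [sub_sub_cancel_left, abs_neg, abs_mul, h4, mul_one, abs_of_pos hr]
    refine hρ _ (fun h5 => ?_) (h3.trans_lt hrδ)
    rw [h5, sub_self, abs_zero] at h3
    exact hr.ne h3
  have hflow := hH.flow_flowSquare (α := fun _ => α) continuous_const hxc hhc hhn hr'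
    (by simp [hh]) (by simp [hh]) θ
  have hx1 : x 1 = t + r := by simp [hx]
  have hx0 : x 0 = t - r := by simp [hx]
  rw [hx1, hx0] at hflow
  rw [hflow, add_right_inj]
  set K := realEigenspace (H α) t
  set K₀ := realEigenspace (H 0) t
  set M : unitInterval → E →L[ℂ] E := fun s => mOp (H α) (H 0) (x s + h s * Complex.I) with hM
  have hMc : Continuous M := by
    have h1 : Continuous fun s => flowSquare H (fun _ => α) x h (s, 1) :=
      (hH.continuous_flowSquare continuous_const hxc hhc hhn hr').comp (by fun_prop)
    refine h1.congr fun s => ?_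
    simp [flowSquare, hM]
  have hMm : ∀ s, M s ∈ unitaryCompact E := fun s =>
    hH.mOp_mem_unitaryCompact α (by
      rw [Complex.add_im, Complex.ofReal_im, Complex.im_ofReal_mul, Complex.I_im]
      have := hhn s
      linarith)
  have hM1 : ∀ s, h s = 0 → M s = 1 := fun s hs => by
    rw [hM]
    simp only
    rw [mOp_eq (hH.selfAdjoint 0), sOp_ofReal _ (by simp [hs]), sOp_ofReal _ (by simp [hs]),
      star_one, one_mul]
  set D : unitInterval → E →L[ℂ] E := fun s => phaseOp K (2 * (Real.pi * s)) with hD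
  set D₀ : unitInterval → E →L[ℂ] E := fun s => phaseOp K₀ (2 * (Real.pi * s)) with hD₀
  have hDc : Continuous D := (continuous_phaseOp K).comp (by fun_prop)
  have hD₀c : Continuous D₀ := (continuous_phaseOp K₀).comp (by fun_prop)
  have hDm : ∀ s, D s ∈ unitaryCompact E := fun s => phaseOp_mem_unitaryCompact _ _
  have hD₀m : ∀ s, D₀ s ∈ unitaryCompact E := fun s => phaseOp_mem_unitaryCompact _ _
  have hDD : ∀ s, D s * star (D s) = 1 := fun s => (Unitary.mem_iff.1 (hDm s).1).2
  have hDD' : ∀ s, star (D s) * D s = 1 := fun s => (Unitary.mem_iff.1 (hDm s).1).1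
  have hDD₀ : ∀ s, D₀ s * star (D₀ s) = 1 := fun s => (Unitary.mem_iff.1 (hD₀m s).1).2
  have hDD₀' : ∀ s, star (D₀ s) * D₀ s = 1 := fun s => (Unitary.mem_iff.1 (hD₀m s).1).1
  have hD0 : D 0 = 1 := by simp [hD, phaseOp_zero]
  have hD1 : D 1 = 1 := by simp [hD, phaseOp_two_pi]
  have hD₀0 : D₀ 0 = 1 := by simp [hD₀, phaseOp_zero]
  have hD₀1 : D₀ 1 = 1 := by simp [hD₀, phaseOp_two_pi]
  -- `M = D B D₀*` splits the path into loops at the identity, so the flows add. The loop `B` stays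
  -- close to the identity and contributes nothing, because `S` is close to `D` and `S₀` is close to
  -- `D₀`.
  set B : unitInterval → E →L[ℂ] E := fun s => star (D s) * M s * D₀ s with hB
  have hBc : Continuous B := (hDc.star.mul hMc).mul hD₀c
  have hBm : ∀ s, B s ∈ unitaryCompact E := fun s =>
    mul_mem_unitaryCompact (mul_mem_unitaryCompact (star_mem_unitaryCompact (hDm s)) (hMm s))
      (hD₀m s)
  have hB0 : B 0 = 1 := by
    rw [hB]
    simp only
    rw [hD0, hD₀0, hM1 0 (by simp [hh]), star_one, one_mul, one_mul]
  have hB1 : B 1 = 1 := by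
    rw [hB]
    simp only
    rw [hD1, hD₀1, hM1 1 (by simp [hh]), star_one, one_mul, one_mul]
  have hBn : ∀ s, ‖B s - 1‖ < 1 := by
    intro s
    set S := sOp (H α) (x s + h s * Complex.I)
    set S₀ := sOp (H 0) (x s + h s * Complex.I)
    have e1 : M s = S * star S₀ := mOp_eq (hH.selfAdjoint 0) _
    have hS₀n : ‖S₀‖ ≤ 1 := norm_sOp_le (hH.selfAdjoint 0) _
    have hDn : ∀ {W : E →L[ℂ] E}, W ∈ unitaryCompact E → ‖W‖ ≤ 1 := fun hW =>
      ContinuousLinearMap.opNorm_le_bound _ zero_le_one fun y => by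
        rw [ContinuousLinearMap.norm_map_of_mem_unitary hW.1, one_mul]
    have h1 : ‖S - D s‖ ≤ C₁ * r := hb₁ r hr (hrδ.trans_le hle3) _ (hu s)
    have h2 : ‖S₀ - D₀ s‖ ≤ C₂ * r := hb₂ r hr (hrδ.trans_le hle4) _ (hu s)
    have e2 : B s - 1 = star (D s) * ((S - D s) * star S₀ + D s * star (S₀ - D₀ s)) * D₀ s := by
      have e3 : (S - D s) * star S₀ + D s * star (S₀ - D₀ s) = M s - D s * star (D₀ s) := by
        rw [star_sub, sub_mul, mul_sub, ← e1]
        abel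
      rw [e3, mul_sub, sub_mul, ← mul_assoc (star (D s)) (D s), hDD', one_mul, hDD₀']
    rw [e2]
    have h3 : ‖(S - D s) * star S₀ + D s * star (S₀ - D₀ s)‖ ≤ C₁ * r + C₂ * r := by
      refine (norm_add_le _ _).trans (add_le_add ?_ ?_)
      · refine (norm_mul_le _ _).trans ?_
        rw [norm_star]
        exact (mul_le_of_le_one_right (norm_nonneg _) hS₀n).trans h1
      · refine (norm_mul_le _ _).trans ?_
        rw [norm_star]
        exact (mul_le_of_le_one_left (norm_nonneg _) (hDn (hDm s))).trans h2
    have h4 : C₁ * r + C₂ * r < 1 := by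
      have h5 : (C₁ + C₂) * r < (C₁ + C₂) * (C₁ + C₂)⁻¹ := by
        gcongr
        exact hrδ.trans_le hle5
      rw [mul_inv_cancel₀ (by positivity)] at h5
      linarith
    refine lt_of_le_of_lt ?_ h4
    refine (norm_mul_le _ _).trans ((mul_le_of_le_one_right (norm_nonneg _) (hDn (hD₀m s))).trans ?_)
    refine (norm_mul_le _ _).trans (le_trans ?_ h3)
    rw [norm_star]
    exact mul_le_of_le_one_left (norm_nonneg _) (hDn (hDm s))
  have hMeq : M = fun s => D s * (B s * star (D₀ s)) := by
    funext s
    rw [hB]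
    simp only
    rw [mul_assoc (star (D s) * M s), hDD₀, mul_one, ← mul_assoc, hDD, one_mul]
  rw [hMeq, flow_mul (B := fun s => B s * star (D₀ s)) hDc (hBc.mul hD₀c.star) hDm
    (fun s => mul_mem_unitaryCompact (hBm s) (star_mem_unitaryCompact (hD₀m s))) hD1
    (by simp only [hB0, hD₀0, star_one, one_mul]),
    flow_mul hBc hD₀c.star hBm (fun s => star_mem_unitaryCompact (hD₀m s)) hB1
    (by simp only [hD₀0, star_one]),
    flow_eq_zero_of_norm_lt hBc hBm hB0 hB1 hBn]
  -- The inverse rotation is written with angles decreasing from `2π` to `0`, so that `flow_phaseOp`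
  -- applies and gives the negative dimension.
  have hφ : (fun s => star (D₀ s)) =
      fun s : unitInterval => phaseOp K₀ (2 * Real.pi - 2 * (Real.pi * s)) := by
    funext s
    rw [hD₀]
    simp only
    rw [star_phaseOp, sub_eq_add_neg, ← phaseOp_mul, phaseOp_two_pi, one_mul]
  have hm : ∀ s : unitInterval, 2 * (Real.pi * s) ∈ Icc 0 (2 * Real.pi) := fun s =>
    ⟨by linarith [(hu s).1], by linarith [(hu s).2]⟩
  rw [hφ, flow_phaseOp K (by fun_prop) hm, flow_phaseOp K₀ (by fun_prop) fun s =>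
    ⟨by linarith [(hm s).2], by linarith [(hm s).1]⟩]
  have hθ1 := θ.2.1
  have hθ2 := θ.2.2.le
  simp [hθ2, hθ1.not_ge]
  ring

end Family

/-! ### Counting eigenvalues in gaps of the essential spectrum -/

section Count

variable {A : E →ₗ.[ℂ] E} {a b : ℝ}

theorem realEigenspace_isOrtho (hA : IsSelfAdjoint A) {s t : ℝ} (hst : s ≠ t) :
    realEigenspace A s ⟂ realEigenspace A t := by
  rw [Submodule.isOrtho_iff_inner_eq]
  intro x hx y hy
  obtain ⟨hd, hy'⟩ := mem_realEigenspace.1 hy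
  have h1 := sub_mul_inner_eigenvector hA hx ⟨y, hd⟩ t
  rw [hy', sub_self, inner_zero_right] at h1
  refine (mul_eq_zero.1 h1.symm).resolve_left (sub_ne_zero.2 fun h => hst ?_)
  exact_mod_cast h

/-- Gap points have punctured neighbourhoods in the resolvent set, and the interval is compact. -/
theorem finite_notMem_resolventSet (hA : IsSelfAdjoint A) (hgap : ∀ t ∈ Icc a b, IsGapAt A t) :
    {t | t ∈ Icc a b ∧ (t : ℂ) ∉ resolventSet A}.Finite := by
  choose! δ hδ hs using fun t (ht : t ∈ Icc a b) => (hgap t ht).exists_punctured hA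
  obtain ⟨F, hF, hcov⟩ := isCompact_Icc.elim_nhds_subcover (fun t => Metric.ball t (δ t))
    fun t ht => Metric.ball_mem_nhds t (hδ t ht)
  refine F.finite_toSet.subset fun t ht => ?_
  obtain ⟨s, hsF, hst⟩ := mem_iUnion₂.1 (hcov ht.1)
  by_cases h : t = s
  · rw [h]
    exact hsF
  · exact absurd (hs s (hF s hsF) t h hst) ht.2

theorem intervalSpace_eq_bot (h : ∀ t ∈ Ico a b, realEigenspace A t = ⊥) :
    intervalSpace A a b = ⊥ := by
  rw [eq_bot_iff, intervalSpace]
  exact iSup₂_le fun t ht => (h t ht).le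

theorem finiteDimensional_intervalSpace (hA : IsSelfAdjoint A)
    (hgap : ∀ t ∈ Icc a b, IsGapAt A t) {l x : ℝ} (hl : a ≤ l) (hx : x ≤ b) :
    FiniteDimensional ℂ (intervalSpace A l x) := by
  have hfin := finite_notMem_resolventSet hA hgap
  set F := {t | t ∈ Icc a b ∧ (t : ℂ) ∉ resolventSet A} with hF
  have : Finite F := hfin
  have : ∀ t : F, FiniteDimensional ℂ (realEigenspace A t) :=
    fun t => (hgap t t.2.1).finiteDimensional
  have h1 : intervalSpace A l x ≤ ⨆ t : F, realEigenspace A t := by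
    refine iSup₂_le fun t ht => ?_
    by_cases hr : (t : ℂ) ∈ resolventSet A
    · rw [realEigenspace_eq_bot hr]
      exact bot_le
    · exact le_iSup (fun t : F => realEigenspace A t) ⟨t, ⟨hl.trans ht.1, ht.2.le.trans hx⟩, hr⟩
  exact Submodule.finiteDimensional_of_le h1

theorem finrank_intervalSpace_add (hA : IsSelfAdjoint A) (hgap : ∀ t ∈ Icc a b, IsGapAt A t)
    {l m x : ℝ} (hl : a ≤ l) (hlm : l ≤ m) (hmx : m ≤ x) (hx : x ≤ b) :
    Module.finrank ℂ (intervalSpace A l x) =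
      Module.finrank ℂ (intervalSpace A l m) + Module.finrank ℂ (intervalSpace A m x) := by
  have := finiteDimensional_intervalSpace hA hgap hl (hmx.trans hx)
  have := finiteDimensional_intervalSpace hA hgap (hl.trans hlm) hx
  have h1 : intervalSpace A l x = intervalSpace A l m ⊔ intervalSpace A m x := by
    rw [intervalSpace, intervalSpace, intervalSpace, ← iSup_union, Ico_union_Ico_eq_Ico hlm hmx]
  have h2 := Submodule.finrank_sup_add_finrank_inf_eq (intervalSpace A l m) (intervalSpace A m x)
  have h3 : Disjoint (intervalSpace A l m) (intervalSpace A m x) := by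
    refine Submodule.IsOrtho.disjoint ?_
    rw [intervalSpace, intervalSpace]
    simp only [Submodule.isOrtho_iSup_left, Submodule.isOrtho_iSup_right]
    intro s hs t ht
    exact realEigenspace_isOrtho hA (ht.2.trans_le hs.1).ne
  rw [h3.eq_bot, finrank_bot, add_zero] at h2
  rw [h1, h2]

theorem intervalCount_of_le (h : a ≤ b) :
    intervalCount A a b = Module.finrank ℂ (intervalSpace A a b) := by
  rw [intervalCount, intervalSpace_eq_bot (a := b) (b := a)
    (by simp [Ico_eq_empty (not_lt.2 h)]), finrank_bot]
  simp

theorem intervalCount_symm (a b : ℝ) : intervalCount A a b = -intervalCount A b a := by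
  rw [intervalCount, intervalCount]
  ring

theorem intervalCount_add_of_le (hA : IsSelfAdjoint A) (hgap : ∀ t ∈ Icc a b, IsGapAt A t)
    {l m x : ℝ} (hl : a ≤ l) (hlm : l ≤ m) (hmx : m ≤ x) (hx : x ≤ b) :
    intervalCount A l x = intervalCount A l m + intervalCount A m x := by
  rw [intervalCount_of_le hlm, intervalCount_of_le hmx, intervalCount_of_le (hlm.trans hmx)]
  exact_mod_cast finrank_intervalSpace_add hA hgap hl hlm hmx hx

theorem intervalCount_eq_sub (hA : IsSelfAdjoint A) (hgap : ∀ t ∈ Icc a b, IsGapAt A t)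
    {l x : ℝ} (hl : l ∈ Icc a b) (hx : x ∈ Icc a b) :
    intervalCount A l x = intervalCount A a x - intervalCount A a l := by
  rcases le_total l x with h | h
  · rw [intervalCount_add_of_le hA hgap le_rfl hl.1 h hx.2]
    ring
  · rw [intervalCount_add_of_le hA hgap le_rfl hx.1 h hl.2, intervalCount_symm]
    ring

theorem intervalCount_nonneg (h : a ≤ b) : 0 ≤ intervalCount A a b := by
  rw [intervalCount_of_le h]
  positivity

theorem intervalCount_monotoneOn (hA : IsSelfAdjoint A) (hgap : ∀ t ∈ Icc a b, IsGapAt A t) :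
    MonotoneOn (intervalCount A a) (Icc a b) := by
  intro x hx y hy hxy
  rw [intervalCount_add_of_le hA hgap le_rfl hx.1 hxy hy.2]
  exact le_add_of_nonneg_right (intervalCount_nonneg hxy)

theorem intervalCount_eq_zero (hab : a ≤ b) (h : ∀ t ∈ Ico a b, realEigenspace A t = ⊥) :
    intervalCount A a b = 0 := by
  rw [intervalCount_of_le hab, intervalSpace_eq_bot h, finrank_bot, Nat.cast_zero]

theorem intervalCount_eq_finrank (hab : a < b) (h : ∀ t ∈ Ioo a b, realEigenspace A t = ⊥) :
    intervalCount A a b = Module.finrank ℂ (realEigenspace A a) := by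
  have h1 : intervalSpace A a b = realEigenspace A a := by
    refine le_antisymm (iSup₂_le fun t ht => ?_)
      (le_iSup₂_of_le (f := fun t (_ : t ∈ Ico a b) => realEigenspace A t) a ⟨le_rfl, hab⟩ le_rfl)
    rcases ht.1.eq_or_lt with rfl | hlt
    · exact le_rfl
    · rw [h t ⟨hlt, ht.2⟩]
      exact bot_le
  rw [intervalCount_of_le hab.le, h1]

theorem eventually_intervalCount_eq (hA : IsSelfAdjoint A) (hgap : ∀ t ∈ Icc a b, IsGapAt A t)
    {x : ℝ} (hx : x ∈ Icc a b) :
    ∀ᶠ u in 𝓝[Icc a b] x, u ≤ x → intervalCount A a u = intervalCount A a x := by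
  obtain ⟨δ, hδ, hs⟩ := (hgap x hx).exists_punctured_bot hA
  filter_upwards [inter_mem_nhdsWithin (Icc a b) (Metric.ball_mem_nhds x hδ)] with u hu hux
  have hu2 : |u - x| < δ := hu.2
  rw [intervalCount_add_of_le hA hgap le_rfl hu.1.1 hux hx.2,
    intervalCount_eq_zero hux fun t ht => hs t ht.2.ne ?_, add_zero]
  rw [abs_lt] at hu2 ⊢
  constructor <;> linarith [ht.1, ht.2]

/-- A function that is locally constant off a discrete set with the same value on both sides is
constant. -/
theorem eq_of_locally_eq {Z : Type*} {G : Set ℝ} {F : ℝ → Z}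
    (h : ∀ t ∈ Icc a b, ∃ v, ∀ᶠ u in 𝓝[Icc a b] t, u ∈ G → F u = v)
    (hG : ∀ t ∈ Icc a b, ∃ᶠ u in 𝓝[Icc a b] t, u ∈ G) {x y : ℝ} (hx : x ∈ Icc a b)
    (hy : y ∈ Icc a b) (hxG : x ∈ G) (hyG : y ∈ G) : F x = F y := by
  have : Nonempty Z := ⟨F x⟩
  choose! v hv using h
  have h1 : ∀ t ∈ Icc a b, t ∈ G → F t = v t := fun t ht htG =>
    (hv t ht).self_of_nhdsWithin ht htG
  have h2 : v x = v y := by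
    -- The local value `v` is itself locally constant: for `s` near `t` there are points of `G`
    -- close to both, and at such a point `F` equals `v t` as well as `v s`.
    refine isPreconnected_Icc.induction₂ (fun x y => v x = v y) (fun t ht => ?_)
      (fun _ _ _ _ _ _ => Eq.trans) (fun _ _ _ _ => Eq.symm) hx hy
    filter_upwards [eventually_eventually_nhdsWithin.2 (hv t ht), self_mem_nhdsWithin] with s hs hsI
    obtain ⟨u, huG, hu1, hu2⟩ := ((hG s hsI).and_eventually (hs.and (hv s hsI))).exists
    rw [← hu1 huG, hu2 huG]
  rw [h1 x hx hxG, h1 y hy hyG, h2]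

end Count

/-! ### Increments of `μ` and of the counting functions. -/

section Family

variable {H : unitInterval → E →ₗ.[ℂ] E}

/-- The increments of `μ` in a gap are given by the eigenvalue counting functions. -/
theorem IsFlowFamily.mu_eq_add_intervalCount (hH : IsFlowFamily H) (α : unitInterval) {a b : ℝ}
    (hab : a < b) (hα : ∀ t ∈ Icc a b, IsGapAt (H α) t) (h0 : ∀ t ∈ Icc a b, IsGapAt (H 0) t)
    (ha : (a : ℂ) ∈ resolventSet (H α) ∩ resolventSet (H 0)) {x : ℝ} (hxI : x ∈ Icc a b)
    (hx : (x : ℂ) ∈ resolventSet (H α) ∩ resolventSet (H 0)) (θ : Ioo (0 : ℝ) (2 * Real.pi)) :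
    mu θ x (H α) (H 0) =
      mu θ a (H α) (H 0) + (intervalCount (H α) a x - intervalCount (H 0) a x) := by
  set G : Set ℝ := {x | (x : ℂ) ∈ resolventSet (H α) ∩ resolventSet (H 0)} with hG
  set F : ℝ → ℤ := fun x => mu θ x (H α) (H 0) -
    (intervalCount (H α) a x - intervalCount (H 0) a x) with hF
  -- At each point of the gap `μ` and the difference of the counting functions jump by the same
  -- difference of multiplicities, so `F` has the same value on both sides.
  have key : F x = F a := by
    refine eq_of_locally_eq (a := a) (b := b) (G := G) (fun t ht => ?_) (fun t ht => ?_) hxI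
      ⟨le_rfl, hab.le⟩ hx ha
    · obtain ⟨δ, hδ, hρ, hjump⟩ := hH.exists_jump α (hα t ht) (h0 t ht)
      set m := mu θ (t - δ / 2) (H α) (H 0) with hm
      have hmu : ∀ u, t - δ < u → u < t → mu θ u (H α) (H 0) = m := by
        intro u hu1 hu2
        have h1 : ∀ s, t - δ < s → s < t → (s : ℂ) ∈ resolventSet (H α) ∩ resolventSet (H 0) :=
          fun s hs1 hs2 => hρ s hs2.ne (by rw [abs_lt]; constructor <;> linarith)
        rcases le_total u (t - δ / 2) with h2 | h2
        · exact (hH.mu_eq_of_Icc α h2 (fun s hs => h1 s (by linarith [hs.1])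
            (by linarith [hs.2])) θ).symm
        · exact hH.mu_eq_of_Icc α h2 (fun s hs => h1 s (by linarith [hs.1])
            (by linarith [hs.2])) θ
      refine ⟨m - (intervalCount (H α) a t - intervalCount (H 0) a t), ?_⟩
      filter_upwards [eventually_intervalCount_eq (hH.selfAdjoint α) hα ht,
        eventually_intervalCount_eq (hH.selfAdjoint 0) h0 ht,
        inter_mem_nhdsWithin (Icc a b) (Metric.ball_mem_nhds t hδ)] with u h1 h2 h3 huG
      have hu : |u - t| < δ := h3.2
      rw [abs_lt] at hu
      rcases lt_trichotomy u t with hlt | heq | hgt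
      · rw [hF]
        simp only
        rw [h1 hlt.le, h2 hlt.le, hmu u (by linarith) hlt]
      · have hj := hjump (δ / 2) (by linarith) (by linarith) θ
        rw [heq] at huG
        rw [realEigenspace_eq_bot huG.1, realEigenspace_eq_bot huG.2, sub_self, add_zero] at hj
        rw [hF, heq]
        simp only
        rw [hH.mu_eq_of_Icc α (a := t - δ / 2) (b := t) (by linarith) (fun s hs => ?_)]
        rcases hs.2.eq_or_lt with rfl | hst
        · exact huG
        · exact hρ s hst.ne (by rw [abs_lt]; constructor <;> linarith [hs.1])
      · have hbot : ∀ {β : unitInterval}, (∀ s : ℝ, s ≠ t → |s - t| < δ →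
            (s : ℂ) ∈ resolventSet (H β)) → (∀ t ∈ Icc a b, IsGapAt (H β) t) →
            intervalCount (H β) a u = intervalCount (H β) a t +
              Module.finrank ℂ (realEigenspace (H β) t) := by
          intro β h4 h5
          rw [intervalCount_add_of_le (hH.selfAdjoint β) h5 le_rfl ht.1 hgt.le h3.1.2,
            intervalCount_eq_finrank hgt fun s hs => realEigenspace_eq_bot (h4 s hs.1.ne' ?_)]
          rw [abs_lt]
          constructor <;> linarith [hs.1, hs.2]
        have hj := hjump (u - t) (by linarith) (by linarith) θ
        rw [add_sub_cancel, hmu (t - (u - t)) (by linarith) (by linarith)] at hj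
        rw [hF]
        simp only
        rw [hbot (fun s hs1 hs2 => (hρ s hs1 hs2).1) hα,
          hbot (fun s hs1 hs2 => (hρ s hs1 hs2).2) h0, hj]
        ring
    -- Only finitely many points of `[a, b]` are outside `G`, whereas every neighbourhood of `t` in
    -- `[a, b]` contains an open interval.
    · have hfin := (finite_notMem_resolventSet (hH.selfAdjoint α) hα).union
        (finite_notMem_resolventSet (hH.selfAdjoint 0) h0)
      intro hev
      obtain ⟨ε, hε, hsub⟩ := Metric.mem_nhdsWithin_iff.1 hev
      have hlt : max a (t - ε) < min b (t + ε) := by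
        rw [max_lt_iff, lt_min_iff, lt_min_iff]
        exact ⟨⟨hab, by linarith [ht.1]⟩, by linarith [ht.2], by linarith⟩
      refine (Ioo_infinite hlt) (hfin.subset fun s hs => ?_)
      have h1 := max_lt_iff.1 hs.1
      have h2 := lt_min_iff.1 hs.2
      have hsI : s ∈ Icc a b := ⟨h1.1.le, h2.1.le⟩
      have h3 : s ∉ G := hsub ⟨by
        rw [Metric.mem_ball, Real.dist_eq, abs_lt]
        constructor <;> linarith, hsI⟩
      by_cases h4 : (s : ℂ) ∈ resolventSet (H α)
      · exact Or.inr ⟨hsI, fun h5 => h3 ⟨h4, h5⟩⟩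
      · exact Or.inl ⟨hsI, h4⟩
  have hz : ∀ β, intervalCount (H β) a a = 0 := fun β => by
    rw [intervalCount, sub_self]
  rw [hF] at key
  simp only [hz] at key
  linarith

end Family

/-! ### Integer valued functions on an interval -/

section GapFun

variable {Δ : Set ℝ}

theorem isFiniteMeasure_gapMeasure (h : Δ.OrdConnected) (hb : Bornology.IsBounded Δ) :
    IsFiniteMeasure (gapMeasure Δ) := by
  refine ⟨?_⟩
  rw [comap_subtype_coe_apply h.measurableSet]
  obtain ⟨r, hr⟩ := hb.subset_closedBall (0 : ℝ)
  rw [image_univ, Subtype.range_coe]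
  exact (measure_mono hr).trans_lt measure_closedBall_lt_top

theorem ae_gapMeasure_of_finite (h : Δ.OrdConnected) {p : Δ → Prop} (hp : {x | ¬ p x}.Finite) :
    ∀ᵐ x ∂gapMeasure Δ, p x := by
  rw [ae_iff, comap_subtype_coe_apply h.measurableSet]
  exact (hp.image _).measure_zero _

theorem gapMeasure_real_univ_ne_zero (h : Δ.OrdConnected) (hΔ : Δ.Nontrivial)
    (hb : Bornology.IsBounded Δ) : (gapMeasure Δ).real univ ≠ 0 := by
  have := isFiniteMeasure_gapMeasure h hb
  obtain ⟨x, hx, y, hy, hxy⟩ := hΔ.exists_lt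
  rw [measureReal_ne_zero_iff, comap_subtype_coe_apply h.measurableSet, image_univ,
    Subtype.range_coe]
  refine ((?_ : (0 : ℝ≥0∞) < volume (Icc x y)).trans_le (measure_mono (h.out hx hy))).ne'
  rw [Real.volume_Icc]
  simpa using hxy

theorem memLp_of_monotone (h : Δ.OrdConnected) (hb : Bornology.IsBounded Δ) {f : Δ → ℤ}
    (hf : Monotone f) {C : ℤ} (hC : ∀ x, |f x| ≤ C) :
    MemLp (fun x => (f x : ℝ)) 1 (gapMeasure Δ) := by
  have := isFiniteMeasure_gapMeasure h hb
  refine MemLp.of_bound ?_ C (Eventually.of_forall fun x => ?_)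
  · exact (measurable_from_top.comp hf.measurable :
      Measurable (((↑) : ℤ → ℝ) ∘ f)).aestronglyMeasurable
  · rw [Real.norm_eq_abs]
    exact_mod_cast hC x

theorem GapFun.ext' {f g : GapFun Δ} (h : ∀ x, f x = g x) : f = g := by
  cases f
  cases g
  congr
  exact funext h

theorem GapClass.proj_eq_iff {f g : GapFun Δ} :
    GapClass.proj f = GapClass.proj g ↔ ∃ n : ℤ, ∀ x, f x = g x + n :=
  Quotient.eq

theorem GapClass.continuous_proj : Continuous (GapClass.proj : GapFun Δ → GapClass Δ) :=
  continuous_quotient_mk'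

/-- The inclusion of `GapFun Δ` into `L_1(Δ)`. -/
def GapFun.toL1 (f : GapFun Δ) : Lp ℝ 1 (gapMeasure Δ) := f.memLp'.toLp _

theorem GapFun.isInducing_toL1 : IsInducing (GapFun.toL1 : GapFun Δ → Lp ℝ 1 (gapMeasure Δ)) :=
  ⟨rfl⟩

/-- Convergence in `L_1` of functions that are locally constant in the parameter. -/
theorem tendsto_toLp_of_eventually_eq {Ω ι : Type*} [MeasurableSpace Ω] {μ : Measure Ω}
    [IsFiniteMeasure μ] {l : Filter ι} [l.IsCountablyGenerated] {F : ι → Ω → ℝ} {f : Ω → ℝ}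
    (hF : ∀ i, MemLp (F i) 1 μ) (hf : MemLp f 1 μ) {C : ℝ}
    (hC : ∀ᶠ i in l, ∀ᵐ x ∂μ, |F i x - f x| ≤ C) (hlim : ∀ᵐ x ∂μ, ∀ᶠ i in l, F i x = f x) :
    Tendsto (fun i => (hF i).toLp (F i)) l (𝓝 (hf.toLp f)) := by
  rw [tendsto_iff_dist_tendsto_zero]
  have h1 : ∀ i, dist ((hF i).toLp (F i)) (hf.toLp f) = ∫ x, |F i x - f x| ∂μ := by
    intro i
    rw [L1.dist_eq_integral_dist]
    refine integral_congr_ae ?_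
    filter_upwards [(hF i).coeFn_toLp, hf.coeFn_toLp] with x h2 h3
    rw [h2, h3, Real.dist_eq]
  simp only [h1]
  have h2 := tendsto_integral_filter_of_dominated_convergence (μ := μ) (l := l)
    (F := fun i x => |F i x - f x|) (f := fun _ => (0 : ℝ)) (fun _ => C)
    (Eventually.of_forall fun i =>
      ((hF i).aestronglyMeasurable.sub hf.aestronglyMeasurable).norm)
    (hC.mono fun i hi => hi.mono fun x hx => by simpa using hx)
    (integrable_const C)
    (hlim.mono fun x hx => tendsto_const_nhds.congr' (hx.mono fun i hi => by simp [hi]))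
  simpa using h2

end GapFun

/-- A bounded nondegenerate interval whose closure does not meet the essential spectrum. -/
structure IsGapInterval (A : E →ₗ.[ℂ] E) (Δ : Set ℝ) : Prop where
  ordConnected : Δ.OrdConnected
  nontrivial : Δ.Nontrivial
  isBounded : Bornology.IsBounded Δ
  disjoint : Disjoint (closure Δ) (essSpectrum A)

theorem exists_Icc_closure_eq {Δ : Set ℝ} (h : Δ.OrdConnected) (hΔ : Δ.Nontrivial)
    (hb : Bornology.IsBounded Δ) :
    ∃ a b, a < b ∧ Δ ⊆ Icc a b ∧ Icc a b ⊆ closure Δ := by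
  obtain ⟨x, hx, y, hy, hxy⟩ := hΔ.exists_lt
  have h1 := csInf_le hb.bddBelow hx
  have h2 := le_csSup hb.bddAbove hy
  have hlt : sInf Δ < sSup Δ := by linarith
  refine ⟨sInf Δ, sSup Δ, hlt, fun z hz => ⟨csInf_le hb.bddBelow hz, le_csSup hb.bddAbove hz⟩, ?_⟩
  rw [← closure_Ioo hlt.ne]
  refine closure_mono fun z hz => ?_
  obtain ⟨u, hu, huz⟩ := exists_lt_of_csInf_lt ⟨x, hx⟩ hz.1
  obtain ⟨v, hv, hzv⟩ := exists_lt_of_lt_csSup ⟨x, hx⟩ hz.2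
  exact h.out hu hv ⟨huz.le, hzv.le⟩

section Count

variable {A : E →ₗ.[ℂ] E} {a b : ℝ} {Δ : Set ℝ}

/-- The function `x ↦ N(l, x; A) + c` on an interval in a gap. -/
def countGapFun (hA : IsSelfAdjoint A) (hgap : ∀ t ∈ Icc a b, IsGapAt A t) (hΔ : Δ.OrdConnected)
    (hs : Δ ⊆ Icc a b) {l : ℝ} (hl : l ∈ Icc a b) (c : ℤ) : GapFun Δ :=
  have hmono : Monotone fun x : Δ => intervalCount A l x + c := by
    intro x y hxy
    simp only
    rw [intervalCount_eq_sub hA hgap hl (hs x.2), intervalCount_eq_sub hA hgap hl (hs y.2)]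
    have := intervalCount_monotoneOn hA hgap (hs x.2) (hs y.2) hxy
    linarith
  have hbdd : ∀ x : Δ, |intervalCount A l x + c| ≤
      intervalCount A a b + |c - intervalCount A a l| := by
    intro x
    have hx := hs x.2
    have h1 := intervalCount_nonneg (A := A) hx.1
    have h2 := intervalCount_monotoneOn hA hgap hx ⟨hx.1.trans hx.2, le_rfl⟩ hx.2
    rw [intervalCount_eq_sub hA hgap hl hx, sub_add_eq_add_sub, add_sub_assoc]
    refine (abs_add_le _ _).trans ?_
    rw [abs_of_nonneg h1]
    linarith
  { toFun x := intervalCount A l x + c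
    monotone' := hmono
    leftCont' x := by
      refine (continuousWithinAt_const (b := intervalCount A l x + c)).congr_of_eventuallyEq ?_ rfl
      have h1 := eventually_intervalCount_eq hA hgap (hs x.2)
      have h2 : Tendsto (Subtype.val : Δ → ℝ) (𝓝[≤] x) (𝓝[Icc a b] (x : ℝ)) :=
        tendsto_nhdsWithin_iff.2 ⟨continuous_subtype_val.continuousAt.mono_left nhdsWithin_le_nhds,
          Eventually.of_forall fun y => hs y.2⟩
      filter_upwards [h2.eventually h1, self_mem_nhdsWithin] with y hy hyx
      rw [intervalCount_eq_sub hA hgap hl (hs x.2), intervalCount_eq_sub hA hgap hl (hs y.2),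
        hy hyx]
    bounded' := ⟨_, hbdd⟩
    memLp' := memLp_of_monotone hΔ (Metric.isBounded_Icc a b |>.subset hs) hmono hbdd }

end Count

/-! ### Lifting the counting functions of the family, and comparison with `μ`. -/

section Family

variable {H : unitInterval → E →ₗ.[ℂ] E} {Δ : Set ℝ}

theorem IsFlowFamily.isGapAt (hH : IsFlowFamily H) {t : ℝ} (ht : t ∉ essSpectrum (H 0))
    (α : unitInterval) : IsGapAt (H α) t :=
  isGapAt_of_compact (hH.selfAdjoint 0) (hH.selfAdjoint α) ht (hH.compact _ (by simp) α)

/-- The ends of `Δ` may be eigenvalues. As these are isolated, the interval can be enlarged so that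
its new ends lie in both resolvent sets, where `μ` is locally constant in `α`. -/
theorem IsFlowFamily.exists_Icc (hH : IsFlowFamily H) (hΔ : IsGapInterval (H 0) Δ)
    (α₀ : unitInterval) : ∃ a b, a < b ∧ Δ ⊆ Icc a b ∧
      (∀ α, ∀ t ∈ Icc a b, IsGapAt (H α) t) ∧
      (a : ℂ) ∈ resolventSet (H α₀) ∩ resolventSet (H 0) ∧
      (b : ℂ) ∈ resolventSet (H α₀) ∩ resolventSet (H 0) := by
  obtain ⟨a, b, hab, hs, hc⟩ :=
    exists_Icc_closure_eq hΔ.ordConnected hΔ.nontrivial hΔ.isBounded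
  have hgap : ∀ t ∈ Icc a b, ∀ α, IsGapAt (H α) t := fun t ht =>
    hH.isGapAt (disjoint_left.1 hΔ.disjoint (hc ht))
  have hnear : ∀ t ∈ Icc a b, ∃ δ > 0, ∀ s : ℝ, s ≠ t → |s - t| < δ →
      (s : ℂ) ∈ resolventSet (H α₀) ∩ resolventSet (H 0) := by
    intro t ht
    obtain ⟨δ₁, hδ₁, h1⟩ := (hgap t ht α₀).exists_punctured (hH.selfAdjoint α₀)
    obtain ⟨δ₂, hδ₂, h2⟩ := (hgap t ht 0).exists_punctured (hH.selfAdjoint 0)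
    exact ⟨min δ₁ δ₂, lt_min hδ₁ hδ₂, fun s hs hst =>
      ⟨h1 s hs (hst.trans_le (min_le_left _ _)), h2 s hs (hst.trans_le (min_le_right _ _))⟩⟩
  obtain ⟨δ, hδ, h1⟩ := hnear a ⟨le_rfl, hab.le⟩
  obtain ⟨ε, hε, h2⟩ := hnear b ⟨hab.le, le_rfl⟩
  have h1' : ∀ s, a - δ / 2 ≤ s → s < a → (s : ℂ) ∈ resolventSet (H α₀) ∩ resolventSet (H 0) :=
    fun s hs hsa => h1 s hsa.ne (by rw [abs_lt]; constructor <;> linarith)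
  have h2' : ∀ s, b < s → s ≤ b + ε / 2 → (s : ℂ) ∈ resolventSet (H α₀) ∩ resolventSet (H 0) :=
    fun s hs hsa => h2 s hs.ne' (by rw [abs_lt]; constructor <;> linarith)
  refine ⟨a - δ / 2, b + ε / 2, by linarith, fun x hx => ?_, fun α t ht => ?_,
    h1' _ le_rfl (by linarith), h2' _ (by linarith) le_rfl⟩
  · have := hs hx
    exact ⟨by linarith [this.1], by linarith [this.2]⟩
  -- The added points lie in the resolvent set of `H(0)`, hence off the essential spectrum. They are
  -- gap points for every `α`, although the choice of the ends depends on `α₀`.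
  · have hess : ∀ s : ℝ, (s : ℂ) ∈ resolventSet (H 0) → s ∉ essSpectrum (H 0) :=
      fun s hs h => h.1 hs
    rcases lt_or_ge t a with hta | hta
    · exact hH.isGapAt (hess t (h1' t ht.1 hta).2) α
    rcases lt_or_ge b t with htb | htb
    · exact hH.isGapAt (hess t (h2' t htb ht.2).2) α
    exact hgap t ⟨hta, htb⟩ α

theorem IsFlowFamily.finite_notMem (hH : IsFlowFamily H) (hΔ : IsGapInterval (H 0) Δ)
    (α : unitInterval) :
    {x : Δ | ¬ (x : ℂ) ∈ resolventSet (H α) ∩ resolventSet (H 0)}.Finite := by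
  obtain ⟨a, b, hab, hs, hgap, -, -⟩ := hH.exists_Icc hΔ α
  have hfin := (finite_notMem_resolventSet (hH.selfAdjoint α) (hgap α)).union
    (finite_notMem_resolventSet (hH.selfAdjoint 0) (hgap 0))
  refine (hfin.preimage (f := Subtype.val) Subtype.val_injective.injOn).subset fun x hx => ?_
  by_cases h : (x : ℂ) ∈ resolventSet (H α)
  · exact Or.inr ⟨hs x.2, fun h' => hx ⟨h, h'⟩⟩
  · exact Or.inl ⟨hs x.2, h⟩

theorem IsFlowFamily.exists_mem (hH : IsFlowFamily H) (hΔ : IsGapInterval (H 0) Δ)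
    (α : unitInterval) : ∃ l : Δ, (l : ℂ) ∈ resolventSet (H α) ∩ resolventSet (H 0) := by
  by_contra! hc
  obtain ⟨x, hx, y, hy, hxy⟩ := hΔ.nontrivial.exists_lt
  have h1 : (univ : Set Δ).Finite :=
    (hH.finite_notMem hΔ α).subset fun l _ => hc l
  have h2 : Δ.Finite := by
    simpa using h1.image (Subtype.val : Δ → ℝ)
  exact Icc_infinite hxy (h2.subset (hΔ.ordConnected.out hx hy))

/-- The increment of `μ` between two points of `Δ`. -/
theorem IsFlowFamily.mu_sub_mu (hH : IsFlowFamily H) (hΔ : IsGapInterval (H 0) Δ)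
    (α : unitInterval) {l x : ℝ} (hlΔ : l ∈ Δ) (hxΔ : x ∈ Δ)
    (hl : (l : ℂ) ∈ resolventSet (H α) ∩ resolventSet (H 0))
    (hx : (x : ℂ) ∈ resolventSet (H α) ∩ resolventSet (H 0)) (θ : Ioo (0 : ℝ) (2 * Real.pi)) :
    mu θ x (H α) (H 0) - mu θ l (H α) (H 0) =
      intervalCount (H α) l x - intervalCount (H 0) l x := by
  obtain ⟨a, b, hab, hs, hgap, ha, -⟩ := hH.exists_Icc hΔ α
  rw [hH.mu_eq_add_intervalCount α hab (hgap α) (hgap 0) ha (hs hxΔ) hx,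
    hH.mu_eq_add_intervalCount α hab (hgap α) (hgap 0) ha (hs hlΔ) hl,
    intervalCount_eq_sub (hH.selfAdjoint α) (hgap α) (hs hlΔ) (hs hxΔ),
    intervalCount_eq_sub (hH.selfAdjoint 0) (hgap 0) (hs hlΔ) (hs hxΔ)]
  ring

theorem IsFlowFamily.intervalCount_add (hH : IsFlowFamily H) (hΔ : IsGapInterval (H 0) Δ)
    (α : unitInterval) {l m x : ℝ} (hl : l ∈ Δ) (hm : m ∈ Δ) (hx : x ∈ Δ) :
    intervalCount (H α) l m + intervalCount (H α) m x = intervalCount (H α) l x := by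
  obtain ⟨a, b, hab, hs, hgap, -, -⟩ := hH.exists_Icc hΔ α
  rw [intervalCount_eq_sub (hH.selfAdjoint α) (hgap α) (hs hl) (hs hm),
    intervalCount_eq_sub (hH.selfAdjoint α) (hgap α) (hs hm) (hs hx),
    intervalCount_eq_sub (hH.selfAdjoint α) (hgap α) (hs hl) (hs hx)]
  ring

theorem IsFlowFamily.exists_gapFun (hH : IsFlowFamily H) (hΔ : IsGapInterval (H 0) Δ)
    (α : unitInterval) {l : ℝ} (hl : l ∈ Δ) (c : ℤ) :
    ∃ f : GapFun Δ, ∀ x, f x = intervalCount (H α) l x + c := by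
  obtain ⟨a, b, hab, hs, hgap, -, -⟩ := hH.exists_Icc hΔ α
  exact ⟨countGapFun (hH.selfAdjoint α) (hgap α) hΔ.ordConnected hs (hs hl) c, fun _ => rfl⟩

/-- The function `μ` differs from an eigenvalue counting function of `H(α)` by an eigenvalue
counting function of `H(0)`. -/
theorem IsFlowFamily.exists_gapFun_mu (hH : IsFlowFamily H) (hΔ : IsGapInterval (H 0) Δ)
    {l₀ : ℝ} (hl₀ : l₀ ∈ Δ) (θ : Ioo (0 : ℝ) (2 * Real.pi)) (α : unitInterval) :
    ∃ f : GapFun Δ, IsCountClass Δ (H α) (GapClass.proj f) ∧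
      ∀ x : Δ, (x : ℂ) ∈ resolventSet (H α) ∩ resolventSet (H 0) →
        f x = mu θ x (H α) (H 0) + intervalCount (H 0) l₀ x := by
  obtain ⟨l, hl⟩ := hH.exists_mem hΔ α
  -- The constant gives `f` the required value at `l`, where `N(l, l) = 0`. Equal increments then
  -- give the required value at all other common resolvent points.
  obtain ⟨f, hf⟩ := hH.exists_gapFun hΔ α l.2
    (mu θ l (H α) (H 0) + intervalCount (H 0) l₀ l)
  refine ⟨f, ⟨⟨l, l.2, hl.1⟩, fun m hm hmρ => ?_⟩, fun x hx => ?_⟩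
  · obtain ⟨g, hg⟩ := hH.exists_gapFun hΔ α hm 0
    refine ⟨g, fun x => by rw [hg, add_zero], GapClass.proj_eq_iff.2
      ⟨intervalCount (H α) m l - (mu θ l (H α) (H 0) + intervalCount (H 0) l₀ l), fun x => ?_⟩⟩
    rw [hg, hf, ← hH.intervalCount_add hΔ α hm l.2 x.2]
    ring
  · have h1 := hH.mu_sub_mu hΔ α l.2 x.2 hl hx θ
    have h2 := hH.intervalCount_add hΔ 0 hl₀ l.2 x.2
    rw [hf]
    linarith

/-- The existence of a point `l₀` is part of `IsCountClass`; without it the condition could hold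
vacuously and determine nothing. -/
theorem IsCountClass.unique {A : E →ₗ.[ℂ] E} {c c' : GapClass Δ} (h : IsCountClass Δ A c)
    (h' : IsCountClass Δ A c') : c = c' := by
  obtain ⟨l, hl, hlr⟩ := h.1
  obtain ⟨f, hf, rfl⟩ := h.2 l hl hlr
  obtain ⟨f', hf', rfl⟩ := h'.2 l hl hlr
  rw [GapFun.ext' fun x => (hf x).trans (hf' x).symm]

/-- Two lifts differ by a constant. -/
theorem IsGapLift.exists_eq_add (hΔ : Δ.OrdConnected) (hΔn : Δ.Nontrivial)
    (hΔb : Bornology.IsBounded Δ) {g g' : C(unitInterval, GapFun Δ)} (hg : IsGapLift Δ H g)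
    (hg' : IsGapLift Δ H g') : ∃ n : ℤ, ∀ α x, g α x = g' α x + n := by
  obtain ⟨γ, hγ, hgγ⟩ := hg
  obtain ⟨γ', hγ', hgγ'⟩ := hg'
  choose n hn using fun α => GapClass.proj_eq_iff.1
    ((hgγ α).trans (((hγ α).unique (hγ' α)).trans (hgγ' α).symm))
  have hfin := isFiniteMeasure_gapMeasure hΔ hΔb
  have h1 : Continuous fun α => ((g α).toL1 - (g' α).toL1 : Lp ℝ 1 (gapMeasure Δ)) :=
    (GapFun.isInducing_toL1.continuous.comp g.continuous).sub
      (GapFun.isInducing_toL1.continuous.comp g'.continuous)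
  -- The difference of the lifts at `α` is the constant `n α`, with integral `|Δ| n(α)`. Continuity
  -- in `L_1` and `|Δ| > 0` make the integer `n` continuous in `α`, hence constant.
  have h2 : ∀ α, ∫ x, ((g α).toL1 - (g' α).toL1 : Lp ℝ 1 (gapMeasure Δ)) x ∂gapMeasure Δ =
      (gapMeasure Δ).real univ * n α := by
    intro α
    have h3 : ∀ᵐ x ∂gapMeasure Δ,
        ((g α).toL1 - (g' α).toL1 : Lp ℝ 1 (gapMeasure Δ)) x = (n α : ℝ) := by
      filter_upwards [Lp.coeFn_sub (g α).toL1 (g' α).toL1, (g α).memLp'.coeFn_toLp,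
        (g' α).memLp'.coeFn_toLp] with x e1 e2 e3
      rw [e1, Pi.sub_apply, GapFun.toL1, GapFun.toL1, e2, e3, hn α x]
      push_cast
      ring
    rw [integral_congr_ae h3, integral_const, smul_eq_mul]
  have h3 : Continuous n := by
    rw [Int.isClosedEmbedding_coe_real.isInducing.continuous_iff]
    have h4 := (continuous_integral.comp h1).const_mul ((gapMeasure Δ).real univ)⁻¹
    refine h4.congr fun α => ?_
    have h5 := h2 α
    simp only [Function.comp_apply]
    rw [h5, inv_mul_cancel_left₀ (gapMeasure_real_univ_ne_zero hΔ hΔn hΔb)]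
  refine ⟨n 0, fun α x => ?_⟩
  rw [hn α x, PreconnectedSpace.constant inferInstance h3 (x := α) (y := 0)]

theorem IsGapLift.gapFlow_eq (hΔ : Δ.OrdConnected) (hΔn : Δ.Nontrivial)
    (hΔb : Bornology.IsBounded Δ) {g : C(unitInterval, GapFun Δ)} (hg : IsGapLift Δ H g) (x : Δ) :
    gapFlow Δ H x = g 1 x - g 0 x := by
  have hex : ∃ g, IsGapLift Δ H g := ⟨g, hg⟩
  obtain ⟨n, hn⟩ := hex.choose_spec.exists_eq_add hΔ hΔn hΔb hg
  rw [gapFlow, dif_pos hex, hn, hn]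
  ring

/-- Functions that agree with `μ` up to a fixed function off the spectra depend continuously on the
parameter. -/
theorem IsFlowFamily.continuous_gapFun (hH : IsFlowFamily H) (hΔ : IsGapInterval (H 0) Δ)
    {l₀ : ℝ} {θ : Ioo (0 : ℝ) (2 * Real.pi)} {f : unitInterval → GapFun Δ}
    (hf : ∀ α, ∀ x : Δ, (x : ℂ) ∈ resolventSet (H α) ∩ resolventSet (H 0) →
      f α x = mu θ x (H α) (H 0) + intervalCount (H 0) l₀ x) : Continuous f := by
  have hfin := isFiniteMeasure_gapMeasure hΔ.ordConnected hΔ.isBounded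
  have hae : ∀ α, ∀ᵐ x : Δ ∂gapMeasure Δ, (x : ℂ) ∈ resolventSet (H α) ∩ resolventSet (H 0) :=
    fun α => ae_gapMeasure_of_finite hΔ.ordConnected (hH.finite_notMem hΔ α)
  rw [GapFun.isInducing_toL1.continuous_iff, continuous_iff_continuousAt]
  intro α₀
  obtain ⟨a, b, hab, hs, hgap, ha, hb⟩ := hH.exists_Icc hΔ α₀
  refine tendsto_toLp_of_eventually_eq (fun α => (f α).memLp') (f α₀).memLp'
    (C := intervalCount (H α₀) a b) ?_ ?_
  · filter_upwards [hH.eventually_mem_resolventSet ha.1, hH.eventually_mem_resolventSet hb.1,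
      hH.eventually_mu_eq ha.1 ha.2, hH.eventually_mu_eq hb.1 hb.2] with α h1 h2 h3 h4
    -- For `α` near `α₀` no eigenvalue crosses the ends: `μ` is locally constant at `a` and at `b`,
    -- so the total count in `[a, b)` does not change. It serves as the dominating constant.
    have hN : intervalCount (H α) a b = intervalCount (H α₀) a b := by
      have h5 := hH.mu_eq_add_intervalCount α hab (hgap α) (hgap 0) ⟨h1, ha.2⟩
        ⟨hab.le, le_rfl⟩ ⟨h2, hb.2⟩ θ
      have h6 := hH.mu_eq_add_intervalCount α₀ hab (hgap α₀) (hgap 0) ha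
        ⟨hab.le, le_rfl⟩ hb θ
      rw [h3, h4] at h5
      linarith
    filter_upwards [hae α, hae α₀] with x hx hx₀
    have hxI := hs x.2
    have hbI : b ∈ Icc a b := ⟨hab.le, le_rfl⟩
    have h5 := hH.mu_eq_add_intervalCount α hab (hgap α) (hgap 0) ⟨h1, ha.2⟩ hxI hx θ
    have h6 := hH.mu_eq_add_intervalCount α₀ hab (hgap α₀) (hgap 0) ha hxI hx₀ θ
    have h7 := intervalCount_nonneg (A := H α) hxI.1
    have h8 := intervalCount_nonneg (A := H α₀) hxI.1
    have h9 := intervalCount_monotoneOn (hH.selfAdjoint α) (hgap α) hxI hbI hxI.2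
    have h10 := intervalCount_monotoneOn (hH.selfAdjoint α₀) (hgap α₀) hxI hbI hxI.2
    have h11 : |f α x - f α₀ x| ≤ intervalCount (H α₀) a b := by
      rw [hf α x hx, hf α₀ x hx₀, h5, h6, h3, abs_le]
      constructor <;> linarith
    exact_mod_cast h11
  -- For all but finitely many `x` the values at `x` are even constant for `α` near `α₀`.
  · filter_upwards [hae α₀] with x hx
    filter_upwards [hH.eventually_mem_resolventSet hx.1, hH.eventually_mu_eq hx.1 hx.2] with α h1 h2
    rw [hf α x ⟨h1, hx.2⟩, hf α₀ x hx, h2]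

/-- A lift of the eigenvalue counting functions that represents `μ`. -/
theorem IsFlowFamily.exists_isGapLift (hH : IsFlowFamily H) (hΔ : IsGapInterval (H 0) Δ)
    {l₀ : ℝ} (hl₀ : l₀ ∈ Δ) (θ : Ioo (0 : ℝ) (2 * Real.pi)) :
    ∃ g : C(unitInterval, GapFun Δ), IsGapLift Δ H g ∧
      ∀ α, ∀ x : Δ, (x : ℂ) ∈ resolventSet (H α) ∩ resolventSet (H 0) →
        g α x = mu θ x (H α) (H 0) + intervalCount (H 0) l₀ x := by
  choose f hf1 hf2 using hH.exists_gapFun_mu hΔ hl₀ θ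
  have hc := hH.continuous_gapFun hΔ hf2
  exact ⟨⟨f, hc⟩, ⟨⟨_, GapClass.continuous_proj.comp hc⟩, hf1, fun _ => rfl⟩, hf2⟩

/-- Almost everywhere `μ` is the continuous lift minus the fixed function `N(l₀, ·; H(0))`, so
integrability and continuity are inherited. -/
theorem IsFlowFamily.exists_continuous_toLp_mu (hH : IsFlowFamily H) (hΔ : IsGapInterval (H 0) Δ)
    (θ : Ioo (0 : ℝ) (2 * Real.pi)) :
    ∃ hμ : ∀ α, MemLp (fun x : Δ => (mu θ x (H α) (H 0) : ℝ)) 1 (gapMeasure Δ),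
      Continuous fun α => (hμ α).toLp _ := by
  obtain ⟨l₀, hl₀⟩ := hΔ.nontrivial.nonempty
  obtain ⟨g, -, hg⟩ := hH.exists_isGapLift hΔ hl₀ θ
  obtain ⟨q, hq⟩ := hH.exists_gapFun hΔ 0 hl₀ 0
  have hae : ∀ α, (fun x : Δ => (g α x : ℝ) - q x) =ᵐ[gapMeasure Δ]
      fun x : Δ => (mu θ x (H α) (H 0) : ℝ) := by
    intro α
    filter_upwards [ae_gapMeasure_of_finite hΔ.ordConnected (hH.finite_notMem hΔ α)] with x hx
    rw [hg α x hx, hq]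
    push_cast
    ring
  have hμ : ∀ α, MemLp (fun x : Δ => (mu θ x (H α) (H 0) : ℝ)) 1 (gapMeasure Δ) := fun α =>
    ((g α).memLp'.sub q.memLp').ae_eq (hae α)
  refine ⟨hμ, ?_⟩
  have h1 : Continuous fun α => ((g α).toL1 - q.toL1 : Lp ℝ 1 (gapMeasure Δ)) :=
    (GapFun.isInducing_toL1.continuous.comp g.continuous).sub continuous_const
  refine h1.congr fun α => ?_
  rw [GapFun.toL1, GapFun.toL1, ← MemLp.toLp_sub, MemLp.toLp_eq_toLp_iff]
  exact hae α

/-- The increment may be computed with the lift that represents `μ`. The counting function of `H(0)`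
cancels, and `μ` is zero at `α = 0` because `M(z; H(0), H(0)) = I`. -/
theorem IsFlowFamily.mu_eq_gapFlow (hH : IsFlowFamily H) (hΔ : IsGapInterval (H 0) Δ)
    (θ : Ioo (0 : ℝ) (2 * Real.pi)) (x : Δ)
    (hx : (x : ℂ) ∈ resolventSet (H 0) ∩ resolventSet (H 1)) :
    mu θ x (H 1) (H 0) = gapFlow Δ H x := by
  obtain ⟨g, hg, hgμ⟩ := hH.exists_isGapLift hΔ x.2 θ
  rw [hg.gapFlow_eq hΔ.ordConnected hΔ.nontrivial hΔ.isBounded, hgμ 1 x ⟨hx.2, hx.1⟩,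
    hgμ 0 x ⟨hx.1, hx.1⟩, mu_self (hH.selfAdjoint 0)]
  ring

end Family

end PushFlow

end

theorem theoremi3 {E : Type*} [NormedAddCommGroup E] [InnerProductSpace ℂ E] [CompleteSpace E]
    (H : unitInterval → E →ₗ.[ℂ] E) (hsa : ∀ α, IsSelfAdjoint (H α))
    (hcompact : ∀ z : ℂ, 0 < z.im → ∀ α,
      IsCompactOperator ⇑(PushFlow.res (H α) z - PushFlow.res (H 0) z))
    (hcont : ∀ z : ℂ, 0 < z.im → Continuous fun α => PushFlow.res (H α) z)
    (hdecay : ∀ l : ℝ, Tendsto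
      (fun y : ℝ => ⨆ α : unitInterval, y * ‖PushFlow.res (H α) (l + y * Complex.I) -
        PushFlow.res (H 0) (l + y * Complex.I)‖) atTop (𝓝 0))
    (Δ : Set ℝ) (hΔ : Δ.OrdConnected) (hΔ_nontrivial : Δ.Nontrivial)
    (hΔ_bounded : Bornology.IsBounded Δ)
    (hΔ_gap : Disjoint (closure Δ) (PushFlow.essSpectrum (H 0))) :
    -- `μ(·; l, H(α), H(0))` is well defined for all `α ∈ [0, 1]` and `l ∈ Δ`
    (∀ α, ∀ l ∈ Δ, PushFlow.MuDefined (H α) (H 0) l) ∧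
    -- `α ↦ μ(θ; ·, H(α), H(0))` is a continuous mapping into `L_1(Δ)`
    (∀ θ, ∃ hμ : ∀ α, MemLp (fun x : Δ => (PushFlow.mu θ x (H α) (H 0) : ℝ)) 1
      (PushFlow.gapMeasure Δ),
      Continuous fun α => (hμ α).toLp _) ∧
    -- the spectral flow of the family in the gap is well defined
    (∃ g, PushFlow.IsGapLift Δ H g) ∧
    -- it equals `μ` off the eigenvalues of `H(0)` and `H(1)`, which are finite in number in `Δ`
    {x : Δ | (x : ℂ) ∉ PushFlow.resolventSet (H 0) ∩ PushFlow.resolventSet (H 1)}.Finite ∧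
    ∀ θ, ∀ x : Δ, (x : ℂ) ∈ PushFlow.resolventSet (H 0) ∩ PushFlow.resolventSet (H 1) →
      PushFlow.mu θ x (H 1) (H 0) = PushFlow.gapFlow Δ H x := by
  have hH : PushFlow.IsFlowFamily H := ⟨hsa, hcompact, hcont, hdecay⟩
  have hG : PushFlow.IsGapInterval (H 0) Δ := ⟨hΔ, hΔ_nontrivial, hΔ_bounded, hΔ_gap⟩
  have hgap : ∀ l ∈ Δ, ∀ α, PushFlow.IsGapAt (H α) l := fun l hl =>
    hH.isGapAt (disjoint_left.1 hΔ_gap (subset_closure hl))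
  refine ⟨fun α l hl => hH.muDefined α (hgap l hl α) (hgap l hl 0),
    hH.exists_continuous_toLp_mu hG, ?_, ?_, fun θ x hx => hH.mu_eq_gapFlow hG θ x hx⟩
  · obtain ⟨l, hl⟩ := hΔ_nontrivial.nonempty
    -- Every `θ` yields a lift; `π` is an arbitrary choice.
    obtain ⟨g, hg, -⟩ := hH.exists_isGapLift hG hl
      ⟨Real.pi, Real.pi_pos, by linarith [Real.pi_pos]⟩
    exact ⟨g, hg⟩
  · exact (hH.finite_notMem hG 1).subset fun x hx h => hx h.symm
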